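/- **Definitions.** Let the variables be the natural numbers. A *clause* is a finite set of literals (variables or negated variables) containing no complementary pair; a *clause-set* is a finite set of clauses, read as a CNF (conjunction of disjunctions). Write $\bot$ for the empty clause, $\top$ for the empty clause-set, $\mathrm{lit}(F)$ for the set of literals whose variable occurs in $F$, $c(F)=|F|$ and $\ell(F)=\sum_{C\in F}|C|$. For a partial assignment $\varphi$, $\varphi * F$ is obtained from $F$ by removing the satisfied clauses and then removing the falsified literals from the remaining clauses; for a clause $C$, $\varphi_C$ is the partial assignment setting exactly the literals of $C$ to $0$. The maps $r_k$, $k\in\mathbb N_0$, on clause-sets are defined by $r_0(F)=\{\bot\}$ if $\bot\in F$ and $r_0(F)=F$ otherwise; $r_{k+1}(F)=r_{k+1}(\langle x\to1\rangle * F)$ if there is $x\in\mathrm{lit}(F)$ with $r_k(\langle x\to 0\rangle * F)=\{\bot\}$ (any such $x$ may be chosen), and $r_{k+1}(F)=F$ otherwise. The *hardness* $\mathrm{hd}(F)$ is the least $k\in\mathbb N_0$ such that every clause $C$ with $F\models C$ satisfies $r_k(\varphi_C * F)=\{\bot\}$. For $k\in\mathbb N_0\cup\{\infty\}$, $F$ is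 a *$k$-base* if $\mathrm{hd}(F)\le k$ and every $F'$ obtained from $F$ by removing one clause or one literal occurrence is not equivalent to $F$ or has $\mathrm{hd}(F')>k$. A *shortest* $k$-base for $F$ (w.r.t. $c$ or $\ell$) is a $k$-base equivalent to $F$ which minimises $c$ (resp. $\ell$) among all $k$-bases equivalent to $F$. A *prime implicate* of $F$ is a clause $C$ with $F\models C$ and $F\not\models C'$ for all $C'\subsetneq C$; $\mathrm{prc}_0(F)$ is the set of all of them. A literal $x$ is *forced* for $F$ if $F\models x$. **Theorem.** Clause-sets are given as lists of clauses, with variable names in binary. For every $k\in\mathbb N_0\cup\{\infty\}$ there is a polynomial-time algorithm which, for every input clause-set $F$ all of whose clauses have length at most $2$, computes an equivalent $k$-base $F'$ that is shortest both with respect to the number of clauses $c$ and with respect to the number of literal occurrences $\ell$; one and the same algorithm serves all $k\ge1$. Moreover, for every such $F$ and all $k\in\mathbb N_0\cup\{\infty\}$: 1. If $F$ is unsatisfiable, then $\{\bot\}$ is a shortest $k$-base for $F$ (for both measures). 2. If $F=\top$, then $\top$ is a shortest $k$-base for $F$ (for both measures). 3. If $F$ is satisfiable and $x$ is a forced literal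 for $F$, then every $k$-base equivalent to $F$ contains $\{x\}$, and if $G$ is a shortest $k$-base for $\langle x\to1\rangle * F$, then $G\cup\{\{x\}\}$ is a shortest $k$-base for $F$ (for each of the two measures). If $F$ is satisfiable and has no forced literal, then all clauses of $F$ and of $\mathrm{prc}_0(F)$ have length exactly $2$. 4. Every $k$-base equivalent to $F$ is a subset of $\mathrm{prc}_0(F)$, and the shortest $k$-bases for $F$ with respect to $c$ are the same as those with respect to $\ell$. 5. All prime implicates of $F$ have length at most $2$, and $\mathrm{prc}_0(F)$ is the unique $0$-base equivalent to $F$ (so the algorithm for $k=0$ computes $\mathrm{prc}_0(F)$ in polynomial time). 6. Every $\infty$-base equivalent to $F$ is a $1$-base, and for $k\ge1$ the shortest $k$-bases for $F$ are precisely the smallest (in number of clauses) subsets of $\mathrm{prc}_0(F)$ equivalent to $F$ (so these can be computed in polynomial time). -/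

import Mathlib

namespace KBase

/-! ### Literals, clauses, clause-sets -/

/-- A literal over the variables `ℕ`: `(v, true)` is the variable `v`, `(v, false)` its negation. -/
abbrev Literal : Type := ℕ × Bool

/-- The complement of a literal. -/
def compl (x : Literal) : Literal := (x.1, !x.2)

/-- `C` is a clause: a finite set of literals without clashes. -/
def IsClause (C : Finset Literal) : Prop := ∀ x ∈ C, compl x ∉ C

/-- A finite set of finite sets of literals; see `IsClauseSet` for the condition that its
elements are clauses. -/
abbrev ClauseSet : Type := Finset (Finset Literal)

/-- All elements of `F` are clauses. -/
def IsClauseSet (F : ClauseSet) : Prop := ∀ C ∈ F, IsClause C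

/-- `F` is a clause-set all of whose clauses have length at most 2. -/
def IsTwoCNF (F : ClauseSet) : Prop := IsClauseSet F ∧ ∀ C ∈ F, C.card ≤ 2

/-- The variables of a clause-set. -/
def vars (F : ClauseSet) : Finset ℕ := F.biUnion fun C => C.image Prod.fst

/-- The literals occurring in `F` in at least one polarity. -/
def lits (F : ClauseSet) : Finset Literal := F.biUnion fun C => C ∪ C.image compl

/-- The number of clauses. -/
def numClauses (F : ClauseSet) : ℕ := F.card

/-- The number of literal occurrences. -/
def numLitOcc (F : ClauseSet) : ℕ := ∑ C ∈ F, C.card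

/-! ### Semantics (CNF-interpretation) -/

/-- The total assignment `v` satisfies some literal of `C`. -/
def SatClause (v : ℕ → Bool) (C : Finset Literal) : Prop := ∃ x ∈ C, v x.1 = x.2

/-- The total assignment `v` satisfies all clauses of `F`. -/
def SatCNF (v : ℕ → Bool) (F : ClauseSet) : Prop := ∀ C ∈ F, SatClause v C

/-- `F` is satisfiable. -/
def Satisfiable (F : ClauseSet) : Prop := ∃ v, SatCNF v F

/-- `F ⊨ C`. -/
def Implies (F : ClauseSet) (C : Finset Literal) : Prop := ∀ v, SatCNF v F → SatClause v C

/-- Logical equivalence of clause-sets. -/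
def Equivalent (F G : ClauseSet) : Prop := ∀ v, SatCNF v F ↔ SatCNF v G

/-- The literal `x` is forced for `F`. -/
def Forced (F : ClauseSet) (x : Literal) : Prop := Implies F {x}

/-- `C` is a prime implicate of `F`. -/
def IsPrimeImplicate (F : ClauseSet) (C : Finset Literal) : Prop :=
  IsClause C ∧ Implies F C ∧ ∀ D, D ⊂ C → ¬ Implies F D

/-! ### Partial assignments and generalised unit-clause propagation -/

/-- Application of a partial assignment to `F`. The assignment is given by the finite
(clash-free) set `T` of literals it makes true: clauses containing a literal of `T` are removed,
and from the remaining clauses all literals with complement in `T` are removed. -/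
def assign (T : Finset Literal) (F : ClauseSet) : ClauseSet :=
  (F.filter fun C => Disjoint C T).image fun C => C.filter fun x => compl x ∉ T

/-- `⟨x → 1⟩ * F`. -/
def setTrue (x : Literal) (F : ClauseSet) : ClauseSet := assign {x} F

/-- `⟨x → 0⟩ * F`. -/
def setFalse (x : Literal) (F : ClauseSet) : ClauseSet := assign {compl x} F

/-- `φ_C * F`, where `φ_C` sets precisely the literals of `C` to `0`. -/
def falsify (C : Finset Literal) (F : ClauseSet) : ClauseSet := assign (C.image compl) F

theorem vars_setTrue_card_lt {x : Literal} {F : ClauseSet} (hx : x ∈ lits F) :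
    (vars (setTrue x F)).card < (vars F).card := by
  have key : vars (setTrue x F) ⊆ (vars F).erase x.1 := by
    intro v hv
    simp only [vars, setTrue, assign, Finset.mem_biUnion, Finset.mem_image, Finset.mem_filter,
      Finset.mem_singleton, Finset.disjoint_singleton_right] at hv
    obtain ⟨_, ⟨C, ⟨hC, hxC⟩, rfl⟩, y, hy, rfl⟩ := hv
    rw [Finset.mem_filter] at hy
    refine Finset.mem_erase.2 ⟨fun h => ?_, ?_⟩
    · by_cases h2 : y.2 = x.2
      · exact hxC ((Prod.ext h h2 : y = x) ▸ hy.1)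
      · refine hy.2 (Prod.ext h ?_)
        revert h2
        simp only [compl]
        cases y.2 <;> cases x.2 <;> simp
    · simp only [vars, Finset.mem_biUnion, Finset.mem_image]
      exact ⟨C, hC, y, hy.1, rfl⟩
  have hxv : x.1 ∈ vars F := by
    simp only [lits, Finset.mem_biUnion, Finset.mem_union, Finset.mem_image] at hx
    simp only [vars, Finset.mem_biUnion, Finset.mem_image]
    obtain ⟨C, hC, h | ⟨y, hy, rfl⟩⟩ := hx
    · exact ⟨C, hC, x, h, rfl⟩
    · exact ⟨C, hC, y, hy, rfl⟩
  exact lt_of_le_of_lt (Finset.card_le_card key) (Finset.card_erase_lt_of_mem hxv)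

open scoped Classical in
/-- Iterated application of `⟨x → 1⟩`, as long as there is a literal `x ∈ lits F` such that
`⟨x → 0⟩ * F` has the property `P`; an arbitrary such literal is chosen in each round. -/
noncomputable def propagate (P : ClauseSet → Prop) (F : ClauseSet) : ClauseSet :=
  if h : ∃ x ∈ lits F, P (setFalse x F) then propagate P (setTrue h.choose F) else F
  termination_by (vars F).card
  decreasing_by exact vars_setTrue_card_lt h.choose_spec.1

/-- The reductions `r_k` (generalised unit-clause propagation of level `k`): `r_0` only recognises
the empty clause, and `r_{k+1}(F) = r_{k+1}(⟨x → 1⟩ * F)` if there is a literal `x ∈ lits F` with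
`r_k(⟨x → 0⟩ * F) = {⊥}`, while otherwise `r_{k+1}(F) = F`. -/
noncomputable def rk : ℕ → ClauseSet → ClauseSet
  | 0, F => if ∅ ∈ F then {∅} else F
  | k + 1, F => propagate (fun G => rk k G = {∅}) F

/-- `F ⊨_k C`: the reduction `r_k` refutes `φ_C * F`. -/
def ImpliesK (k : ℕ) (F : ClauseSet) (C : Finset Literal) : Prop := rk k (falsify C F) = {∅}

/-! ### Hardness and `k`-bases -/

/-- The hardness of `F`: the least `k : ℕ` such that `F ⊨ C` implies `F ⊨_k C` for all
clauses `C`. -/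
noncomputable def hardness (F : ClauseSet) : ℕ∞ :=
  sInf {m : ℕ∞ | ∃ k : ℕ, m = k ∧ ∀ C, IsClause C → Implies F C → ImpliesK k F C}

/-- `G` results from `F` by removing one clause or one literal occurrence. -/
def IsRemoval (F G : ClauseSet) : Prop :=
  (∃ C ∈ F, G = F.erase C) ∨ (∃ C ∈ F, ∃ x ∈ C, G = insert (C.erase x) (F.erase C))

/-- `F` is a `k`-base, for `k ∈ ℕ ∪ {∞}`. -/
def IsKBase (k : ℕ∞) (F : ClauseSet) : Prop :=
  IsClauseSet F ∧ hardness F ≤ k ∧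
    ∀ G, IsRemoval F G → ¬ Equivalent G F ∨ k < hardness G

/-- `G` is a `k`-base equivalent to `F`. -/
def IsEquivKBase (k : ℕ∞) (F G : ClauseSet) : Prop := IsKBase k G ∧ Equivalent G F

/-- `G` is, with respect to the size measure `μ`, a shortest `k`-base equivalent to `F`. -/
def IsShortestKBase (μ : ClauseSet → ℕ) (k : ℕ∞) (F G : ClauseSet) : Prop :=
  IsEquivKBase k F G ∧ ∀ H, IsEquivKBase k F H → μ G ≤ μ H

/-- `G` is a set of prime implicates of `F` which is equivalent to `F`. -/
def IsEquivPrimeSubset (F G : ClauseSet) : Prop :=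
  (∀ C ∈ G, IsPrimeImplicate F C) ∧ Equivalent G F

/-- `G` is an equivalent set of prime implicates of `F` with the least number of clauses. -/
def IsSmallestPrimeSubset (F G : ClauseSet) : Prop :=
  IsEquivPrimeSubset F G ∧ ∀ H, IsEquivPrimeSubset F H → numClauses G ≤ numClauses H

/-! ### Polynomial-time computation on clause-sets -/

/-- A list of lists of literals is how an algorithm reads and writes a clause-set. -/
abbrev Formula : Type := List (List Literal)

/-- The clause-set listed by `L`. -/
def toClauseSet (L : Formula) : ClauseSet := (L.map List.toFinset).toFinset

/-- The alphabet for writing formulas. -/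
inductive Sym : Type
  | bit (b : Bool)
  | sign (b : Bool)
  | endClause
  deriving DecidableEq, Fintype

/-- A literal is written as the binary digits of its variable, closed by its sign. -/
def encodeLiteral (x : Literal) : List Sym :=
  (Computability.encodeNat x.1).map Sym.bit ++ [Sym.sign x.2]

/-- A clause is written as the sequence of its literals, closed by an end marker. -/
def encodeClause (C : List Literal) : List Sym := C.flatMap encodeLiteral ++ [Sym.endClause]

/-- A formula is written as the sequence of its clauses. -/
def encodeFormula (L : Formula) : List Sym := L.flatMap encodeClause

/-- One step of reading a formula from left to right; the state holds the clauses, the literals of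
the current clause, and the digits of the current literal read so far. -/
def decodeStep (s : Formula × List Literal × List Bool) :
    Sym → Formula × List Literal × List Bool
  | Sym.bit b => (s.1, s.2.1, s.2.2 ++ [b])
  | Sym.sign b => (s.1, s.2.1 ++ [(Computability.decodeNat s.2.2, b)], [])
  | Sym.endClause => (s.1 ++ [s.2.1], [], [])

theorem decode_bits (l : List Bool) (s : Formula × List Literal × List Bool) :
    (l.map Sym.bit).foldl decodeStep s = (s.1, s.2.1, s.2.2 ++ l) := by
  induction l generalizing s with
  | nil => simp
  | cons b l ih => simp [ih, decodeStep]

theorem decode_literals (C : List Literal) (L : Formula) (D : List Literal) :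
    (C.flatMap encodeLiteral).foldl decodeStep (L, D, []) = (L, D ++ C, []) := by
  induction C generalizing D with
  | nil => simp
  | cons x C ih =>
    simp [List.flatMap_cons, encodeLiteral, List.foldl_append, decode_bits, decodeStep, ih]

theorem decode_clauses (L M : Formula) :
    (L.flatMap encodeClause).foldl decodeStep (M, [], []) = (M ++ L, [], []) := by
  induction L generalizing M with
  | nil => simp
  | cons C L ih =>
    simp [List.flatMap_cons, encodeClause, List.foldl_append, decode_literals, decodeStep, ih]

/-- The encoding of formulas over the finite alphabet `Sym`. -/
def formulaEncoding : Computability.Encoding Formula Sym where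
  encode := encodeFormula
  decode w := some (w.foldl decodeStep ([], [], [])).1
  decode_encode L := by simp [encodeFormula, decode_clauses]

/-- `f` is computed by a Turing machine in time polynomial in the length of the encoded input. -/
def PolyTime (f : Formula → Formula) : Prop :=
  Nonempty (Turing.TM2ComputableInPolyTime formulaEncoding.encode formulaEncoding.encode f)

end KBase

/-! Hardness. The choice of literals inside `r_k` is eliminated by the derivation system `Ref`, in
which a step branches on a literal, one branch dropping by one level; `rk_falsify_eq_iff` identifies
it with refutation by `r_k`. Derivability is monotone in the level and in the set of falsified
literals, and survives replacing clauses by subclauses. Therefore shortening a clause to a smaller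
implicate never raises hardness, and a `k`-base consists of prime implicates. At level 0 every
implicate must contain a clause of the base, so all prime implicates are present.

Length at most 2. In the implication digraph a clause `{¬p, q}` is an arc from `p` to `q`, together
with the skew arc from `¬q` to `¬p`. A set of literals closed under reachability and free of clashes
extends to a model when no literal is equivalent to its complement. Consequently, for satisfiable
`F`, `F ⊨ C` holds exactly when the complement of some `a ∈ C` reaches some `b ∈ C`
(`exists_reach_of_implies`). So prime implicates have length at most 2, and unit propagation along a
path shows that every equivalent set of prime implicates has hardness at most 1. For `k ≥ 1` the
hardness condition is thus void, and shortest `k`-bases are the smallest equivalent sets of prime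
implicates. The unit clauses are the forced literals and occur in each of these sets, so counting
clauses and counting literal occurrences give the same order.

A smallest set. Forced literals contribute their units. The other literals form strong components
which come in complementary pairs. `Keep` selects a directed cycle through one component of each
pair, and, for every covering pair of components, one arc between the representatives of least rank.
Ranks belong to variables, so the representatives respect complementation. The selected clauses
imply `F` (`litTrue_of_reach`). For minimality, each selected clause is matched with a clause of an
arbitrary competitor that leaves the same literal of a cycle, or joins the same two components
(`Keep.exists_matches`), and this matching is injective (`Matches.unique`).

Running time. Structured stack programs are compiled to Turing machines. The functions they compute
in polynomial time on tree codes (`PF`) are closed under composition, pairing, case distinction and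
folds with controlled growth. This covers Warshall's algorithm and the tests defining `Keep`. -/

namespace KBase

open Turing

/-! ### Structured stack programs -/

/-- The stacks of a program: `port` holds the input and the output, `main` the data,
the others are working space. -/
inductive Stk : Type
  | port | main | regA | regB | regC | count
  deriving DecidableEq

instance : Fintype Stk where
  elems := {.port, .main, .regA, .regB, .regC, .count}
  complete k := by cases k <;> simp

/-- Structured programs on the stacks `Stk` over the alphabet `Sym`. -/
inductive Prog : Type
  | push (k : Stk) (a : Sym)
  | pop (k : Stk)
  | seq (p q : Prog)
  | test (k : Stk) (f : Option Sym → Prog)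
  | loop (k : Stk) (c : Option Sym → Bool) (p : Prog)

/-- The contents of all stacks. -/
abbrev Stacks : Type := Stk → List Sym

/-- `Runs p s s' t`: started on `s`, the program `p` ends with `s'` after `t` steps. -/
inductive Runs : Prog → Stacks → Stacks → ℕ → Prop
  | push (k a s) : Runs (.push k a) s (Function.update s k (a :: s k)) 1
  | pop (k s) : Runs (.pop k) s (Function.update s k (s k).tail) 1
  | seq {p q s s₁ s₂ t₁ t₂} : Runs p s s₁ t₁ → Runs q s₁ s₂ t₂ → Runs (.seq p q) s s₂ (t₁ + t₂)
  | test {k f s s' t} : Runs (f (s k).head?) s s' t → Runs (.test k f) s s' (t + 1)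
  | loop_done {k c p s} : c (s k).head? = false → Runs (.loop k c p) s s 1
  | loop_step {k c p s s₁ s₂ t₁ t₂} : c (s k).head? = true → Runs p s s₁ t₁ →
      Runs (.loop k c p) s₁ s₂ t₂ → Runs (.loop k c p) s s₂ (t₁ + t₂ + 1)

/-- The labels of the Turing machine executing a program. -/
def Prog.Lab : Prog → Type
  | .push _ _ => Unit
  | .pop _ => Unit
  | .seq p q => p.Lab ⊕ q.Lab
  | .test _ f => Option (Σ a, (f a).Lab)
  | .loop _ _ p => Option p.Lab

/-- There are finitely many labels. -/
@[reducible]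
def Prog.labFintype : (p : Prog) → Fintype p.Lab
  | .push _ _ => inferInstanceAs (Fintype Unit)
  | .pop _ => inferInstanceAs (Fintype Unit)
  | .seq p q =>
    let _ := p.labFintype
    let _ := q.labFintype
    inferInstanceAs (Fintype (p.Lab ⊕ q.Lab))
  | .test _ f =>
    let _ := fun a => (f a).labFintype
    inferInstanceAs (Fintype (Option (Σ a, (f a).Lab)))
  | .loop _ _ p =>
    let _ := p.labFintype
    inferInstanceAs (Fintype (Option p.Lab))

/-- The label at which the execution of a program starts. -/
def Prog.entry : (p : Prog) → p.Lab
  | .push _ _ => ()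
  | .pop _ => ()
  | .seq p _ => Sum.inl p.entry
  | .test _ _ => none
  | .loop _ _ _ => none

/-- The statements executing a program inside a machine with labels `Λ`, given an embedding of the
labels of the program and the label to continue with. -/
def Prog.code : (p : Prog) → {Λ : Type} → (p.Lab → Λ) → Λ → p.Lab →
    TM2.Stmt (fun _ : Stk => Sym) Λ (Option Sym)
  | .push k a, _, _, ex, _ => .push k (fun _ => a) (.goto fun _ => ex)
  | .pop k, _, _, ex, _ => .pop k (fun v _ => v) (.goto fun _ => ex)
  | .seq p q, _, inj, _, Sum.inl l =>
    p.code (fun l => inj (Sum.inl l)) (inj (Sum.inr q.entry)) l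
  | .seq _ q, _, inj, ex, Sum.inr l => q.code (fun l => inj (Sum.inr l)) ex l
  | .test k f, _, inj, _, none =>
    .peek k (fun _ o => o) (.goto fun v => inj (some ⟨v, (f v).entry⟩))
  | .test _ f, _, inj, ex, some ⟨a, l⟩ => (f a).code (fun l => inj (some ⟨a, l⟩)) ex l
  | .loop k c p, _, inj, ex, none =>
    .peek k (fun _ o => o) (.goto fun v => if c v then inj (some p.entry) else ex)
  | .loop _ _ p, _, inj, _, some l => p.code (fun l => inj (some l)) (inj none) l

/-- The embedding `inj`, the exit label `ex` and the memory `v` are arbitrary because a subprogram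
runs inside the machine of the whole program, with a continuation depending on its position. The
costs in `Runs` are exactly the numbers of machine steps. -/
theorem Runs.iterate_step {p : Prog} {s s' : Stacks} {t : ℕ} (h : Runs p s s' t) {Λ : Type}
    (M : Λ → TM2.Stmt (fun _ : Stk => Sym) Λ (Option Sym)) (inj : p.Lab → Λ) (ex : Λ)
    (hM : ∀ l, M (inj l) = p.code inj ex l) (v : Option Sym) :
    ∃ v', (flip bind (TM2.step M))^[t] (some ⟨some (inj p.entry), v, s⟩) =
      some ⟨some ex, v', s'⟩ := by
  induction h generalizing v ex with
  | push k a s =>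
    refine ⟨v, ?_⟩
    simp [flip, hM, Prog.code, TM2.step, TM2.stepAux]
  | pop k s =>
    refine ⟨v, ?_⟩
    simp [flip, hM, Prog.code, TM2.step, TM2.stepAux]
  | @seq p q s s₁ s₂ t₁ t₂ _ _ ih₁ ih₂ =>
    obtain ⟨v₁, h₁⟩ := ih₁ (fun l => inj (Sum.inl l)) (inj (Sum.inr q.entry))
      (fun l => hM (Sum.inl l)) v
    obtain ⟨v₂, h₂⟩ := ih₂ (fun l => inj (Sum.inr l)) ex (fun l => hM (Sum.inr l)) v₁
    refine ⟨v₂, ?_⟩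
    rw [Nat.add_comm, Function.iterate_add_apply]
    exact (congrArg _ h₁).trans h₂
  | @test k f s s' t _ ih =>
    obtain ⟨v₁, h₁⟩ := ih (fun l => inj (some ⟨_, l⟩)) ex (fun l => hM (some ⟨_, l⟩)) (s k).head?
    refine ⟨v₁, ?_⟩
    rw [Function.iterate_succ_apply, ← h₁]
    congr 1
    change (TM2.step M ⟨some (inj none), v, s⟩) = _
    rw [TM2.step, show M (inj none) = _ from hM none]
    simp [Prog.code, TM2.stepAux]
  | @loop_done k c p s hc =>
    refine ⟨(s k).head?, ?_⟩
    change (TM2.step M ⟨some (inj none), v, s⟩) = _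
    rw [TM2.step, show M (inj none) = _ from hM none]
    simp [Prog.code, TM2.stepAux, hc]
  | @loop_step k c p s s₁ s₂ t₁ t₂ hc _ _ ih₁ ih₂ =>
    obtain ⟨v₁, h₁⟩ := ih₁ (fun l => inj (some l)) (inj none) (fun l => hM (some l)) (s k).head?
    obtain ⟨v₂, h₂⟩ := ih₂ inj ex hM v₁
    refine ⟨v₂, ?_⟩
    rw [Function.iterate_succ_apply, Nat.add_comm, Function.iterate_add_apply, ← h₂]
    congr 1
    refine Eq.trans (congrArg _ ?_) h₁
    change (TM2.step M ⟨some (inj none), v, s⟩) = _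
    rw [TM2.step, show M (inj none) = _ from hM none]
    simp [Prog.code, TM2.stepAux, hc]

/-- The Turing machine executing a program and then halting. -/
def Prog.machine (p : Prog) : FinTM2 :=
  letI := p.labFintype
  { K := Stk
    k₀ := .port
    k₁ := .port
    Γ := fun _ => Sym
    Λ := Option p.Lab
    main := some p.entry
    σ := Option Sym
    initialState := none
    Γk₀Fin := inferInstanceAs (Fintype Sym)
    m := fun l => match l with
      | none => .load (fun _ => none) .halt
      | some l => p.code some none l }

/-- The stacks with `w` in `port` and nothing elsewhere. -/
def onPort (w : List Sym) : Stacks := fun k => if k = .port then w else []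

theorem polyTime_of_runs {f : Formula → Formula} (p : Prog) (q : Polynomial ℕ)
    (h : ∀ L, ∃ t ≤ q.eval (encodeFormula L).length,
      Runs p (onPort (encodeFormula L)) (onPort (encodeFormula (f L))) t) :
    PolyTime f := by
  choose t ht hr using h
  -- The additional step is the one at the label `none`: a halting configuration must carry the
  -- initial memory, which is restored there.
  refine ⟨{ tm := p.machine, inputAlphabet := Equiv.refl _, outputAlphabet := Equiv.refl _,
            time := q + 1, outputsFun := fun L => ⟨⟨t L + 1, ?_⟩, ?_⟩ }⟩
  · obtain ⟨v, hv⟩ := (hr L).iterate_step p.machine.m some none (fun _ => rfl) none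
    rw [Nat.add_comm, Function.iterate_add_apply]
    have e₁ : (some (initList p.machine (List.map (Equiv.refl _).invFun
        (formulaEncoding.encode L))) : Option p.machine.Cfg) =
        some ⟨some (some p.entry), none, onPort (encodeFormula L)⟩ := by
      refine congrArg some ?_
      simp only [initList, Prog.machine]
      congr 1
      funext k
      by_cases hk : k = Stk.port
      · subst hk; simp [onPort, formulaEncoding]; rfl
      · simp [onPort, hk]
    refine (congrArg _ ((congrArg _ e₁).trans hv)).trans ?_
    change some _ = some _
    refine congrArg some ?_
    simp only [haltList, Prog.machine]
    change TM2.stepAux (.load (fun _ => none) .halt) _ _ = _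
    simp only [TM2.stepAux]
    congr 1
    funext k
    by_cases hk : k = Stk.port
    · subst hk; simp [onPort, formulaEncoding]; rfl
    · simp [onPort, hk]
  · simpa [formulaEncoding] using ht L

/-- The total height of the stacks. -/
def Stacks.height (s : Stacks) : ℕ := ∑ k, (s k).length

theorem Stacks.height_update (s : Stacks) (k : Stk) (w : List Sym) :
    Stacks.height (Function.update s k w) + (s k).length = s.height + w.length := by
  have h₁ := Finset.add_sum_erase Finset.univ (fun j => (Function.update s k w j).length)
    (Finset.mem_univ k)
  have h₂ := Finset.add_sum_erase Finset.univ (fun j => (s j).length) (Finset.mem_univ k)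
  have h₃ : ∑ j ∈ Finset.univ.erase k, (Function.update s k w j).length =
      ∑ j ∈ Finset.univ.erase k, (s j).length :=
    Finset.sum_congr rfl fun j hj => by rw [Function.update_of_ne (Finset.ne_of_mem_erase hj)]
  simp only [Function.update_self] at h₁
  simp only [Stacks.height]
  omega

/-- A step pushes at most one symbol. This turns time bounds into bounds on the size of results. -/
theorem Runs.height_le {p : Prog} {s s' : Stacks} {t : ℕ} (h : Runs p s s' t) :
    s'.height ≤ s.height + t := by
  induction h with
  | push k a s => have := s.height_update k (a :: s k); simp at this; omega
  | pop k s => have := s.height_update k (s k).tail; simp at this; omega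
  | seq => omega
  | test => omega
  | loop_done => omega
  | loop_step => omega

/-! ### Binary trees on the main stack -/

/-- Unlabelled binary trees, the data of our programs. -/
inductive Tr : Type
  | leaf
  | node (a b : Tr)

/-- A node is written before its two subtrees. -/
def Tr.word : Tr → List Sym
  | .leaf => [Sym.bit false]
  | .node a b => Sym.bit true :: (a.word ++ b.word)

/-- The stacks with given contents. -/
def cfg (m a b c n : List Sym) : Stacks
  | .port => []
  | .main => m
  | .regA => a
  | .regB => b
  | .regC => c
  | .count => n

section cfg

variable (m a b c n w : List Sym)

@[simp] theorem cfg_main : cfg m a b c n .main = m := rfl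
@[simp] theorem cfg_regA : cfg m a b c n .regA = a := rfl
@[simp] theorem cfg_regB : cfg m a b c n .regB = b := rfl
@[simp] theorem cfg_regC : cfg m a b c n .regC = c := rfl
@[simp] theorem cfg_count : cfg m a b c n .count = n := rfl

@[simp] theorem update_cfg_main :
    Function.update (cfg m a b c n) .main w = cfg w a b c n := by
  funext k; cases k <;> simp [Function.update, cfg]
@[simp] theorem update_cfg_regA :
    Function.update (cfg m a b c n) .regA w = cfg m w b c n := by
  funext k; cases k <;> simp [Function.update, cfg]
@[simp] theorem update_cfg_regB :
    Function.update (cfg m a b c n) .regB w = cfg m a w c n := by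
  funext k; cases k <;> simp [Function.update, cfg]
@[simp] theorem update_cfg_regC :
    Function.update (cfg m a b c n) .regC w = cfg m a b w n := by
  funext k; cases k <;> simp [Function.update, cfg]
@[simp] theorem update_cfg_count :
    Function.update (cfg m a b c n) .count w = cfg m a b c w := by
  funext k; cases k <;> simp [Function.update, cfg]

end cfg

/-! ### Stack primitives and their running times -/

theorem Runs.push' {k : Stk} {x : Sym} {s s' : Stacks}
    (h : Function.update s k (x :: s k) = s') : Runs (.push k x) s s' 1 := h ▸ .push k x s

theorem Runs.pop' {k : Stk} {s s' : Stacks}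
    (h : Function.update s k (s k).tail = s') : Runs (.pop k) s s' 1 := h ▸ .pop k s

theorem Runs.cast {p : Prog} {s s₁ s' : Stacks} {t t' : ℕ} (h : Runs p s s₁ t) (hs : s₁ = s')
    (ht : t = t') : Runs p s s' t' := hs ▸ ht ▸ h

namespace Prog

/-- Do nothing. -/
def skip : Prog := .loop .main (fun _ => false) (.pop .main)

/-- Move the contents of stack `k` to stack `j`, in reverse order. -/
def move (k j : Stk) : Prog :=
  .loop k Option.isSome (.test k fun
    | some x => .seq (.push j x) (.pop k)
    | none => .pop k)

/-- Move the top tree of `main` to `regA`, in reverse order. -/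
def takeLoop : Prog :=
  .loop .count Option.isSome (.test .main fun
    | some (Sym.bit true) =>
      .seq (.push .regA (Sym.bit true)) (.seq (.pop .main) (.push .count Sym.endClause))
    | _ => .seq (.push .regA (Sym.bit false)) (.seq (.pop .main) (.pop .count)))

/-- Move the top tree of `main` to `regA`, in reverse order. -/
def take : Prog := .seq (.push .count Sym.endClause) takeLoop

/-- Move the top tree of `main` to the stack `k`. -/
def store (k : Stk) : Prog := .seq take (.move .regA k)

/-- Move the contents of the stack `k` to `main`. -/
def fetch (k : Stk) : Prog := .seq (.move k .regA) (.move .regA .main)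

/-- Empty the stack `regA`. -/
def clear : Prog := .loop .regA Option.isSome (.pop .regA)

/-- Move `regA` to `main` and `regB`. -/
def fork : Prog :=
  .loop .regA Option.isSome (.test .regA fun
    | some x => .seq (.push .main x) (.seq (.push .regB x) (.pop .regA))
    | none => .pop .regA)

/-- Remove the top tree. -/
def drop : Prog := .seq take clear

/-- Duplicate the top tree. -/
def dup : Prog := .seq take (.seq fork (fetch .regB))

/-- Exchange the two top trees. -/
def swap : Prog :=
  .seq (store .regB) (.seq (store .regC) (.seq (fetch .regB) (fetch .regC)))

/-- Join the second and third tree to a node on top of the first tree. -/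
def joinBelow : Prog :=
  .seq (store .regB) (.seq (.push .main (Sym.bit true)) (.seq (store .regC)
    (.seq (fetch .regB) (fetch .regC))))

/-- Push a word. -/
def pushWord : List Sym → Prog
  | [] => skip
  | x :: w => .seq (pushWord w) (.push .main x)

end Prog

/-- Four steps per symbol: loop test, case distinction, push and pop. The failing test at the end
costs one more. -/
theorem runs_move {k j : Stk} (hkj : k ≠ j) (w : List Sym) (s : Stacks) (hw : s k = w) :
    Runs (.move k j) s
      (Function.update (Function.update s j (w.reverse ++ s j)) k []) (4 * w.length + 1) := by
  induction w generalizing s with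
  | nil =>
    refine Runs.cast (.loop_done (by simp [hw])) ?_ rfl
    rw [List.reverse_nil, List.nil_append, Function.update_eq_self, ← hw,
      Function.update_eq_self]
  | cons x w ih =>
    have h := ih (Function.update (Function.update s j (x :: s j)) k w) (by simp)
    have e : Function.update (Function.update (Function.update (Function.update s j (x :: s j)) k w)
        j (w.reverse ++ Function.update (Function.update s j (x :: s j)) k w j)) k [] =
        Function.update (Function.update s j ((x :: w).reverse ++ s j)) k [] := by
      funext i
      by_cases hi : i = k
      · subst hi; simp
      · by_cases hj : i = j
        · subst hj; simp [hi]
        · simp [hi, hj]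
    rw [e] at h
    have hb : Runs (.test k fun
        | some x => .seq (.push j x) (.pop k)
        | none => .pop k) s (Function.update (Function.update s j (x :: s j)) k w) (1 + 1 + 1) := by
      refine .test ?_
      rw [hw]
      refine .seq (.push _ _ _) (.pop' ?_)
      rw [Function.update_of_ne hkj, hw, List.tail_cons]
    have := Runs.loop_step (c := Option.isSome) (by simp [hw]) hb h
    exact this.cast rfl (by simp only [List.length_cons]; omega)

/-- The stack `count` holds in unary the number of trees still to be read: a node replaces one such
tree by two, a leaf removes one. The run `h` after the tree is a parameter so that the runs on the
two subtrees can be chained. -/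
theorem runs_takeLoop (d : Tr) (r a b c n : List Sym) {s' : Stacks} {t : ℕ}
    (h : Runs .takeLoop (cfg r (d.word.reverse ++ a) b c n) s' t) :
    Runs .takeLoop (cfg (d.word ++ r) a b c (Sym.endClause :: n)) s' (t + 5 * d.word.length) := by
  induction d generalizing r a n t with
  | leaf =>
    refine Runs.cast (Runs.loop_step (s₁ := cfg r (Sym.bit false :: a) b c n) (by simp)
      (.test (.seq (.push .regA _ _) (.seq (.pop .main _) (.pop' (k := .count) ?_)))) h) rfl ?_
    · simp [Tr.word]
    · simp [Tr.word]; omega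
  | node d e ihd ihe =>
    have h₂ := ihe r (d.word.reverse ++ (Sym.bit true :: a)) n (t := t) (by simpa [Tr.word] using h)
    have h₁ := ihd (e.word ++ r) (Sym.bit true :: a) (Sym.endClause :: n) h₂
    refine Runs.cast (Runs.loop_step (by simp)
      (.test (.seq (.push .regA _ _) (.seq (.pop .main _) (.push' (k := .count) ?_)))) h₁) rfl ?_
    · simp [Tr.word]
    · simp [Tr.word]; omega

theorem runs_take (d : Tr) (r b c : List Sym) :
    Runs .take (cfg (d.word ++ r) [] b c []) (cfg r d.word.reverse b c [])
      (5 * d.word.length + 2) := by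
  have h := runs_takeLoop d r [] b c [] (.loop_done (by simp))
  have := Runs.seq (Runs.push' (k := .count) (x := Sym.endClause)
    (s := cfg (d.word ++ r) [] b c []) (by simp)) h
  exact this.cast (by simp) (by omega)

theorem runs_storeB (d : Tr) (r c : List Sym) :
    Runs (.store .regB) (cfg (d.word ++ r) [] [] c []) (cfg r [] d.word c [])
      (9 * d.word.length + 3) := by
  have h₂ := runs_move (k := .regA) (j := .regB) (by decide) d.word.reverse
    (cfg r d.word.reverse [] c []) rfl
  have := (runs_take d r [] c).seq h₂
  exact this.cast (by simp) (by simp; omega)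

theorem runs_storeC (d : Tr) (r b : List Sym) :
    Runs (.store .regC) (cfg (d.word ++ r) [] b [] []) (cfg r [] b d.word [])
      (9 * d.word.length + 3) := by
  have h₂ := runs_move (k := .regA) (j := .regC) (by decide) d.word.reverse
    (cfg r d.word.reverse b [] []) rfl
  have := (runs_take d r b []).seq h₂
  exact this.cast (by simp) (by simp; omega)

theorem runs_fetchB (w r c : List Sym) :
    Runs (.fetch .regB) (cfg r [] w c []) (cfg (w ++ r) [] [] c []) (8 * w.length + 2) := by
  have h₁ := runs_move (k := .regB) (j := .regA) (by decide) w (cfg r [] w c []) rfl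
  have h₂ := runs_move (k := .regA) (j := .main) (by decide) w.reverse
    (cfg r w.reverse [] c []) rfl
  simp only [cfg_regA, List.append_nil, update_cfg_regA, update_cfg_regB] at h₁
  have := h₁.seq h₂
  exact this.cast (by simp) (by simp; omega)

theorem runs_fetchC (w r b : List Sym) :
    Runs (.fetch .regC) (cfg r [] b w []) (cfg (w ++ r) [] b [] []) (8 * w.length + 2) := by
  have h₁ := runs_move (k := .regC) (j := .regA) (by decide) w (cfg r [] b w []) rfl
  have h₂ := runs_move (k := .regA) (j := .main) (by decide) w.reverse
    (cfg r w.reverse b [] []) rfl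
  simp only [cfg_regA, List.append_nil, update_cfg_regA, update_cfg_regC] at h₁
  have := h₁.seq h₂
  exact this.cast (by simp) (by simp; omega)

theorem runs_clear (w r : List Sym) :
    Runs .clear (cfg r w [] [] []) (cfg r [] [] [] []) (2 * w.length + 1) := by
  induction w with
  | nil => exact .loop_done rfl
  | cons x w ih =>
    have := Runs.loop_step (k := .regA) (c := Option.isSome) (s := cfg r (x :: w) [] [] []) (by simp)
      (.pop' (s' := cfg r w [] [] []) (by simp)) ih
    exact this.cast rfl (by simp; omega)

theorem runs_fork (w r b : List Sym) :
    Runs .fork (cfg r w b [] []) (cfg (w.reverse ++ r) [] (w.reverse ++ b) [] [])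
      (5 * w.length + 1) := by
  induction w generalizing r b with
  | nil => exact .loop_done rfl
  | cons x w ih =>
    refine Runs.cast (Runs.loop_step (s₁ := cfg (x :: r) w (x :: b) [] []) (by simp)
      (.test (.seq (.push .main _ _) (.seq (.push .regB _ _) (.pop' (k := .regA) ?_)))) (ih _ _)) ?_ ?_
    · simp
    · simp
    · simp; omega

/-- `Does p m m' n`: the program `p` turns the main stack `m` into `m'` in at most `n` steps; the
other stacks are empty before and after. -/
def Does (p : Prog) (m m' : List Sym) (n : ℕ) : Prop :=
  ∃ t ≤ n, Runs p (cfg m [] [] [] []) (cfg m' [] [] [] []) t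

theorem Does.mono {p : Prog} {m m' : List Sym} {n n' : ℕ} (h : Does p m m' n) (hn : n ≤ n') :
    Does p m m' n' :=
  let ⟨t, ht, hr⟩ := h
  ⟨t, ht.trans hn, hr⟩

theorem Does.seq {p q : Prog} {m m₁ m₂ : List Sym} {n₁ n₂ : ℕ} (h₁ : Does p m m₁ n₁)
    (h₂ : Does q m₁ m₂ n₂) : Does (.seq p q) m m₂ (n₁ + n₂) :=
  let ⟨_, ht₁, hr₁⟩ := h₁
  let ⟨_, ht₂, hr₂⟩ := h₂
  ⟨_, add_le_add ht₁ ht₂, hr₁.seq hr₂⟩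

theorem Does.test {f : Option Sym → Prog} {m m' : List Sym} {n : ℕ}
    (h : Does (f m.head?) m m' n) : Does (.test .main f) m m' (n + 1) :=
  let ⟨_, ht, hr⟩ := h
  ⟨_, Nat.add_le_add_right ht 1, .test hr⟩

theorem does_skip (m : List Sym) : Does .skip m m 1 := ⟨1, le_rfl, .loop_done rfl⟩

theorem does_push (x : Sym) (m : List Sym) : Does (.push .main x) m (x :: m) 1 :=
  ⟨1, le_rfl, .push' (by simp)⟩

theorem does_pop (x : Sym) (m : List Sym) : Does (.pop .main) (x :: m) m 1 :=
  ⟨1, le_rfl, .pop' (by simp)⟩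

theorem does_pushWord (w m : List Sym) : Does (.pushWord w) m (w ++ m) (w.length + 1) := by
  induction w with
  | nil => exact does_skip m
  | cons x w ih => exact (ih.seq (does_push x _)).mono (by simp)

theorem does_drop (d : Tr) (r : List Sym) : Does .drop (d.word ++ r) r (7 * d.word.length + 3) :=
  ⟨_, by simp; omega, (runs_take d r [] []).seq (runs_clear _ r)⟩

theorem does_dup (d : Tr) (r : List Sym) :
    Does .dup (d.word ++ r) (d.word ++ (d.word ++ r)) (18 * d.word.length + 5) := by
  have h := runs_fork d.word.reverse r []
  simp only [List.reverse_reverse, List.append_nil] at h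
  exact ⟨_, by simp; omega, (runs_take d r [] []).seq (h.seq (runs_fetchB _ _ _))⟩

theorem does_swap (d e : Tr) (r : List Sym) :
    Does .swap (d.word ++ (e.word ++ r)) (e.word ++ (d.word ++ r))
      (17 * d.word.length + 17 * e.word.length + 10) :=
  ⟨_, by omega, (runs_storeB d _ []).seq ((runs_storeC e _ _).seq
    ((runs_fetchB _ _ _).seq (runs_fetchC _ _ _)))⟩

/-- As soon as `bit true` lies on top of the second and third tree, they form a single tree, which
one `store` moves. -/
theorem does_joinBelow (l a s : Tr) (r : List Sym) :
    Does .joinBelow (l.word ++ (a.word ++ (s.word ++ r))) ((Tr.node a s).word ++ (l.word ++ r))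
      (17 * l.word.length + 17 * a.word.length + 17 * s.word.length + 40) := by
  have h := runs_storeC (Tr.node a s) r l.word
  refine ⟨_, ?_, (runs_storeB l _ []).seq ((Runs.push' ?_).seq (Runs.seq h
    ((runs_fetchB _ _ _).seq (runs_fetchC _ _ _))))⟩
  · simp [Tr.word]; omega
  · simp [Tr.word]

/-! ### Functions computed in polynomial time on trees -/

/-- Types whose elements are represented by trees. -/
class Enc (α : Type) where
  /-- The tree representing an element. -/
  enc : α → Tr

open Enc

instance : Enc Bool where
  enc b := bif b then .node .leaf .leaf else .leaf

instance {α β : Type} [Enc α] [Enc β] : Enc (α × β) where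
  enc x := .node (enc x.1) (enc x.2)

/-- The tree representing a list. -/
def encList {α : Type} [Enc α] : List α → Tr
  | [] => .leaf
  | a :: l => .node (enc a) (encList l)

instance {α : Type} [Enc α] : Enc (List α) where
  enc := encList

instance : Enc ℕ where
  enc n := enc (Computability.encodeNat n)

/-- The word representing an element. -/
def wd {α : Type} [Enc α] (x : α) : List Sym := (enc x).word

/-- The length of the representation. -/
def sz {α : Type} [Enc α] (x : α) : ℕ := (wd x).length

section size

variable {α β : Type} [Enc α] [Enc β]

theorem wd_pair (x : α × β) : wd x = Sym.bit true :: (wd x.1 ++ wd x.2) := rfl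
theorem wd_nil : wd ([] : List α) = [Sym.bit false] := rfl
theorem wd_cons (a : α) (l : List α) : wd (a :: l) = Sym.bit true :: (wd a ++ wd l) := rfl

theorem length_word (x : α) : (enc x).word.length = sz x := rfl

@[simp] theorem sz_pair (x : α) (y : β) : sz (x, y) = sz x + sz y + 1 := by
  simp [sz, wd_pair]

@[simp] theorem sz_nil : sz ([] : List α) = 1 := rfl

@[simp] theorem sz_cons (a : α) (l : List α) : sz (a :: l) = sz a + sz l + 1 := by
  simp [sz, wd_cons]

theorem sz_bool_le (b : Bool) : sz b ≤ 3 := by cases b <;> decide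

theorem length_le_sz (l : List α) : l.length ≤ sz l := by
  induction l with
  | nil => simp
  | cons a l ih => simp; omega

theorem sz_le_of_mem {a : α} {l : List α} (h : a ∈ l) : sz a ≤ sz l := by
  induction l with
  | nil => simp at h
  | cons b l ih =>
    rcases List.mem_cons.1 h with rfl | h
    · simp; omega
    · have := ih h; simp; omega

theorem sz_append (l l' : List α) : sz (l ++ l') + 1 = sz l + sz l' := by
  induction l with
  | nil => simp; omega
  | cons a l ih => simp; omega

theorem sz_list_le {l : List α} {B : ℕ} (h : ∀ a ∈ l, sz a ≤ B) :
    sz l ≤ l.length * (B + 1) + 1 := by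
  induction l with
  | nil => simp
  | cons a l ih =>
    have h₁ := h a (by simp)
    have h₂ := ih fun b hb => h b (by simp [hb])
    simp only [sz_cons, List.length_cons]
    rw [Nat.succ_mul]; omega

end size

/-- `f` is computed by a program in polynomial time. -/
def PF {α β : Type} [Enc α] [Enc β] (f : α → β) : Prop :=
  ∃ (p : Prog) (q : Polynomial ℕ), ∀ x r, Does p (wd x ++ r) (wd (f x) ++ r) (q.eval (sz x))

theorem eval_mono (q : Polynomial ℕ) : Monotone fun n => q.eval n := by
  intro a b h
  induction q using Polynomial.induction_on' with
  | add p q hp hq => simpa using add_le_add hp hq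
  | monomial n c => simpa using Nat.mul_le_mul_left c (Nat.pow_le_pow_left h n)

theorem Does.length_le {p : Prog} {m m' : List Sym} {n : ℕ} (h : Does p m m' n) :
    m'.length ≤ m.length + n := by
  obtain ⟨t, ht, hr⟩ := h
  have := hr.height_le
  have e : ∀ m : List Sym, Stacks.height (cfg m [] [] [] []) = m.length := fun m => by
    have : (Finset.univ : Finset Stk) = {.port, .main, .regA, .regB, .regC, .count} := rfl
    simp [Stacks.height, this, cfg]
  rw [e, e] at this
  omega

namespace PF

variable {α β γ δ : Type} [Enc α] [Enc β] [Enc γ] [Enc δ]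

/-- The result is at most as long as the input plus the number of steps. Compositions stay
polynomial for this reason. -/
theorem size_le {f : α → β} (h : PF f) : ∃ q : Polynomial ℕ, ∀ x, sz (f x) ≤ q.eval (sz x) := by
  obtain ⟨p, q, h⟩ := h
  refine ⟨Polynomial.X + q, fun x => ?_⟩
  simpa [sz] using (h x []).length_le

protected theorem id : PF (fun x : α => x) := ⟨.skip, 1, fun x r => (does_skip _).mono (by simp)⟩

/-- Programs see only words, so functions into different types with equal words are interchangeable.
-/
theorem of_wd_eq {f : α → β} {g : α → γ} (h : PF f) (e : ∀ x, wd (f x) = wd (g x)) : PF g := by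
  obtain ⟨p, q, h⟩ := h
  exact ⟨p, q, fun x r => e x ▸ h x r⟩

theorem comp {g : β → γ} {f : α → β} (hg : PF g) (hf : PF f) : PF (fun x => g (f x)) := by
  obtain ⟨s, hs⟩ := hf.size_le
  obtain ⟨p₁, q₁, h₁⟩ := hg
  obtain ⟨p₂, q₂, h₂⟩ := hf
  refine ⟨.seq p₂ p₁, q₂ + q₁.comp s, fun x r => ((h₂ x r).seq (h₁ _ r)).mono ?_⟩
  have := eval_mono q₁ (hs x)
  simp at this ⊢
  omega

theorem const (b : β) : PF (fun _ : α => b) := by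
  refine ⟨.seq .drop (.pushWord (wd b)), 7 * Polynomial.X + Polynomial.C (sz b + 4), fun x r =>
    ((does_drop (enc x) r).seq (does_pushWord (wd b) r)).mono ?_⟩
  simp only [Polynomial.eval_add, Polynomial.eval_mul, Polynomial.eval_X, Polynomial.eval_C,
    Polynomial.eval_ofNat, sz, wd]
  omega

theorem pair {f : α → β} {g : α → γ} (hf : PF f) (hg : PF g) : PF (fun x => (f x, g x)) := by
  obtain ⟨sf, hsf⟩ := hf.size_le
  obtain ⟨sg, hsg⟩ := hg.size_le
  obtain ⟨p₁, q₁, h₁⟩ := hf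
  obtain ⟨p₂, q₂, h₂⟩ := hg
  refine ⟨.seq .dup (.seq p₁ (.seq .swap (.seq p₂ (.seq .swap (.push .main (Sym.bit true)))))),
    q₁ + q₂ + 40 * (Polynomial.X + sf + sg + 1), fun x r => ?_⟩
  rw [wd_pair, List.cons_append, List.append_assoc]
  refine ((does_dup (enc x) r).seq ((h₁ x _).seq ((does_swap (enc (f x)) (enc x) r).seq
    ((h₂ x _).seq ((does_swap (enc (g x)) (enc (f x)) r).seq (does_push _ _)))))).mono ?_
  have := hsf x
  have := hsg x
  simp only [Polynomial.eval_add, Polynomial.eval_mul, Polynomial.eval_X, Polynomial.eval_one,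
    Polynomial.eval_ofNat, length_word] at *
  omega

theorem fst : PF (fun x : α × β => x.1) := by
  refine ⟨.seq (.pop .main) (.seq .swap .drop), 40 * (Polynomial.X + 1), fun x r => ?_⟩
  have := (does_pop (Sym.bit true) (wd x.1 ++ (wd x.2 ++ r))).seq
    ((does_swap (enc x.1) (enc x.2) r).seq (does_drop (enc x.2) _))
  rw [wd_pair, List.cons_append, List.append_assoc]
  refine this.mono ?_
  have : sz x = sz x.1 + sz x.2 + 1 := sz_pair x.1 x.2
  simp only [Polynomial.eval_add, Polynomial.eval_mul, Polynomial.eval_X, Polynomial.eval_one,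
      Polynomial.eval_ofNat, length_word] at *
  omega

theorem snd : PF (fun x : α × β => x.2) := by
  refine ⟨.seq (.pop .main) .drop, 40 * (Polynomial.X + 1), fun x r => ?_⟩
  have := (does_pop (Sym.bit true) (wd x.1 ++ (wd x.2 ++ r))).seq (does_drop (enc x.1) _)
  rw [wd_pair, List.cons_append, List.append_assoc]
  refine this.mono ?_
  have : sz x = sz x.1 + sz x.2 + 1 := sz_pair x.1 x.2
  simp only [Polynomial.eval_add, Polynomial.eval_mul, Polynomial.eval_X, Polynomial.eval_one,
      Polynomial.eval_ofNat, length_word] at *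
  omega

theorem cond {c : α → Bool} {f g : α → β} (hc : PF c) (hf : PF f) (hg : PF g) :
    PF (fun x => bif c x then f x else g x) := by
  obtain ⟨p₀, q₀, h₀⟩ := hc
  obtain ⟨p₁, q₁, h₁⟩ := hf
  obtain ⟨p₂, q₂, h₂⟩ := hg
  -- The tree of `true` has three symbols and that of `false` has one; they are popped before the
  -- branch is entered.
  refine ⟨.seq .dup (.seq p₀ (.test .main fun
    | some (Sym.bit true) => .seq (.pop .main) (.seq (.pop .main) (.seq (.pop .main) p₁))
    | _ => .seq (.pop .main) p₂)), q₀ + q₁ + q₂ + 40 * (Polynomial.X + 1), fun x r => ?_⟩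
  change Does _ _ (wd (bif c x then f x else g x) ++ r) _
  cases hcx : c x
  · have := (does_dup (enc x) r).seq ((h₀ x _).seq
      (Does.test (m := wd (c x) ++ (wd x ++ r)) (m' := wd (g x) ++ r)
        (f := fun
          | some (Sym.bit true) => .seq (.pop .main) (.seq (.pop .main) (.seq (.pop .main) p₁))
          | _ => .seq (.pop .main) p₂)
        (by rw [hcx]; exact (does_pop _ _).seq (h₂ x r))))
    refine this.mono ?_
    simp only [Polynomial.eval_add, Polynomial.eval_mul, Polynomial.eval_X, Polynomial.eval_one,
      Polynomial.eval_ofNat, length_word] at *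
    omega
  · have := (does_dup (enc x) r).seq ((h₀ x _).seq
      (Does.test (m := wd (c x) ++ (wd x ++ r)) (m' := wd (f x) ++ r)
        (f := fun
          | some (Sym.bit true) => .seq (.pop .main) (.seq (.pop .main) (.seq (.pop .main) p₁))
          | _ => .seq (.pop .main) p₂)
        (by
          rw [hcx]
          exact (does_pop _ _).seq ((does_pop _ _).seq ((does_pop _ _).seq (h₁ x r))))))
    refine this.mono ?_
    simp only [Polynomial.eval_add, Polynomial.eval_mul, Polynomial.eval_X, Polynomial.eval_one,
      Polynomial.eval_ofNat, length_word] at *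
    omega

theorem cons {f : α → β} {g : α → List β} (hf : PF f) (hg : PF g) : PF (fun x => f x :: g x) :=
  (hf.pair hg).of_wd_eq fun _ => rfl

theorem list_casesOn {l : α → List β} {f : α → γ} {g : α × β × List β → γ} (hl : PF l) (hf : PF f)
    (hg : PF g) : PF (fun x => match l x with
      | [] => f x
      | a :: t => g (x, a, t)) := by
  obtain ⟨s, hs⟩ := hl.size_le
  obtain ⟨p₀, q₀, h₀⟩ := hl
  obtain ⟨p₁, q₁, h₁⟩ := hf
  obtain ⟨p₂, q₂, h₂⟩ := hg
  let F : Option Sym → Prog := fun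
    -- A nonempty list has the same word as the pair of its head and tail. After the swap, one more
    -- `bit true` therefore completes the word of `(x, a, t)`.
    | some (Sym.bit true) => .seq .swap (.seq (.push .main (Sym.bit true)) p₂)
    | _ => .seq (.pop .main) p₁
  refine ⟨.seq .dup (.seq p₀ (.test .main F)),
    q₀ + q₁ + q₂.comp (Polynomial.X + s + 1) + 40 * (Polynomial.X + s + 1), fun x r => ?_⟩
  have hsx := hs x
  change Does _ _ (wd (match l x with
    | [] => f x
    | a :: t => g (x, a, t)) ++ r) _
  rcases hlx : l x with _ | ⟨a, t⟩
  · have := (does_dup (enc x) r).seq ((h₀ x _).seq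
      (Does.test (m := wd (l x) ++ (wd x ++ r)) (m' := wd (f x) ++ r) (f := F)
        (by rw [hlx]; exact (does_pop _ _).seq (h₁ x r))))
    refine this.mono ?_
    simp only [Polynomial.eval_add, Polynomial.eval_mul, Polynomial.eval_X, Polynomial.eval_one,
      Polynomial.eval_ofNat, length_word] at *
    omega
  · have h₃ := h₂ (x, a, t) r
    rw [wd_pair, List.cons_append, List.append_assoc] at h₃
    have := (does_dup (enc x) r).seq ((h₀ x _).seq
      (Does.test (m := wd (l x) ++ (wd x ++ r)) (m' := wd (g (x, a, t)) ++ r) (f := F)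
        (by
          rw [hlx]
          exact (does_swap (enc (a, t)) (enc x) r).seq ((does_push (Sym.bit true) _).seq h₃))))
    refine this.mono ?_
    have e : sz (x, a, t) ≤ sz x + s.eval (sz x) + 1 := by
      rw [hlx, sz_cons] at hsx
      simp only [sz_pair]; omega
    have e₂ := eval_mono q₂ e
    have e₃ : sz (a, t) ≤ s.eval (sz x) := by
      rw [hlx] at hsx; exact hsx
    simp only [Polynomial.eval_add, Polynomial.eval_mul, Polynomial.eval_X, Polynomial.eval_one,
      Polynomial.eval_ofNat, Polynomial.eval_comp, length_word] at *
    omega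

end PF

/-- The loop which folds the program `p` over the top list. -/
def Prog.foldLoop (p : Prog) : Prog :=
  .loop .main (fun o => o == some (Sym.bit true))
    (.seq (.pop .main) (.seq .swap (.seq .joinBelow (.seq p .swap))))

/-- The number `B` bounds the list and every intermediate accumulator, so each call of `p` receives
a pair of size at most `2 * B + 1`. The term `200 * B + 200` generously covers the moving of trees
in one round. -/
theorem does_foldLoop {β γ : Type} [Enc β] [Enc γ] {g : β × γ → γ} {p : Prog} {q : Polynomial ℕ}
    (hp : ∀ x r, Does p (wd x ++ r) (wd (g x) ++ r) (q.eval (sz x))) (B : ℕ) (l : List β) (s : γ)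
    (r : List Sym) (hl : sz l ≤ B)
    (hB : ∀ n, sz ((l.take n).foldl (fun s a => g (a, s)) s) ≤ B) :
    Does (.seq p.foldLoop (.pop .main)) (wd l ++ (wd s ++ r))
      (wd (l.foldl (fun s a => g (a, s)) s) ++ r)
      (l.length * (q.eval (2 * B + 1) + 200 * B + 200) + 2) := by
  suffices h : Does p.foldLoop (wd l ++ (wd s ++ r))
      (Sym.bit false :: (wd (l.foldl (fun s a => g (a, s)) s) ++ r))
      (l.length * (q.eval (2 * B + 1) + 200 * B + 200) + 1) from h.seq (does_pop _ _)
  induction l generalizing s with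
  | nil => exact ⟨1, by simp, .loop_done rfl⟩
  | cons a l ih =>
    have hl' : sz l ≤ B := by rw [sz_cons] at hl; omega
    obtain ⟨t, ht, hr⟩ := ih (g (a, s)) hl' fun n => by simpa using hB (n + 1)
    have hs : sz s ≤ B := by simpa using hB 0
    have hg : sz (g (a, s)) ≤ B := by simpa using hB 1
    have hb := (does_pop (Sym.bit true) (wd a ++ (wd l ++ (wd s ++ r)))).seq
      ((does_swap (enc a) (enc l) (wd s ++ r)).seq ((does_joinBelow (enc l) (enc a) (enc s) r).seq
        ((hp (a, s) (wd l ++ r)).seq (does_swap (enc (g (a, s))) (enc l) r))))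
    obtain ⟨t', ht', hr'⟩ := hb
    have e : wd (a :: l) ++ (wd s ++ r) = Sym.bit true :: (wd a ++ (wd l ++ (wd s ++ r))) := by
      simp [wd_cons]
    rw [e]
    refine ⟨_, ?_, .loop_step rfl hr' hr⟩
    have hq : q.eval (sz (a, s)) ≤ q.eval (2 * B + 1) := eval_mono q (by
      rw [sz_cons] at hl; simp only [sz_pair]; omega)
    rw [sz_cons] at hl
    rw [List.length_cons, Nat.succ_mul]
    simp only [length_word] at ht'
    omega

/-! ### Iteration over lists and the operations built from it -/

namespace PF

/-- The loop body has access only to the current element and the accumulator, so the parameter `x`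
has to travel inside the accumulator. -/
theorem foldl_fst {α β γ : Type} {f : α × γ × β → γ} (x : α) (s : γ) (l : List β) :
    l.foldl (fun (s : α × γ) a => (s.1, f (s.1, s.2, a))) (x, s) =
      (x, l.foldl (fun s a => f (x, s, a)) s) := by
  induction l generalizing s with
  | nil => rfl
  | cons a l ih => exact ih _

variable {α β γ δ : Type} [Enc α] [Enc β] [Enc γ] [Enc δ]

/-- A polynomial-time step may double the accumulator, so iteration is not harmless in general. The
bound `B` on all intermediate values rules out exponential growth. -/
theorem foldl_of_bound {l : α → List β} {i : α → γ} {f : α × γ × β → γ} (hl : PF l) (hi : PF i)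
    (hf : PF f) (B : Polynomial ℕ)
    (hB : ∀ x n, sz (((l x).take n).foldl (fun s a => f (x, s, a)) (i x)) ≤ B.eval (sz x)) :
    PF (fun x => (l x).foldl (fun s a => f (x, s, a)) (i x)) := by
  have hg : PF (fun y : β × α × γ => (y.2.1, f (y.2.1, y.2.2, y.1))) :=
    (fst.comp snd).pair (hf.comp ((fst.comp snd).pair ((snd.comp snd).pair fst)))
  obtain ⟨p, q, h⟩ := hg
  obtain ⟨s, hs⟩ := hl.size_le
  obtain ⟨p₀, q₀, h₀⟩ := hl.pair (PF.id.pair hi)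
  suffices PF (fun x => (x, (l x).foldl (fun s a => f (x, s, a)) (i x))) from snd.comp this
  let R : Polynomial ℕ := s + Polynomial.X + B + 1
  refine ⟨.seq p₀ (.seq (.pop .main) (.seq p.foldLoop (.pop .main))),
    q₀ + 1 + (s * (q.comp (2 * R + 1) + 200 * R + 200) + 2), fun x r => ?_⟩
  have hR : R.eval (sz x) = s.eval (sz x) + sz x + B.eval (sz x) + 1 := by simp [R]
  have h₁ := does_foldLoop (g := fun y : β × α × γ => (y.2.1, f (y.2.1, y.2.2, y.1))) h
    (R.eval (sz x)) (l x) (x, i x) r (by rw [hR]; have := hs x; omega) (fun n => by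
      rw [foldl_fst, sz_pair, hR]
      have := hB x n
      omega)
  rw [foldl_fst] at h₁
  have h₂ := h₀ x r
  rw [wd_pair, List.cons_append, List.append_assoc] at h₂
  refine (h₂.seq ((does_pop _ _).seq h₁)).mono ?_
  have : (l x).length ≤ s.eval (sz x) := (length_le_sz _).trans (hs x)
  have := Nat.mul_le_mul_right (q.eval (2 * R.eval (sz x) + 1) + 200 * R.eval (sz x) + 200) this
  simp only [Polynomial.eval_add, Polynomial.eval_mul, Polynomial.eval_one,
    Polynomial.eval_ofNat, Polynomial.eval_comp]
  omega

/-- When each step adds an amount controlled by the parameter `x` alone, the total growth is at most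
the length of the list times this amount. -/
theorem foldl {l : α → List β} {i : α → γ} {f : α × γ × β → γ} (hl : PF l) (hi : PF i)
    (hf : PF f) (P : Polynomial ℕ)
    (hP : ∀ x s, ∀ a ∈ l x, sz (f (x, s, a)) ≤ sz s + P.eval (sz x)) :
    PF (fun x => (l x).foldl (fun s a => f (x, s, a)) (i x)) := by
  obtain ⟨ql, hql⟩ := hl.size_le
  obtain ⟨qi, hqi⟩ := hi.size_le
  refine foldl_of_bound hl hi hf (qi + ql * P) fun x n => ?_
  have key : ∀ (m : List β) (s : γ), (∀ a ∈ m, a ∈ l x) →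
      sz (m.foldl (fun s a => f (x, s, a)) s) ≤ sz s + m.length * P.eval (sz x) := by
    intro m
    induction m with
    | nil => intro s _; simp
    | cons a m ih =>
      intro s h
      have h₁ := ih (f (x, s, a)) fun b hb => h b (by simp [hb])
      have h₂ := hP x s a (h a (by simp))
      rw [List.length_cons, Nat.succ_mul, List.foldl_cons]
      omega
  have h₁ := key ((l x).take n) (i x) fun a ha => List.mem_of_mem_take ha
  have h₂ : ((l x).take n).length ≤ ql.eval (sz x) :=
    (List.length_take_le' _ _).trans ((length_le_sz _).trans (hql x))
  have h₃ := Nat.mul_le_mul_right (P.eval (sz x)) h₂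
  have := hqi x
  simp only [Polynomial.eval_add, Polynomial.eval_mul]
  omega

theorem not {f : α → Bool} (hf : PF f) : PF (fun x => !f x) :=
  (hf.cond (const false) (const true)).of_wd_eq fun x => by cases f x <;> rfl

theorem and {f g : α → Bool} (hf : PF f) (hg : PF g) : PF (fun x => f x && g x) :=
  (hf.cond hg (const false)).of_wd_eq fun x => by cases f x <;> rfl

theorem or {f g : α → Bool} (hf : PF f) (hg : PF g) : PF (fun x => f x || g x) :=
  (hf.cond (const true) hg).of_wd_eq fun x => by cases f x <;> rfl

theorem beqBool {f g : α → Bool} (hf : PF f) (hg : PF g) : PF (fun x => f x == g x) :=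
  (hf.cond hg hg.not).of_wd_eq fun x => by cases f x <;> cases g x <;> rfl

theorem reverse {l : α → List β} (hl : PF l) : PF (fun x => (l x).reverse) := by
  obtain ⟨ql, hql⟩ := hl.size_le
  have := hl.foldl (const []) (f := fun y : α × List β × β => y.2.2 :: y.2.1)
    ((snd.comp snd).cons (fst.comp snd)) (ql + 1) fun x s a ha => by
      have := (sz_le_of_mem ha).trans (hql x)
      simp; omega
  refine this.of_wd_eq fun x => ?_
  rw [List.foldl_flip_cons_eq_append']
  simp

theorem append {l m : α → List β} (hl : PF l) (hm : PF m) : PF (fun x => l x ++ m x) := by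
  obtain ⟨ql, hql⟩ := hl.size_le
  have := hl.reverse.foldl hm (f := fun y : α × List β × β => y.2.2 :: y.2.1)
    ((snd.comp snd).cons (fst.comp snd)) (ql + 1) fun x s a ha => by
      have := (sz_le_of_mem (List.mem_reverse.1 ha)).trans (hql x)
      simp; omega
  refine this.of_wd_eq fun x => ?_
  rw [List.foldl_flip_cons_eq_append']
  simp

theorem flatMap {l : α → List β} {f : α × β → List γ} (hl : PF l) (hf : PF f) :
    PF (fun x => (l x).flatMap fun a => f (x, a)) := by
  obtain ⟨ql, hql⟩ := hl.size_le
  obtain ⟨qf, hqf⟩ := hf.size_le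
  have := hl.foldl (const []) (f := fun y : α × List γ × β => y.2.1 ++ f (y.1, y.2.2))
    ((fst.comp snd).append (hf.comp (fst.pair (snd.comp snd))))
    (qf.comp (Polynomial.X + ql + 1)) fun x s a ha => by
      have h₁ := (sz_le_of_mem ha).trans (hql x)
      have h₂ := sz_append s (f (x, a))
      have h₃ := hqf (x, a)
      have h₄ : qf.eval (sz (x, a)) ≤ qf.eval (sz x + ql.eval (sz x) + 1) :=
        eval_mono qf (by simp; omega)
      simp only [Polynomial.eval_add, Polynomial.eval_one, Polynomial.eval_X,
        Polynomial.eval_comp]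
      omega
  refine this.of_wd_eq fun x => ?_
  have key : ∀ (m : List β) (s : List γ),
      m.foldl (fun s a => s ++ f (x, a)) s = s ++ m.flatMap fun a => f (x, a) := by
    intro m
    induction m with
    | nil => simp
    | cons a m ih => intro s; simp [ih]
  simp [key]

theorem map {l : α → List β} {f : α × β → γ} (hl : PF l) (hf : PF f) :
    PF (fun x => (l x).map fun a => f (x, a)) :=
  (hl.flatMap (hf.cons (const []))).of_wd_eq fun x => by
    rw [← List.flatMap_singleton' (List.map _ _), List.flatMap_map]

theorem filter {l : α → List β} {f : α × β → Bool} (hl : PF l) (hf : PF f) :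
    PF (fun x => (l x).filter fun a => f (x, a)) :=
  (hl.flatMap (hf.cond (snd.cons (const [])) (const []))).of_wd_eq fun x => by
    congr 1
    induction l x with
    | nil => rfl
    | cons a m ih => cases h : f (x, a) <;> simp [h, ih]

theorem any {l : α → List β} {f : α × β → Bool} (hl : PF l) (hf : PF f) :
    PF (fun x => (l x).any fun a => f (x, a)) := by
  have := hl.foldl (const false) (f := fun y : α × Bool × β => y.2.1 || f (y.1, y.2.2))
    ((fst.comp snd).or (hf.comp (fst.pair (snd.comp snd)))) 3 fun x s a _ => by
      have := sz_bool_le (s || f (x, a))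
      simp; omega
  refine this.of_wd_eq fun x => ?_
  have key : ∀ (m : List β) (s : Bool),
      m.foldl (fun s a => s || f (x, a)) s = (s || m.any fun a => f (x, a)) := by
    intro m
    induction m with
    | nil => simp
    | cons a m ih => intro s; simp [ih, Bool.or_assoc]
  simp [key]

theorem all {l : α → List β} {f : α × β → Bool} (hl : PF l) (hf : PF f) :
    PF (fun x => (l x).all fun a => f (x, a)) :=
  (hl.any hf.not).not.of_wd_eq fun x => by
    rw [List.not_any_eq_all_not]; simp

theorem isEmpty {l : α → List β} (hl : PF l) : PF (fun x => (l x).isEmpty) :=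
  (hl.list_casesOn (const true) (const false)).of_wd_eq fun x => by cases l x <;> rfl

theorem headD {l : α → List β} {f : α → β} (hl : PF l) (hf : PF f) :
    PF (fun x => (l x).headD (f x)) :=
  (hl.list_casesOn hf (fst.comp snd)).of_wd_eq fun x => by cases l x <;> rfl

end PF

/-- One step of the comparison of two lists: compare the next element with the head of the
remaining list. -/
def beqStep (s : List Bool × Bool) (a : Bool) : List Bool × Bool :=
  match s.1 with
  | [] => ([], false)
  | b :: t => (t, s.2 && a == b)

theorem foldl_beqStep (l m : List Bool) (c : Bool) :
    ((l.foldl beqStep (m, c)).1.isEmpty && (l.foldl beqStep (m, c)).2) = (c && l == m) := by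
  induction l generalizing m c with
  | nil => cases m <;> cases c <;> simp
  | cons a l ih =>
    cases m with
    | nil => rw [List.foldl_cons]; simp [beqStep, ih]
    | cons b m => rw [List.foldl_cons]; simp [beqStep, ih, Bool.and_assoc]

namespace PF

variable {α β γ δ : Type} [Enc α] [Enc β] [Enc γ] [Enc δ]

/-- Equality of lists becomes a fold over one list, with the unread rest of the other in the
accumulator. That rest only shrinks, so a constant covers the growth. -/
theorem beqList {f g : α → List Bool} (hf : PF f) (hg : PF g) : PF (fun x => f x == g x) := by
  have hs : PF (fun y : α × (List Bool × Bool) × Bool => beqStep y.2.1 y.2.2) :=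
    ((fst.comp (fst.comp snd)).list_casesOn
      (f := fun _ : α × (List Bool × Bool) × Bool => (([], false) : List Bool × Bool))
      (g := fun z => (z.2.2, z.1.2.1.2 && z.1.2.2 == z.2.1)) (const _)
      ((snd.comp snd).pair ((snd.comp (fst.comp (snd.comp fst))).and
        ((snd.comp (snd.comp fst)).beqBool (fst.comp snd))))).of_wd_eq fun y => by
      rcases y with ⟨_, ⟨_ | _, _⟩, _⟩ <;> rfl
  have := hf.foldl (hg.pair (const true)) hs 10 fun x s a _ => by
    rcases s with ⟨_ | ⟨b, t⟩, c⟩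
    · have := sz_bool_le false
      simp [beqStep]; omega
    · have := sz_bool_le (c && a == b)
      simp [beqStep]; omega
  refine ((fst.comp this).isEmpty.and (snd.comp this)).of_wd_eq fun x => ?_
  rw [foldl_beqStep, Bool.true_and]

theorem digits {f : α → ℕ} (hf : PF f) : PF (fun x => Computability.encodeNat (f x)) :=
  hf.of_wd_eq fun _ => rfl

theorem eqNat {f g : α → ℕ} (hf : PF f) (hg : PF g) : PF (fun x => decide (f x = g x)) :=
  (hf.digits.beqList hg.digits).of_wd_eq fun x => by
    congr 1
    rw [Bool.eq_iff_iff]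
    simpa using (Function.LeftInverse.injective Computability.decode_encodeNat).eq_iff

theorem eqLit {f g : α → Literal} (hf : PF f) (hg : PF g) : PF (fun x => decide (f x = g x)) :=
  (((fst.comp hf).eqNat (fst.comp hg)).and ((snd.comp hf).beqBool (snd.comp hg))).of_wd_eq
    fun x => by
      congr 1
      rw [Bool.eq_iff_iff]
      simp [Prod.ext_iff]

theorem compl {f : α → Literal} (hf : PF f) : PF (fun x => compl (f x)) :=
  (fst.comp hf).pair (snd.comp hf).not

end PF

/-! ### Reading and writing formulas -/

/-- The code of a symbol. -/
def symCode : Sym → List Bool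
  | .bit b => [false, b]
  | .sign b => [true, b]
  | .endClause => []

instance : Enc Sym where
  enc x := enc (symCode x)

/-- The stacks with `u` in `port` and `m` in `main`. -/
def pcfg (u m : List Sym) : Stacks
  | .port => u
  | .main => m
  | _ => []

section pcfg

variable (u m w : List Sym)

@[simp] theorem pcfg_port : pcfg u m .port = u := rfl
@[simp] theorem pcfg_main : pcfg u m .main = m := rfl

@[simp] theorem update_pcfg_main : Function.update (pcfg u m) .main w = pcfg u w := by
  funext k; cases k <;> simp [Function.update, pcfg]
@[simp] theorem update_pcfg_port : Function.update (pcfg u m) .port w = pcfg w m := by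
  funext k; cases k <;> simp [Function.update, pcfg]

theorem pcfg_nil_left : pcfg [] m = cfg m [] [] [] [] := by
  funext k; cases k <;> rfl

theorem pcfg_nil_right : pcfg u [] = onPort u := by
  funext k; cases k <;> rfl

end pcfg

namespace Prog

/-- Read the input into a list on the main stack. -/
def readPort : Prog :=
  .seq (.push .main (Sym.bit false))
    (.loop .port Option.isSome (.test .port fun
      | some x => .seq (.pop .port) (.seq (pushWord (wd x)) (.push .main (Sym.bit true)))
      | none => .pop .port))

/-- Remove the word of a symbol from `main` and push the symbol to `port`. -/
def emit : Prog :=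
  .test .main fun
    | some (Sym.bit true) =>
      .seq (.pop .main) (.test .main fun
        | some (Sym.bit true) =>
          .seq (.pop .main) (.seq (.pop .main) (.seq (.pop .main) (.seq (.pop .main)
            (.test .main fun
              | some (Sym.bit true) =>
                .seq (.pop .main) (.seq (.pop .main) (.seq (.pop .main) (.seq (.pop .main)
                  (.push .port (Sym.sign true)))))
              | _ => .seq (.pop .main) (.seq (.pop .main) (.push .port (Sym.sign false)))))))
        | _ =>
          .seq (.pop .main) (.seq (.pop .main)
            (.test .main fun
              | some (Sym.bit true) =>
                .seq (.pop .main) (.seq (.pop .main) (.seq (.pop .main) (.seq (.pop .main)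
                  (.push .port (Sym.bit true)))))
              | _ => .seq (.pop .main) (.seq (.pop .main) (.push .port (Sym.bit false))))))
    | _ => .seq (.pop .main) (.push .port Sym.endClause)

/-- Write the list on the main stack to the output. -/
def writePort : Prog :=
  .seq (.loop .main (fun o => o == some (Sym.bit true)) (.seq (.pop .main) emit)) (.pop .main)

end Prog

theorem runs_pushWord (w u m : List Sym) :
    Runs (.pushWord w) (pcfg u m) (pcfg u (w ++ m)) (w.length + 1) := by
  induction w with
  | nil => exact .loop_done rfl
  | cons x w ih => exact (ih.seq (.push .main x _)).cast (by simp) (by simp)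

/-- Reading prepends to a list, which reverses the input; writing to the output stack reverses once
more. The parser and `PF.unparse` are made for the reversed order. -/
theorem runs_readPort (u : List Sym) :
    ∃ t ≤ 20 * u.length + 2, Runs .readPort (pcfg u []) (pcfg [] (wd u.reverse)) t := by
  suffices h : ∀ v : List Sym, ∃ t ≤ 20 * u.length + 1, Runs (.loop .port Option.isSome
      (.test .port fun
        | some x => .seq (.pop .port) (.seq (.pushWord (wd x)) (.push .main (Sym.bit true)))
        | none => .pop .port)) (pcfg u (wd v)) (pcfg [] (wd (u.reverse ++ v))) t by
    obtain ⟨t, ht, hr⟩ := h []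
    rw [List.append_nil] at hr
    exact ⟨_, by omega, .seq (.push' (by simp [wd_nil])) hr⟩
  induction u with
  | nil => exact fun v => ⟨1, by simp, .loop_done rfl⟩
  | cons x u ih =>
    intro v
    obtain ⟨t, ht, hr⟩ := ih (x :: v)
    have hx : (wd x).length ≤ 9 := by rcases x with (_ | _) | (_ | _) | _ <;> decide
    refine ⟨_, ?_, (Runs.loop_step (s₁ := pcfg u (wd (x :: v))) rfl
      (.test (.seq (.pop' (k := .port) (s' := pcfg u (wd v)) ?_)
        (.seq (runs_pushWord _ _ _) (.push' (k := .main) ?_)))) hr).cast ?_ rfl⟩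
    · simp only [List.length_cons]; omega
    · simp
    · simp [wd_cons]
    · simp

theorem runs_emit (x : Sym) (u r : List Sym) :
    ∃ t ≤ 20, Runs .emit (pcfg u (wd x ++ r)) (pcfg (x :: u) r) t := by
  rcases x with (_ | _) | (_ | _) | _
  · exact ⟨_, by decide, .test (.seq (.pop' (update_pcfg_main _ _ _)) (.test
      (.seq (.pop' (update_pcfg_main _ _ _)) (.seq (.pop' (update_pcfg_main _ _ _)) (.test
        (.seq (.pop' (update_pcfg_main _ _ _)) (.seq (.pop' (update_pcfg_main _ _ _))
          (.push' (update_pcfg_port _ _ _)))))))))⟩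
  · exact ⟨_, by decide, .test (.seq (.pop' (update_pcfg_main _ _ _)) (.test
      (.seq (.pop' (update_pcfg_main _ _ _)) (.seq (.pop' (update_pcfg_main _ _ _)) (.test
        (.seq (.pop' (update_pcfg_main _ _ _)) (.seq (.pop' (update_pcfg_main _ _ _))
          (.seq (.pop' (update_pcfg_main _ _ _)) (.seq (.pop' (update_pcfg_main _ _ _))
            (.push' (update_pcfg_port _ _ _)))))))))))⟩
  · exact ⟨_, by decide, .test (.seq (.pop' (update_pcfg_main _ _ _)) (.test
      (.seq (.pop' (update_pcfg_main _ _ _)) (.seq (.pop' (update_pcfg_main _ _ _))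
      (.seq (.pop' (update_pcfg_main _ _ _)) (.seq (.pop' (update_pcfg_main _ _ _)) (.test
        (.seq (.pop' (update_pcfg_main _ _ _)) (.seq (.pop' (update_pcfg_main _ _ _))
          (.push' (update_pcfg_port _ _ _)))))))))))⟩
  · exact ⟨_, by decide, .test (.seq (.pop' (update_pcfg_main _ _ _)) (.test
      (.seq (.pop' (update_pcfg_main _ _ _)) (.seq (.pop' (update_pcfg_main _ _ _))
      (.seq (.pop' (update_pcfg_main _ _ _)) (.seq (.pop' (update_pcfg_main _ _ _)) (.test
        (.seq (.pop' (update_pcfg_main _ _ _)) (.seq (.pop' (update_pcfg_main _ _ _))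
          (.seq (.pop' (update_pcfg_main _ _ _)) (.seq (.pop' (update_pcfg_main _ _ _))
            (.push' (update_pcfg_port _ _ _)))))))))))))⟩
  · exact ⟨_, by decide, .test (.seq (.pop' (update_pcfg_main _ _ _))
      (.push' (update_pcfg_port _ _ _)))⟩

theorem runs_writePort (l : List Sym) :
    ∃ t ≤ 22 * l.length + 2, Runs .writePort (pcfg [] (wd l)) (pcfg l.reverse []) t := by
  suffices h : ∀ u : List Sym, ∃ t ≤ 22 * l.length + 1,
      Runs (.loop .main (fun o => o == some (Sym.bit true)) (.seq (.pop .main) .emit))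
        (pcfg u (wd l)) (pcfg (l.reverse ++ u) [Sym.bit false]) t by
    obtain ⟨t, ht, hr⟩ := h []
    rw [List.append_nil] at hr
    exact ⟨_, by omega, hr.seq (.pop' (by simp))⟩
  induction l with
  | nil => exact fun u => ⟨1, by simp, .loop_done rfl⟩
  | cons x l ih =>
    intro u
    obtain ⟨t, ht, hr⟩ := ih (x :: u)
    obtain ⟨t₁, ht₁, hr₁⟩ := runs_emit x u (wd l)
    refine ⟨_, ?_, (Runs.loop_step (s := pcfg u (wd (x :: l))) rfl
      (.seq (.pop' (k := .main) ?_) hr₁) hr).cast ?_ rfl⟩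
    · simp only [List.length_cons]; omega
    · simp [wd_cons]
    · simp

/-- Formulas with the variables given by their binary digits. -/
abbrev DigitFormula : Type := List (List (List Bool × Bool))

/-- One step of reading a formula from right to left. -/
def parseStep (F : DigitFormula) (s : List Bool) : DigitFormula :=
  match s with
  | [] => [] :: F
  | k :: t =>
    match F with
    | [] => []
    | C :: G =>
      bif k then (([], t.headD false) :: C) :: G else
        match C with
        | [] => C :: G
        | x :: D => ((t.headD false :: x.1, x.2) :: D) :: G

/-- The binary digits of the variables of a formula. -/
def toDigits (L : Formula) : DigitFormula :=
  L.map (List.map fun x => (Computability.encodeNat x.1, x.2))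

/-- From right to left every closing mark comes before what it closes: an end marker opens an empty
clause, a sign opens a literal without digits, and a digit is put in front of the current literal.
The partial formula is thus the only state needed. -/
theorem foldr_parseStep (L : Formula) :
    (encodeFormula L).foldr (fun x F => parseStep F (symCode x)) [] = toDigits L := by
  have hbits : ∀ (l ds : List Bool) (b : Bool) (C) (G : DigitFormula),
      (l.map Sym.bit).foldr (fun x F => parseStep F (symCode x)) (((ds, b) :: C) :: G) =
        ((l ++ ds, b) :: C) :: G := by
    intro l ds b C G
    induction l with
    | nil => rfl
    | cons d l ih =>
      rw [List.map_cons, List.foldr_cons, ih]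
      rfl
  have hlits : ∀ (C : List Literal) (G : DigitFormula),
      (C.flatMap encodeLiteral).foldr (fun x F => parseStep F (symCode x)) ([] :: G) =
        (C.map fun x => (Computability.encodeNat x.1, x.2)) :: G := by
    intro C G
    induction C with
    | nil => rfl
    | cons x C ih =>
      rw [List.flatMap_cons, List.foldr_append, ih, encodeLiteral, List.foldr_append]
      have := hbits (Computability.encodeNat x.1) [] x.2
        (C.map fun x => (Computability.encodeNat x.1, x.2)) G
      rw [List.append_nil] at this
      exact this
  induction L with
  | nil => rfl
  | cons C L ih =>
    rw [encodeFormula, List.flatMap_cons, List.foldr_append, ← encodeFormula, ih, encodeClause,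
      List.foldr_append]
    exact hlits C (toDigits L)

namespace PF

theorem parse : PF (fun w : List Sym => w.reverse.foldr (fun x F => parseStep F (symCode x)) []) := by
  have hs : PF (fun y : List (List Bool) × DigitFormula × List Bool => parseStep y.2.1 y.2.2) := by
    have h₁ := (snd.comp snd : PF fun y : List (List Bool) × DigitFormula × List Bool => y.2.2)
    have h₂ : PF fun z : ((List (List Bool) × DigitFormula × List Bool) × Bool × List Bool) ×
        List (List Bool × Bool) × DigitFormula => z.1.2.2.headD false :=
      (snd.comp (snd.comp fst)).headD (const false)
    refine (h₁.list_casesOn ((const []).cons (fst.comp snd))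
      ((fst.comp (snd.comp fst)).list_casesOn (const [])
        ((fst.comp (snd.comp fst)).cond
          ((((const []).pair h₂).cons (fst.comp snd)).cons (snd.comp snd))
          ((fst.comp snd).list_casesOn ((fst.comp snd).cons (snd.comp snd))
            (((((h₂.comp fst).cons (fst.comp (fst.comp snd))).pair
              (snd.comp (fst.comp snd))).cons (snd.comp snd)).cons
                (snd.comp (snd.comp fst))))))).of_wd_eq fun y => ?_
    rcases y with ⟨w, _ | ⟨_ | _, _⟩, _ | ⟨_ | _, _⟩⟩ <;> rfl
  have hb : PF (fun w : List (List Bool) => w.foldl parseStep []) := by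
    refine foldl PF.id (const []) hs 20 fun w F s _ => ?_
    have e := fun b => sz_bool_le b
    simp only [Polynomial.eval_ofNat]
    rcases s with _ | ⟨_ | _, t⟩
    · simp [parseStep]; omega
    · rcases F with _ | ⟨_ | ⟨⟨_, _⟩, _⟩, _⟩ <;> simp [parseStep]
      have := e (t.head?.getD false)
      omega
    · rcases F with _ | ⟨C, _⟩ <;> simp [parseStep]
      have := e (t.head?.getD false)
      omega
  -- A symbol is represented by the tree of its code, so replacing symbols by codes leaves the word
  -- unchanged and costs nothing.
  refine (hb.comp (α := List Sym) (f := fun w => w.map symCode) (PF.id.of_wd_eq fun w => ?_)).of_wd_eq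
    fun w => ?_
  · induction w with
    | nil => rfl
    | cons x w ih => rw [List.map_cons, wd_cons, wd_cons, ih]; rfl
  · rw [List.foldr_reverse, List.foldl_map]

theorem unparse : PF (fun L : Formula => (encodeFormula L).reverse) := by
  have hl : PF (fun x : Literal => encodeLiteral x) :=
    ((fst.digits.map (γ := Sym) (f := fun y : Literal × Bool => Sym.bit y.2)
      (((const false).cons (snd.cons (const []))).of_wd_eq fun _ => rfl)).append
      (m := fun x : Literal => [Sym.sign x.2])
      ((((const true).cons (snd.cons (const []))).cons (const [])).of_wd_eq fun _ => rfl))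
  have hc : PF (fun C : List Literal => encodeClause C) :=
    (PF.id.flatMap (hl.comp snd)).append (const [Sym.endClause])
  exact (PF.id.flatMap (hc.comp snd)).reverse

end PF

/-- Numbers are represented by their binary digits, so a parser producing digits already produces
the word of the formula, with no arithmetic. -/
theorem wd_toDigits (L : Formula) : wd (toDigits L) = wd L := by
  have h : ∀ C : List Literal,
      wd (C.map fun x => (Computability.encodeNat x.1, x.2)) = wd C := by
    intro C
    induction C with
    | nil => rfl
    | cons x C ih => rw [List.map_cons, wd_cons, wd_cons, ih]; rfl
  induction L with
  | nil => rfl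
  | cons C L ih => rw [toDigits, List.map_cons, wd_cons, wd_cons, ← toDigits, ih, h]

theorem sz_symList_le (w : List Sym) : sz w ≤ 10 * w.length + 1 := by
  have := sz_list_le (l := w) (B := 9) fun x _ => by rcases x with (_ | _) | (_ | _) | _ <;> decide
  omega

/-- The program reads the port, parses, computes `f` followed by `PF.unparse`, and writes. The
polynomials `N` and `M` bound the sizes of the symbol list and of the parsed formula in terms of the
input length. -/
theorem PF.polyTime {f : Formula → Formula} (hf : PF f) : PolyTime f := by
  obtain ⟨q₄, h₄⟩ := (PF.unparse.comp hf).size_le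
  obtain ⟨q₅, h₅⟩ := PF.parse.size_le
  obtain ⟨p₁, q₁, h₁⟩ := PF.parse
  obtain ⟨p₂, q₂, h₂⟩ := PF.unparse.comp hf
  let N : Polynomial ℕ := 10 * Polynomial.X + 1
  let M : Polynomial ℕ := q₅.comp N
  refine polyTime_of_runs (.seq .readPort (.seq p₁ (.seq p₂ .writePort)))
    (20 * Polynomial.X + 2 + (q₁.comp N + (q₂.comp M + (22 * q₄.comp M + 2)))) fun L => ?_
  set w := encodeFormula L with hw
  obtain ⟨t₁, ht₁, hr₁⟩ := runs_readPort w
  obtain ⟨t₂, ht₂, hr₂⟩ := h₁ w.reverse []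
  obtain ⟨t₃, ht₃, hr₃⟩ := h₂ L []
  obtain ⟨t₄, ht₄, hr₄⟩ := runs_writePort (encodeFormula (f L)).reverse
  have hp : w.reverse.reverse.foldr (fun x F => parseStep F (symCode x)) [] = toDigits L := by
    rw [List.reverse_reverse, hw, foldr_parseStep]
  have h₅' := h₅ w.reverse
  simp only [hp] at hr₂ h₅'
  rw [wd_toDigits] at hr₂
  simp only [List.append_nil, ← pcfg_nil_left] at hr₂ hr₃
  rw [List.reverse_reverse, pcfg_nil_right] at hr₄
  rw [pcfg_nil_right] at hr₁
  refine ⟨_, ?_, hr₁.seq (hr₂.seq (hr₃.seq hr₄))⟩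
  have e₁ : sz w.reverse ≤ 10 * w.length + 1 := by simpa using sz_symList_le w.reverse
  have e₂ : sz L ≤ q₅.eval (10 * w.length + 1) := by
    have : sz (toDigits L) = sz L := by rw [sz, wd_toDigits, sz]
    rw [← this]
    exact h₅'.trans (eval_mono q₅ e₁)
  have e₃ := eval_mono q₁ e₁
  have e₄ := eval_mono q₂ e₂
  have e₅ := eval_mono q₄ e₂
  have e₆ := h₄ L
  have e₇ := length_le_sz (encodeFormula (f L)).reverse
  simp only [Polynomial.eval_add, Polynomial.eval_mul, Polynomial.eval_X, Polynomial.eval_one,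
      Polynomial.eval_ofNat, Polynomial.eval_comp, N, M] at *
  omega

/-! ### A choice-free description of the reductions `r_k` -/

@[simp] theorem compl_compl (x : Literal) : compl (compl x) = x := by simp [compl]

theorem compl_ne (x : Literal) : compl x ≠ x := by
  intro h
  simpa [compl] using congrArg Prod.snd h

theorem compl_inj {x y : Literal} : compl x = compl y ↔ x = y :=
  ⟨fun h => by simpa using congrArg compl h, congrArg _⟩

theorem compl_eq_comm {x y : Literal} : compl x = y ↔ compl y = x :=
  ⟨fun h => by rw [← h, compl_compl], fun h => by rw [← h, compl_compl]⟩

/-- The truth value of a literal under a total assignment. -/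
def LitTrue (v : ℕ → Bool) (x : Literal) : Prop := v x.1 = x.2

theorem litTrue_compl {v : ℕ → Bool} {x : Literal} : LitTrue v (compl x) ↔ ¬ LitTrue v x := by
  simp only [LitTrue, compl]
  cases v x.1 <;> cases x.2 <;> simp

/-- `Ref F k A`: the falsification of the literals in `A` is refuted for `F` at level `k`. -/
inductive Ref (F : ClauseSet) : ℕ → Finset Literal → Prop
  | base {k A C} : C ∈ F → C ⊆ A → Ref F k A
  | step {k A} (x : Literal) : Ref F k (insert x A) → Ref F (k + 1) (insert (compl x) A) →
      Ref F (k + 1) A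

theorem Ref.mono_set {F : ClauseSet} {k : ℕ} {A B : Finset Literal} (h : Ref F k A) (hAB : A ⊆ B) :
    Ref F k B := by
  induction h generalizing B with
  | base hC hA => exact .base hC (hA.trans hAB)
  | step x _ _ ih₁ ih₂ =>
    exact .step x (ih₁ (Finset.insert_subset_insert x hAB))
      (ih₂ (Finset.insert_subset_insert _ hAB))

/-- Only leaves of a derivation mention clauses, and a subclause serves there as well. Hence
replacing clauses by subclauses preserves refutability. -/
theorem Ref.mono_clauses {F G : ClauseSet} {k : ℕ} {A : Finset Literal} (h : Ref F k A)
    (hFG : ∀ C ∈ F, ∃ D ∈ G, D ⊆ C) : Ref G k A := by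
  induction h with
  | base hC hA =>
    obtain ⟨D, hD, hDC⟩ := hFG _ hC
    exact .base hD (hDC.trans hA)
  | step x _ _ ih₁ ih₂ => exact .step x ih₁ ih₂

theorem Ref.succ {F : ClauseSet} {k : ℕ} {A : Finset Literal} (h : Ref F k A) :
    Ref F (k + 1) A := by
  induction h with
  | base hC hA => exact .base hC hA
  | step x _ _ ih₁ ih₂ => exact .step x ih₁ ih₂

theorem Ref.mono_level {F : ClauseSet} {k m : ℕ} {A : Finset Literal} (h : Ref F k A)
    (hkm : k ≤ m) : Ref F m A :=
  Nat.le_induction h (fun _ _ => Ref.succ) m hkm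

theorem Ref.sound {F : ClauseSet} {k : ℕ} {A : Finset Literal} (h : Ref F k A) {v : ℕ → Bool}
    (hv : ∀ x ∈ A, ¬ LitTrue v x) : ¬ SatCNF v F := by
  induction h with
  | base hC hA =>
    intro hs
    obtain ⟨x, hx, hvx⟩ := hs _ hC
    exact hv x (hA hx) hvx
  | step x _ _ ih₁ ih₂ =>
    by_cases hx : LitTrue v x
    · refine ih₂ fun y hy => ?_
      rcases Finset.mem_insert.1 hy with rfl | hy
      · rwa [litTrue_compl, not_not]
      · exact hv y hy
    · refine ih₁ fun y hy => ?_
      rcases Finset.mem_insert.1 hy with rfl | hy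
      · exact hx
      · exact hv y hy

theorem exists_falsifying {A : Finset Literal} (hA : IsClause A) :
    ∃ v : ℕ → Bool, ∀ x ∈ A, ¬ LitTrue v x := by
  classical
  refine ⟨fun n => decide ((n, false) ∈ A), fun x hx h => ?_⟩
  have hc := hA x hx
  rcases x with ⟨n, _ | _⟩
  · simp [LitTrue, hx] at h
  · simp only [LitTrue, decide_eq_true_eq] at h
    exact hc h

theorem mem_image_compl {A : Finset Literal} {x : Literal} : x ∈ A.image compl ↔ compl x ∈ A := by
  simp only [Finset.mem_image]
  exact ⟨fun ⟨y, hy, e⟩ => by rw [← e, compl_compl]; exact hy, fun h => ⟨_, h, compl_compl x⟩⟩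

theorem mem_falsify {A D : Finset Literal} {F : ClauseSet} :
    D ∈ falsify A F ↔ ∃ C ∈ F, (∀ x ∈ C, compl x ∉ A) ∧ C \ A = D := by
  simp only [falsify, assign, Finset.mem_image (s := F.filter _), Finset.mem_filter, and_assoc]
  refine exists_congr fun C => and_congr_right fun _ => ?_
  rw [Finset.disjoint_left]
  simp only [mem_image_compl, compl_compl]
  rw [Finset.filter_notMem_eq_sdiff]

theorem mem_setFalse {x : Literal} {G : ClauseSet} {D : Finset Literal} :
    D ∈ setFalse x G ↔ ∃ C ∈ G, compl x ∉ C ∧ C.erase x = D := by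
  simp only [setFalse, assign, Finset.mem_image, Finset.mem_filter, and_assoc,
    Finset.disjoint_singleton_right, Finset.mem_singleton, compl_inj, Finset.filter_ne']

theorem setTrue_eq (x : Literal) (G : ClauseSet) : setTrue x G = setFalse (compl x) G := by
  rw [setTrue, setFalse, compl_compl]

theorem setFalse_falsify {x : Literal} {A : Finset Literal} {F : ClauseSet} (hx : compl x ∉ A) :
    setFalse x (falsify A F) = falsify (insert x A) F := by
  ext D
  simp only [mem_setFalse, mem_falsify]
  constructor
  · rintro ⟨_, ⟨C, hC, h, rfl⟩, hxC, rfl⟩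
    refine ⟨C, hC, fun y hy hyA => ?_, by rw [Finset.sdiff_insert]⟩
    rcases Finset.mem_insert.1 hyA with e | hyA
    · exact hxC (by rw [← e, compl_compl]; exact Finset.mem_sdiff.2 ⟨hy, fun hyA => hx (by
        rw [← e, compl_compl]; exact hyA)⟩)
    · exact h y hy hyA
  · rintro ⟨C, hC, h, rfl⟩
    refine ⟨C \ A, ⟨C, hC, fun y hy hyA => h y hy (Finset.mem_insert_of_mem hyA), rfl⟩, ?_, by
      rw [Finset.sdiff_insert]⟩
    intro hxC
    exact h _ (Finset.mem_sdiff.1 hxC).1 (by rw [compl_compl]; exact Finset.mem_insert_self _ _)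

theorem mem_lits {x : Literal} {G : ClauseSet} : x ∈ lits G ↔ ∃ C ∈ G, x ∈ C ∨ compl x ∈ C := by
  simp only [lits, Finset.mem_biUnion, Finset.mem_union, mem_image_compl]

theorem notMem_of_mem_lits_falsify {x : Literal} {A : Finset Literal} {F : ClauseSet}
    (hx : x ∈ lits (falsify A F)) : x ∉ A ∧ compl x ∉ A := by
  obtain ⟨D, hD, hxD⟩ := mem_lits.1 hx
  obtain ⟨C, _, h, rfl⟩ := mem_falsify.1 hD
  rcases hxD with hxD | hxD
  · exact ⟨(Finset.mem_sdiff.1 hxD).2, h x (Finset.mem_sdiff.1 hxD).1⟩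
  · refine ⟨?_, (Finset.mem_sdiff.1 hxD).2⟩
    simpa using h _ (Finset.mem_sdiff.1 hxD).1

theorem falsify_insert_of_notMem_lits {x : Literal} {A : Finset Literal} {F : ClauseSet}
    (hxA : compl x ∉ A) (hx : x ∉ lits (falsify A F)) :
    falsify (insert x A) F = falsify A F := by
  rw [← setFalse_falsify hxA]
  have h : ∀ C ∈ falsify A F, x ∉ C ∧ compl x ∉ C := fun C hC =>
    ⟨fun h => hx (mem_lits.2 ⟨C, hC, .inl h⟩), fun h => hx (mem_lits.2 ⟨C, hC, .inr h⟩)⟩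
  ext D
  rw [mem_setFalse]
  constructor
  · rintro ⟨C, hC, _, rfl⟩
    rwa [Finset.erase_eq_of_notMem (h C hC).1]
  · exact fun hD => ⟨D, hD, (h D hD).2, Finset.erase_eq_of_notMem (h D hD).1⟩

theorem isClause_insert {x : Literal} {A : Finset Literal} (hA : IsClause A) (hx : compl x ∉ A) :
    IsClause (insert x A) := by
  intro y hy hc
  rcases Finset.mem_insert.1 hy with rfl | hy
  · rcases Finset.mem_insert.1 hc with e | hc
    · exact compl_ne _ e
    · exact hx hc
  · rcases Finset.mem_insert.1 hc with e | hc
    · exact hx (by rw [← e, compl_compl]; exact hy)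
    · exact hA y hy hc

theorem empty_mem_falsify {A : Finset Literal} {F : ClauseSet} (hA : IsClause A) :
    ∅ ∈ falsify A F ↔ ∃ C ∈ F, C ⊆ A := by
  rw [mem_falsify]
  refine exists_congr fun C => and_congr_right fun _ => ?_
  rw [Finset.sdiff_eq_empty_iff_subset]
  exact ⟨fun h => h.2, fun h => ⟨fun x hx => hA x (h hx), h⟩⟩

/-- Without literals only `∅` and `{∅}` are possible. In the first case an assignment falsifying `A`
would satisfy `F`, contradicting `Ref.sound`. -/
theorem Ref.falsify_eq_of_lits_empty {F : ClauseSet} {k : ℕ} {A : Finset Literal}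
    (hA : IsClause A) (h : Ref F k A) (hl : ∀ x, x ∉ lits (falsify A F)) :
    falsify A F = {∅} := by
  have h₁ : ∀ C ∈ falsify A F, C = ∅ := fun C hC =>
    Finset.eq_empty_of_forall_notMem fun x hx => hl x (mem_lits.2 ⟨C, hC, .inl hx⟩)
  refine Finset.eq_singleton_iff_unique_mem.2 ⟨?_, h₁⟩
  by_contra hne
  obtain ⟨v, hv⟩ := exists_falsifying hA
  refine h.sound hv fun C hC => ?_
  by_contra hvC
  refine hne ?_
  have hmem : C \ A ∈ falsify A F := mem_falsify.2 ⟨C, hC, fun x hx hxA => hvC ⟨x, hx, ?_⟩, rfl⟩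
  · rwa [h₁ _ hmem] at hmem
  · by_contra hvx
    exact hv _ hxA (litTrue_compl.2 hvx)

/-- Induction on the level and, within a level, on the number of remaining variables. If propagation
picks `x`, its condition is the first premise of `Ref.step`; conversely, a derivation for `A` also
works for the larger set. Thus the choice is irrelevant. If no literal can be picked, a derivation
at level `k + 1` collapses to level `k`; then every occurring literal could have been picked, so
none occurs. -/
theorem rk_falsify_eq_iff {F : ClauseSet} (k : ℕ) {A : Finset Literal} (hA : IsClause A) :
    rk k (falsify A F) = {∅} ↔ Ref F k A := by
  induction k generalizing A with
  | zero =>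
    have h : rk 0 (falsify A F) = {∅} ↔ ∅ ∈ falsify A F := by
      simp only [rk]
      split_ifs with h
      · simp [h]
      · exact ⟨fun e => absurd (e ▸ Finset.mem_singleton_self ∅) h, fun e => absurd e h⟩
    rw [h, empty_mem_falsify hA]
    refine ⟨fun ⟨C, hC, hCA⟩ => .base hC hCA, fun h => ?_⟩
    cases h with
    | base hC hCA => exact ⟨_, hC, hCA⟩
  | succ k ih =>
    generalize hn : (vars (falsify A F)).card = n
    induction n using Nat.strong_induction_on generalizing A with
    | _ n ihn =>
    rw [rk, propagate]
    split_ifs with h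
    · have hx := h.choose_spec.1
      have hP := h.choose_spec.2
      have hc := hx
      set x := h.choose
      obtain ⟨hxA, hxA'⟩ := notMem_of_mem_lits_falsify hx
      have e : setTrue x (falsify A F) = falsify (insert (compl x) A) F := by
        rw [setTrue_eq, setFalse_falsify (by simpa using hxA)]
      have hlt := vars_setTrue_card_lt hx
      rw [e, hn] at hlt
      have key := ihn _ hlt (isClause_insert hA (x := compl x) (by simpa using hxA)) rfl
      rw [rk] at key
      rw [e, key]
      rw [setFalse_falsify hxA', ih (isClause_insert hA hxA')] at hP
      exact ⟨fun hr => .step x hP hr, fun hr => hr.mono_set (Finset.subset_insert _ _)⟩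
    · have hno : ∀ x ∈ lits (falsify A F), ¬ Ref F k (insert x A) := by
        intro x hx hr
        obtain ⟨_, hxA'⟩ := notMem_of_mem_lits_falsify hx
        refine h ⟨x, hx, ?_⟩
        rwa [setFalse_falsify hxA', ih (isClause_insert hA hxA')]
      constructor
      · intro e
        obtain ⟨C, hC, hCA⟩ := (empty_mem_falsify hA).1 (e ▸ Finset.mem_singleton_self ∅)
        exact .base hC hCA
      · intro hr
        suffices hl : ∀ x, x ∉ lits (falsify A F) from hr.falsify_eq_of_lits_empty hA hl
        suffices hk : Ref F k A from fun x hx => hno x hx (hk.mono_set (Finset.subset_insert _ _))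
        -- Collapse of the level. A step on `x ∈ B` has a premise about `B` itself at level `k`; if
        -- `compl x ∈ B`, the other premise is about `B` and the induction continues; otherwise `x`
        -- does not occur in the reduced clause-set, and falsifying it changes nothing.
        have aux : ∀ j B, Ref F j B → j = k + 1 → B = A → Ref F k A := by
          intro j B hr
          induction hr with
          | base hC hCA => exact fun _ e => e ▸ .base hC hCA
          | @step j B x h₁ _ _ ih₂ =>
            intro hj hB
            obtain rfl : j = k := by omega
            subst hB
            by_cases hx : x ∈ B
            · rwa [Finset.insert_eq_of_mem hx] at h₁
            · by_cases hx' : compl x ∈ B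
              · exact ih₂ rfl (Finset.insert_eq_of_mem hx')
              · have hxl : x ∉ lits (falsify B F) := fun hxl => hno x hxl h₁
                rw [← ih (isClause_insert hA hx'), falsify_insert_of_notMem_lits hx' hxl,
                  ih hA] at h₁
                exact h₁
        exact aux _ _ hr rfl rfl

theorem impliesK_iff {F : ClauseSet} {k : ℕ} {C : Finset Literal} (hC : IsClause C) :
    ImpliesK k F C ↔ Ref F k C := rk_falsify_eq_iff k hC

/-- The infimum over an empty set would be `⊤`; over a nonempty set it is attained, and monotonicity
in the level carries the derivations up to `k`. -/
theorem hardness_le_iff {F : ClauseSet} {k : ℕ} :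
    hardness F ≤ k ↔ ∀ C, IsClause C → Implies F C → Ref F k C := by
  constructor
  · intro h C hC hF
    have hne : {m : ℕ∞ | ∃ k : ℕ, m = k ∧ ∀ C, IsClause C → Implies F C → ImpliesK k F C}.Nonempty := by
      by_contra hne
      rw [Set.not_nonempty_iff_eq_empty] at hne
      rw [hardness, hne, sInf_empty] at h
      exact absurd h (by simp)
    obtain ⟨j, hj, hr⟩ := csInf_mem hne
    rw [← hardness] at hj
    rw [hj] at h
    exact ((impliesK_iff hC).1 (hr C hC hF)).mono_level (by exact_mod_cast h)
  · exact fun h => sInf_le ⟨k, rfl, fun C hC hF => (impliesK_iff hC).2 (h C hC hF)⟩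

/-! ### General facts on `k`-bases -/

/-- Derivations exist only at finite levels; the bound at `⊤` is trivial. -/
theorem hardness_le_of_forall_nat {G H : ClauseSet}
    (h : ∀ n : ℕ, hardness G ≤ n → hardness H ≤ n) {k : ℕ∞} (hk : hardness G ≤ k) :
    hardness H ≤ k := by
  induction k using ENat.recTopCoe with
  | top => exact le_top
  | coe n => exact h n hk

theorem Equivalent.symm {F G : ClauseSet} (h : Equivalent F G) : Equivalent G F :=
  fun v => (h v).symm

theorem Equivalent.trans {F G H : ClauseSet} (h : Equivalent F G) (h' : Equivalent G H) :
    Equivalent F H := fun v => (h v).trans (h' v)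

theorem Equivalent.implies_iff {F G : ClauseSet} (h : Equivalent F G) {C : Finset Literal} :
    Implies F C ↔ Implies G C :=
  forall_congr' fun v => by rw [h v]

theorem Equivalent.satisfiable {F G : ClauseSet} (h : Equivalent F G) (hF : Satisfiable F) :
    Satisfiable G :=
  let ⟨v, hv⟩ := hF
  ⟨v, (h v).1 hv⟩

theorem Equivalent.isPrimeImplicate_iff {F G : ClauseSet} (h : Equivalent F G)
    {C : Finset Literal} : IsPrimeImplicate F C ↔ IsPrimeImplicate G C := by
  simp only [IsPrimeImplicate, h.implies_iff]

theorem SatClause.mono {v : ℕ → Bool} {C D : Finset Literal} (h : SatClause v C) (hCD : C ⊆ D) :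
    SatClause v D :=
  let ⟨x, hx, hv⟩ := h
  ⟨x, hCD hx, hv⟩

theorem Implies.mono {F : ClauseSet} {C D : Finset Literal} (h : Implies F C) (hCD : C ⊆ D) :
    Implies F D := fun v hv => (h v hv).mono hCD

theorem implies_of_mem {F : ClauseSet} {C : Finset Literal} (h : C ∈ F) : Implies F C :=
  fun _ hv => hv C h

theorem IsClause.subset {C D : Finset Literal} (h : IsClause D) (hCD : C ⊆ D) : IsClause C :=
  fun x hx hx' => h x (hCD hx) (hCD hx')

theorem isClause_empty : IsClause ∅ := fun _ h => absurd h (Finset.notMem_empty _)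

theorem isClause_singleton (x : Literal) : IsClause {x} := fun y hy h => by
  rw [Finset.mem_singleton] at hy h
  exact compl_ne y (h.trans hy.symm)

theorem exists_primeImplicate_subset {F : ClauseSet} {C : Finset Literal} (hC : IsClause C)
    (h : Implies F C) : ∃ D ⊆ C, IsPrimeImplicate F D := by
  induction C using Finset.strongInduction with
  | H C ih =>
  by_cases hp : ∀ D, D ⊂ C → ¬ Implies F D
  · exact ⟨C, subset_rfl, hC, h, hp⟩
  · push Not at hp
    obtain ⟨D, hD, hF⟩ := hp
    obtain ⟨E, hE, hE'⟩ := ih D hD (hC.subset hD.subset) hF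
    exact ⟨E, hE.trans hD.subset, hE'⟩

theorem equivalent_shorten {G : ClauseSet} {C D : Finset Literal} (hDC : D ⊆ C)
    (hD : Implies G D) : Equivalent (insert D (G.erase C)) G := by
  intro v
  constructor
  · intro hv E hE
    by_cases hEC : E = C
    · exact hEC ▸ (hv D (Finset.mem_insert_self _ _)).mono hDC
    · exact hv E (Finset.mem_insert_of_mem (Finset.mem_erase.2 ⟨hEC, hE⟩))
  · intro hv E hE
    rcases Finset.mem_insert.1 hE with rfl | hE
    · exact hD v hv
    · exact hv E (Finset.mem_of_mem_erase hE)

/-- Suppose a proper subclause `D` of `C` were implied. Dropping from `C` a literal outside `D`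
preserves equivalence, and by `Ref.mono_clauses` it does not raise the hardness, against the
definition of a base. -/
theorem IsEquivKBase.isPrimeImplicate {k : ℕ∞} {F G : ClauseSet} (h : IsEquivKBase k F G)
    {C : Finset Literal} (hC : C ∈ G) : IsPrimeImplicate F C := by
  obtain ⟨⟨hG, hk, hr⟩, he⟩ := h
  rw [← he.isPrimeImplicate_iff]
  refine ⟨hG C hC, implies_of_mem hC, fun D hD hGD => ?_⟩
  obtain ⟨x, hx, hxD⟩ := Finset.exists_of_ssubset hD
  have hsub : D ⊆ C.erase x := fun y hy =>
    Finset.mem_erase.2 ⟨fun e => hxD (e ▸ hy), hD.subset hy⟩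
  have heq := equivalent_shorten (C := C) (Finset.erase_subset x C) (hGD.mono hsub)
  rcases hr _ (.inr ⟨C, hC, x, hx, rfl⟩) with h | h
  · exact h heq
  · refine absurd h (not_lt.2 (hardness_le_of_forall_nat (fun n hn => ?_) hk))
    rw [hardness_le_iff] at hn ⊢
    intro E hE hGE
    refine (hn E hE (heq.implies_iff.1 hGE)).mono_clauses fun A hA => ?_
    by_cases hAC : A = C
    · exact ⟨_, Finset.mem_insert_self _ _, hAC ▸ Finset.erase_subset x C⟩
    · exact ⟨A, Finset.mem_insert_of_mem (Finset.mem_erase.2 ⟨hAC, hA⟩), subset_rfl⟩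

theorem hardness_le_zero_iff {G : ClauseSet} :
    hardness G ≤ 0 ↔ ∀ C, IsClause C → Implies G C → ∃ D ∈ G, D ⊆ C := by
  have := hardness_le_iff (F := G) (k := 0)
  rw [Nat.cast_zero] at this
  rw [this]
  refine forall_congr' fun C => forall_congr' fun _ => forall_congr' fun _ => ?_
  refine ⟨fun h => ?_, fun ⟨D, hD, hDC⟩ => .base hD hDC⟩
  cases h with
  | base hD hDC => exact ⟨_, hD, hDC⟩

/-- A literal cannot be removed from a prime implicate. -/
theorem not_equivalent_shorten {F G : ClauseSet} (he : Equivalent G F) {C : Finset Literal}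
    (hp : IsPrimeImplicate F C) {x : Literal} (hx : x ∈ C) :
    ¬ Equivalent (insert (C.erase x) (G.erase C)) G := fun h =>
  hp.2.2 _ (Finset.erase_ssubset hx)
    ((h.trans he).implies_iff.1 (implies_of_mem (Finset.mem_insert_self _ _)))

/-- Under hardness 0 every implicate contains a clause of `G`, and for a prime implicate this can
only be the clause itself. For the same reason no prime implicate can be removed from the full set
without raising the hardness. -/
theorem isEquivKBase_zero_iff {F G : ClauseSet} (hF : IsClauseSet F) :
    IsEquivKBase 0 F G ↔ ∀ C, C ∈ G ↔ IsPrimeImplicate F C := by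
  constructor
  · intro h C
    refine ⟨fun hC => h.isPrimeImplicate hC, fun hC => ?_⟩
    obtain ⟨D, hD, hDC⟩ := hardness_le_zero_iff.1 h.1.2.1 C hC.1 (h.2.implies_iff.2 hC.2.1)
    rcases hDC.eq_or_ssubset with rfl | hDC
    · exact hD
    · exact absurd (h.2.implies_iff.1 (implies_of_mem hD)) (hC.2.2 D hDC)
  · intro h
    have he : Equivalent G F := by
      intro v
      constructor
      · intro hv C hC
        obtain ⟨D, hDC, hD⟩ := exists_primeImplicate_subset (hF C hC) (implies_of_mem hC)
        exact (hv D ((h D).2 hD)).mono hDC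
      · exact fun hv C hC => ((h C).1 hC).2.1 v hv
    refine ⟨⟨fun C hC => ((h C).1 hC).1, hardness_le_zero_iff.2 fun C hC hGC => ?_, ?_⟩, he⟩
    · obtain ⟨D, hDC, hD⟩ := exists_primeImplicate_subset hC (he.implies_iff.1 hGC)
      exact ⟨D, (h D).2 hD, hDC⟩
    · rintro H (⟨C, hC, rfl⟩ | ⟨C, hC, x, hx, rfl⟩)
      · by_contra hcon
        push Not at hcon
        obtain ⟨he', hk⟩ := hcon
        have hp := (h C).1 hC
        obtain ⟨D, hD, hDC⟩ := hardness_le_zero_iff.1 hk C hp.1 ((he'.trans he).implies_iff.2 hp.2.1)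
        obtain ⟨hne, hDG⟩ := Finset.mem_erase.1 hD
        exact hp.2.2 D (hDC.ssubset_of_ne hne) ((h D).1 hDG).2.1
      · exact .inl (not_equivalent_shorten he ((h C).1 hC) hx)

/-! ### Forced literals -/

theorem eq_or_eq_compl {x y : Literal} (h : y.1 = x.1) : y = x ∨ y = compl x := by
  rcases x with ⟨n, _ | _⟩ <;> rcases y with ⟨m, _ | _⟩ <;> simp_all [compl]

/-- `x` and its complement do not occur in `G`. -/
def Fresh (x : Literal) (G : ClauseSet) : Prop := ∀ C ∈ G, x ∉ C ∧ compl x ∉ C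

theorem satClause_update {x : Literal} {C : Finset Literal} (h : x ∉ C) (h' : compl x ∉ C)
    (v : ℕ → Bool) (b : Bool) : SatClause (Function.update v x.1 b) C ↔ SatClause v C := by
  refine exists_congr fun y => and_congr_right fun hy => ?_
  rw [Function.update_of_ne]
  intro e
  rcases eq_or_eq_compl e with rfl | rfl
  · exact h hy
  · exact h' hy

theorem Fresh.satCNF_update {x : Literal} {G : ClauseSet} (h : Fresh x G) (v : ℕ → Bool) (b : Bool) :
    SatCNF (Function.update v x.1 b) G ↔ SatCNF v G :=
  forall₂_congr fun C hC => satClause_update (h C hC).1 (h C hC).2 v b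

theorem satCNF_insert_unit {v : ℕ → Bool} {x : Literal} {G : ClauseSet} :
    SatCNF v (insert {x} G) ↔ LitTrue v x ∧ SatCNF v G := by
  simp only [SatCNF, Finset.forall_mem_insert, SatClause, Finset.mem_singleton, LitTrue,
    exists_eq_left]

theorem satCNF_insert_unit_update {v : ℕ → Bool} {x : Literal} {G : ClauseSet} (h : Fresh x G) :
    SatCNF (Function.update v x.1 x.2) (insert {x} G) ↔ SatCNF v G := by
  rw [satCNF_insert_unit, h.satCNF_update]
  simp [LitTrue]

theorem equivalent_insert_unit_iff {x : Literal} {G H : ClauseSet} (hG : Fresh x G)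
    (hH : Fresh x H) : Equivalent (insert {x} G) (insert {x} H) ↔ Equivalent G H := by
  refine ⟨fun h v => ?_, fun h v => ?_⟩
  · rw [← satCNF_insert_unit_update hG, h, satCNF_insert_unit_update hH]
  · rw [satCNF_insert_unit, satCNF_insert_unit, h]

/-- As long as `x` is not falsified, the unit clause closes no leaf. A branching on the variable of
`x` is replaced by its branch falsifying `compl x`, a literal that no clause of `G` contains. -/
theorem Ref.of_insert_unit {x : Literal} {G : ClauseSet} (hG : Fresh x G) {k : ℕ}
    {A : Finset Literal} (h : Ref (insert {x} G) k A) (hx : x ∉ A) :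
    Ref G k (A.erase (compl x)) := by
  induction h with
  | @base k A C hC hCA =>
    rcases Finset.mem_insert.1 hC with rfl | hC
    · exact absurd (hCA (Finset.mem_singleton_self x)) hx
    · exact .base hC fun y hy => Finset.mem_erase.2
        ⟨fun e => (hG C hC).2 (e ▸ hy), hCA hy⟩
  | @step k A y _ _ ih₁ ih₂ =>
    by_cases h₁ : y = x
    · have := ih₂ (by
        rw [h₁, Finset.mem_insert, not_or]
        exact ⟨(compl_ne x).symm, hx⟩)
      rw [h₁, Finset.erase_insert_eq_erase] at this
      exact this
    · have h₃ := ih₁ (by rw [Finset.mem_insert, not_or]; exact ⟨Ne.symm h₁, hx⟩)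
      by_cases h₂ : y = compl x
      · rw [h₂, Finset.erase_insert_eq_erase] at h₃
        exact h₃.succ
      · have h₄ := ih₂ (by
          rw [Finset.mem_insert, not_or]
          exact ⟨fun e => h₂ (by rw [e, compl_compl]), hx⟩)
        rw [Finset.erase_insert_of_ne h₂] at h₃
        rw [Finset.erase_insert_of_ne (fun e => h₁ (compl_inj.1 e))] at h₄
        exact .step y h₃ h₄

/-- The variable of `x` is irrelevant for `G`. An implicate of `G` may therefore lose `x`, and an
implicate of the extended set that does not contain `x` may lose `compl x` to become one of `G`.
Derivations are transferred by `Ref.of_insert_unit` and by monotonicity. -/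
theorem hardness_insert_unit_le_iff {x : Literal} {G : ClauseSet} (hG : Fresh x G) {k : ℕ∞} :
    hardness (insert {x} G) ≤ k ↔ hardness G ≤ k := by
  refine ⟨hardness_le_of_forall_nat fun n hn => ?_, hardness_le_of_forall_nat fun n hn => ?_⟩
  · rw [hardness_le_iff] at hn ⊢
    intro C hC hGC
    have himp : Implies (insert {x} G) (C.erase x) := by
      intro v hv
      by_cases hx : x ∈ C
      swap
      · rw [Finset.erase_eq_of_notMem hx]
        exact hGC v (satCNF_insert_unit.1 hv).2
      have hv' : SatCNF (Function.update v x.1 (!x.2)) G :=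
        (hG.satCNF_update _ _).2 (satCNF_insert_unit.1 hv).2
      obtain ⟨y, hy, hvy⟩ := hGC _ hv'
      have hyx : y ≠ x := by
        rintro rfl
        simp at hvy
      refine ⟨y, Finset.mem_erase.2 ⟨hyx, hy⟩, ?_⟩
      rwa [Function.update_of_ne] at hvy
      intro e
      rcases eq_or_eq_compl e with rfl | rfl
      · exact hyx rfl
      · exact hC x hx hy
    exact ((hn _ (hC.subset (Finset.erase_subset _ _)) himp).of_insert_unit hG
      (Finset.notMem_erase _ _)).mono_set ((Finset.erase_subset _ _).trans (Finset.erase_subset _ _))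
  · rw [hardness_le_iff] at hn ⊢
    intro C hC hGC
    by_cases hx : x ∈ C
    · exact .base (Finset.mem_insert_self _ _) (Finset.singleton_subset_iff.2 hx)
    · have himp : Implies G (C.erase (compl x)) := by
        intro v hv
        obtain ⟨y, hy, hvy⟩ := hGC _ ((satCNF_insert_unit_update hG).2 hv)
        have hyx : y ≠ compl x := by
          rintro rfl
          simp [compl] at hvy
        refine ⟨y, Finset.mem_erase.2 ⟨hyx, hy⟩, ?_⟩
        rwa [Function.update_of_ne] at hvy
        intro e
        rcases eq_or_eq_compl e with rfl | rfl
        · exact hx hy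
        · exact hyx rfl
      exact ((hn _ (hC.subset (Finset.erase_subset _ _)) himp).mono_set
        (Finset.erase_subset _ _)).mono_clauses fun D hD =>
          ⟨D, Finset.mem_insert_of_mem hD, subset_rfl⟩

theorem Fresh.removal {x : Literal} {G H : ClauseSet} (hG : Fresh x G) (h : IsRemoval G H) :
    Fresh x H := by
  rcases h with ⟨C, hC, rfl⟩ | ⟨C, hC, y, hy, rfl⟩
  · exact fun D hD => hG D (Finset.mem_of_mem_erase hD)
  · intro D hD
    rcases Finset.mem_insert.1 hD with rfl | hD
    · exact ⟨fun h => (hG C hC).1 (Finset.mem_of_mem_erase h),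
        fun h => (hG C hC).2 (Finset.mem_of_mem_erase h)⟩
    · exact hG D (Finset.mem_of_mem_erase hD)

theorem Fresh.notMem {x : Literal} {G : ClauseSet} (hG : Fresh x G) : {x} ∉ G :=
  fun h => (hG _ h).1 (Finset.mem_singleton_self x)

theorem isRemoval_insert_unit_iff {x : Literal} {G H : ClauseSet} (hG : Fresh x G) :
    IsRemoval (insert {x} G) H ↔
      H = G ∨ H = insert ∅ G ∨ ∃ H', IsRemoval G H' ∧ H = insert {x} H' := by
  have hne : ∀ C ∈ G, {x} ≠ C := fun C hC e => hG.notMem (e ▸ hC)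
  have he : ∀ C ∈ G, (insert {x} G : ClauseSet).erase C = insert {x} (G.erase C) := fun C hC =>
    Finset.erase_insert_of_ne (hne C hC)
  have hx : (insert {x} G : ClauseSet).erase {x} = G := Finset.erase_insert hG.notMem
  constructor
  · rintro (⟨C, hC, rfl⟩ | ⟨C, hC, y, hy, rfl⟩)
    · rcases Finset.mem_insert.1 hC with rfl | hC
      · exact .inl hx
      · exact .inr (.inr ⟨_, .inl ⟨C, hC, rfl⟩, he C hC⟩)
    · rcases Finset.mem_insert.1 hC with rfl | hC
      · rw [Finset.mem_singleton] at hy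
        subst hy
        rw [hx, Finset.erase_singleton]
        exact .inr (.inl rfl)
      · exact .inr (.inr ⟨_, .inr ⟨C, hC, y, hy, rfl⟩, by rw [he C hC, Finset.insert_comm]⟩)
  · rintro (rfl | rfl | ⟨_, ⟨C, hC, rfl⟩ | ⟨C, hC, y, hy, rfl⟩, rfl⟩)
    · exact .inl ⟨_, Finset.mem_insert_self _ _, hx.symm⟩
    · exact .inr ⟨_, Finset.mem_insert_self _ _, x, Finset.mem_singleton_self x, by
        rw [hx, Finset.erase_singleton]⟩
    · exact .inl ⟨C, Finset.mem_insert_of_mem hC, (he C hC).symm⟩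
    · exact .inr ⟨C, Finset.mem_insert_of_mem hC, y, hy, by rw [he C hC, Finset.insert_comm]⟩

theorem not_satCNF_of_empty_mem {v : ℕ → Bool} {G : ClauseSet} (h : ∅ ∈ G) : ¬ SatCNF v G :=
  fun hv => by simpa [SatClause] using hv ∅ h

/-- Removals inside `G` correspond to each other. The two removals that hit the unit destroy
equivalence because `G` is satisfiable: dropping the unit admits models with `x` false, and emptying
it admits none. -/
theorem isKBase_insert_unit_iff {x : Literal} {G : ClauseSet} (hG : Fresh x G)
    (hs : Satisfiable G) {k : ℕ∞} : IsKBase k (insert {x} G) ↔ IsKBase k G := by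
  obtain ⟨v, hv⟩ := hs
  have hc : IsClauseSet (insert {x} G) ↔ IsClauseSet G := by
    simp [IsClauseSet, isClause_singleton]
  have key : ∀ H, IsRemoval G H →
      ((¬ Equivalent (insert {x} H) (insert {x} G) ∨ k < hardness (insert {x} H)) ↔
        (¬ Equivalent H G ∨ k < hardness H)) := fun H hH => by
    rw [equivalent_insert_unit_iff (hG.removal hH) hG, ← not_le, ← not_le,
      hardness_insert_unit_le_iff (hG.removal hH)]
  rw [IsKBase, IsKBase, hc, hardness_insert_unit_le_iff hG]
  refine and_congr_right fun _ => and_congr_right fun _ => ⟨fun h H hH => ?_, fun h H hH => ?_⟩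
  · exact (key H hH).1 (h _ ((isRemoval_insert_unit_iff hG).2 (.inr (.inr ⟨H, hH, rfl⟩))))
  · rcases (isRemoval_insert_unit_iff hG).1 hH with rfl | rfl | ⟨H', hH', rfl⟩
    · refine .inl fun he => ?_
      have := (satCNF_insert_unit.1 ((he _).1 ((hG.satCNF_update v (!x.2)).2 hv))).1
      simp [LitTrue] at this
    · exact .inl fun he => not_satCNF_of_empty_mem (Finset.mem_insert_self _ _)
        ((he _).2 ((satCNF_insert_unit_update hG).2 hv))
    · exact (key H' hH').2 (h H' hH')

/-- After making `x` false the clause must be satisfied by another literal, which is unaffected by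
the change; so `x` would be superfluous. -/
theorem IsPrimeImplicate.notMem_of_indep {F : ClauseSet} {D : Finset Literal}
    (hD : IsPrimeImplicate F D) {x : Literal}
    (hF : ∀ v b, SatCNF v F → SatCNF (Function.update v x.1 b) F) : x ∉ D := by
  intro hx
  refine hD.2.2 _ (Finset.erase_ssubset hx) fun v hv => ?_
  obtain ⟨y, hy, hvy⟩ := hD.2.1 _ (hF v (!x.2) hv)
  have hyx : y ≠ x := by
    rintro rfl
    simp at hvy
  refine ⟨y, Finset.mem_erase.2 ⟨hyx, hy⟩, ?_⟩
  rwa [Function.update_of_ne] at hvy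
  intro e
  rcases eq_or_eq_compl e with rfl | rfl
  · exact hyx rfl
  · exact hD.1 x hx hy

theorem isPrimeImplicate_of_forced {F : ClauseSet} (hs : Satisfiable F) {x : Literal}
    (hx : Forced F x) : IsPrimeImplicate F {x} := by
  refine ⟨isClause_singleton x, hx, fun D hD hF => ?_⟩
  obtain ⟨v, hv⟩ := hs
  rw [Finset.ssubset_singleton_iff] at hD
  obtain ⟨y, hy, _⟩ := hF v hv
  simp [hD] at hy

theorem IsPrimeImplicate.eq_of_forced {F : ClauseSet} {D : Finset Literal}
    (hD : IsPrimeImplicate F D) {x : Literal} (hx : Forced F x) (hxD : x ∈ D) : D = {x} := by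
  by_contra hne
  exact hD.2.2 {x} ((Finset.singleton_subset_iff.2 hxD).ssubset_of_ne (Ne.symm hne)) hx

theorem IsPrimeImplicate.compl_notMem_of_forced {F : ClauseSet} {D : Finset Literal}
    (hD : IsPrimeImplicate F D) {x : Literal} (hx : Forced F x) : compl x ∉ D := by
  intro hxD
  refine hD.2.2 _ (Finset.erase_ssubset hxD) fun v hv => ?_
  obtain ⟨y, hy, hvy⟩ := hD.2.1 v hv
  refine ⟨y, Finset.mem_erase.2 ⟨?_, hy⟩, hvy⟩
  rintro rfl
  obtain ⟨z, hz, hvz⟩ := hx v hv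
  rw [Finset.mem_singleton] at hz
  subst hz
  exact litTrue_compl.1 hvy hvz

theorem fresh_erase_of_forced {F G : ClauseSet} (hG : ∀ C ∈ G, IsPrimeImplicate F C) {x : Literal}
    (hx : Forced F x) : Fresh x (G.erase {x}) := by
  intro C hC
  obtain ⟨hne, hC⟩ := Finset.mem_erase.1 hC
  exact ⟨fun h => hne ((hG C hC).eq_of_forced hx h), (hG C hC).compl_notMem_of_forced hx⟩

/-- All prime implicates other than `{x}` avoid the variable of `x`. Without `{x}`, a model of `G`
could be changed to make `x` false. -/
theorem IsEquivPrimeSubset.unit_mem_of_forced {F G : ClauseSet} (hG : IsEquivPrimeSubset F G)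
    (hs : Satisfiable F) {x : Literal} (hx : Forced F x) : {x} ∈ G := by
  by_contra hne
  have hfr := fresh_erase_of_forced hG.1 hx
  rw [Finset.erase_eq_of_notMem hne] at hfr
  obtain ⟨v, hv⟩ := hs
  have := hx _ ((hG.2 _).1 ((hfr.satCNF_update v (!x.2)).2 ((hG.2 v).2 hv)))
  simp [SatClause] at this

theorem IsEquivKBase.isEquivPrimeSubset {k : ℕ∞} {F G : ClauseSet} (h : IsEquivKBase k F G) :
    IsEquivPrimeSubset F G := ⟨fun _ hC => h.isPrimeImplicate hC, h.2⟩

theorem satCNF_setTrue {v : ℕ → Bool} {x : Literal} {F : ClauseSet} :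
    SatCNF v (setTrue x F) ↔ SatCNF (Function.update v x.1 x.2) F := by
  rw [setTrue_eq]
  have hself : ∀ C : Finset Literal, x ∈ C → SatClause (Function.update v x.1 x.2) C :=
    fun C hC => ⟨x, hC, by simp⟩
  constructor
  · intro h C hC
    by_cases hx : x ∈ C
    · exact hself C hx
    · obtain ⟨y, hy, hvy⟩ := h _ (mem_setFalse.2 ⟨C, hC, by simpa using hx, rfl⟩)
      have hm := Finset.mem_erase.1 hy
      refine ⟨y, hm.2, ?_⟩
      rw [Function.update_of_ne, hvy]
      intro e
      rcases eq_or_eq_compl e with rfl | rfl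
      · exact hx hm.2
      · exact hm.1 rfl
  · intro h D hD
    obtain ⟨C, hC, hx, rfl⟩ := mem_setFalse.1 hD
    rw [compl_compl] at hx
    obtain ⟨y, hy, hvy⟩ := h C hC
    have hne : y ≠ compl x := by
      rintro rfl
      simp [compl] at hvy
    refine ⟨y, Finset.mem_erase.2 ⟨hne, hy⟩, ?_⟩
    rwa [Function.update_of_ne] at hvy
    intro e
    rcases eq_or_eq_compl e with rfl | rfl
    · exact hx hy
    · exact hne rfl

theorem litTrue_of_forced {F : ClauseSet} {x : Literal} (hx : Forced F x) {v : ℕ → Bool}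
    (hv : SatCNF v F) : LitTrue v x := by
  obtain ⟨y, hy, hvy⟩ := hx v hv
  rw [Finset.mem_singleton] at hy
  exact hy ▸ hvy

theorem update_eq_of_litTrue {v : ℕ → Bool} {x : Literal} (h : LitTrue v x) :
    Function.update v x.1 x.2 = v := by
  rw [← (show v x.1 = x.2 from h), Function.update_eq_self]

theorem equivalent_insert_unit_setTrue {F G : ClauseSet} {x : Literal} (hx : Forced F x)
    (hG : Fresh x G) : Equivalent (insert {x} G) F ↔ Equivalent G (setTrue x F) := by
  refine ⟨fun h v => ?_, fun h v => ?_⟩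
  · rw [satCNF_setTrue, ← h, satCNF_insert_unit_update hG]
  · rw [satCNF_insert_unit, h, satCNF_setTrue]
    constructor
    · rintro ⟨h₁, h₂⟩
      rwa [update_eq_of_litTrue h₁] at h₂
    · intro hv
      have := litTrue_of_forced hx hv
      exact ⟨this, by rwa [update_eq_of_litTrue this]⟩

theorem isEquivKBase_insert_unit_iff {F G : ClauseSet} (hs : Satisfiable F) {x : Literal}
    (hx : Forced F x) (hG : Fresh x G) {k : ℕ∞} :
    IsEquivKBase k F (insert {x} G) ↔ IsEquivKBase k (setTrue x F) G := by
  rw [IsEquivKBase, IsEquivKBase, equivalent_insert_unit_setTrue hx hG]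
  refine and_congr_left fun h => isKBase_insert_unit_iff hG ?_
  obtain ⟨v, hv⟩ := hs
  refine ⟨v, (h v).2 ?_⟩
  rwa [satCNF_setTrue, update_eq_of_litTrue (litTrue_of_forced hx hv)]

theorem IsEquivKBase.fresh_setTrue {F G : ClauseSet} {x : Literal} {k : ℕ∞}
    (h : IsEquivKBase k (setTrue x F) G) : Fresh x G := by
  have hind : ∀ v b, SatCNF v (setTrue x F) → SatCNF (Function.update v x.1 b) (setTrue x F) := by
    intro v b hv
    rw [satCNF_setTrue] at hv ⊢
    rwa [Function.update_idem]
  exact fun C hC => ⟨(h.isPrimeImplicate hC).notMem_of_indep hind,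
    (h.isPrimeImplicate hC).notMem_of_indep (x := compl x) hind⟩

/-- Adding and removing the unit are inverse correspondences between the `k`-bases for `setTrue x F`
and those for `F`, and the measure always changes by exactly one. -/
theorem isShortestKBase_insert_unit {F G : ClauseSet} (hs : Satisfiable F) {x : Literal}
    (hx : Forced F x) {k : ℕ∞} {μ : ClauseSet → ℕ}
    (hμ : ∀ G, {x} ∉ G → μ (insert {x} G) = μ G + 1)
    (h : IsShortestKBase μ k (setTrue x F) G) : IsShortestKBase μ k F (insert {x} G) := by
  have hG := h.1.fresh_setTrue
  refine ⟨(isEquivKBase_insert_unit_iff hs hx hG).2 h.1, fun H hH => ?_⟩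
  have hxH := hH.isEquivPrimeSubset.unit_mem_of_forced hs hx
  have hfr := fresh_erase_of_forced hH.isEquivPrimeSubset.1 hx
  have e := Finset.insert_erase hxH
  rw [← e] at hH
  have := h.2 _ ((isEquivKBase_insert_unit_iff hs hx hfr).1 hH)
  rw [hμ G hG.notMem, ← e, hμ _ hfr.notMem]
  omega

theorem numClauses_insert_unit {x : Literal} {G : ClauseSet} (h : {x} ∉ G) :
    numClauses (insert {x} G) = numClauses G + 1 := Finset.card_insert_of_notMem h

theorem numLitOcc_insert_unit {x : Literal} {G : ClauseSet} (h : {x} ∉ G) :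
    numLitOcc (insert {x} G) = numLitOcc G + 1 := by
  rw [numLitOcc, Finset.sum_insert h, Finset.card_singleton, add_comm]; rfl

/-! ### Degenerate clause-sets -/

theorem isShortestKBase_of_unsatisfiable {F : ClauseSet} (hF : ¬ Satisfiable F) (k : ℕ∞) :
    IsShortestKBase numClauses k F {∅} ∧ IsShortestKBase numLitOcc k F {∅} := by
  have hb : IsEquivKBase k F {∅} := by
    refine ⟨⟨?_, ?_, ?_⟩, fun v => ?_⟩
    · intro C hC
      rw [Finset.mem_singleton.1 hC]
      exact isClause_empty
    · exact (hardness_le_zero_iff.2 fun C _ _ =>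
        ⟨∅, Finset.mem_singleton_self _, Finset.empty_subset _⟩).trans zero_le
    · rintro G (⟨C, hC, rfl⟩ | ⟨C, hC, x, hx, rfl⟩)
      · rw [Finset.mem_singleton.1 hC, Finset.erase_singleton]
        exact .inl fun h => not_satCNF_of_empty_mem (Finset.mem_singleton_self ∅)
          ((h fun _ => true).1 fun C hC => absurd hC (Finset.notMem_empty C))
      · rw [Finset.mem_singleton.1 hC] at hx
        exact absurd hx (Finset.notMem_empty x)
    · exact ⟨fun h => absurd h (not_satCNF_of_empty_mem (Finset.mem_singleton_self ∅)),
        fun h => absurd ⟨v, h⟩ hF⟩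
  refine ⟨⟨hb, fun H hH => ?_⟩, ⟨hb, fun H hH => by simp [numLitOcc]⟩⟩
  rw [numClauses, Finset.card_singleton]
  refine Finset.card_pos.2 (Finset.nonempty_iff_ne_empty.2 ?_)
  rintro rfl
  exact hF (hH.2.satisfiable ⟨fun _ => true, fun C hC => absurd hC (Finset.notMem_empty C)⟩)

theorem isShortestKBase_empty (k : ℕ∞) :
    IsShortestKBase numClauses k ∅ ∅ ∧ IsShortestKBase numLitOcc k ∅ ∅ := by
  have hb : IsEquivKBase k ∅ ∅ := by
    refine ⟨⟨fun C hC => absurd hC (Finset.notMem_empty C), ?_, ?_⟩, fun v => Iff.rfl⟩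
    · refine (hardness_le_zero_iff.2 fun C hC h => ?_).trans zero_le
      obtain ⟨v, hv⟩ := exists_falsifying hC
      obtain ⟨x, hx, hvx⟩ := h v fun C hC => absurd hC (Finset.notMem_empty C)
      exact absurd hvx (hv x hx)
    · rintro G (⟨C, hC, rfl⟩ | ⟨C, hC, x, hx, rfl⟩) <;> exact absurd hC (Finset.notMem_empty C)
  exact ⟨⟨hb, fun H _ => by simp [numClauses]⟩, ⟨hb, fun H _ => by simp [numLitOcc]⟩⟩

/-! ### The implication digraph of a 2-CNF -/

/-- The arc `p → q` of the implication digraph: the clause `{¬p, q}` is in `F`. -/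
def Arc (F : ClauseSet) (p q : Literal) : Prop := {compl p, q} ∈ F

/-- Reachability in the implication digraph. -/
def Reach (F : ClauseSet) : Literal → Literal → Prop := Relation.ReflTransGen (Arc F)

theorem Arc.skew {F : ClauseSet} {p q : Literal} (h : Arc F p q) : Arc F (compl q) (compl p) := by
  rw [Arc, compl_compl, Finset.pair_comm]
  exact h

theorem Reach.skew {F : ClauseSet} {p q : Literal} (h : Reach F p q) :
    Reach F (compl q) (compl p) := by
  induction h with
  | refl => exact .refl
  | tail _ h ih => exact .head h.skew ih

theorem Reach.skew' {F : ClauseSet} {p q : Literal} (h : Reach F (compl p) (compl q)) :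
    Reach F q p := by
  simpa using h.skew

theorem Reach.sound {F : ClauseSet} {p q : Literal} (h : Reach F p q) {v : ℕ → Bool}
    (hv : SatCNF v F) (hp : LitTrue v p) : LitTrue v q := by
  induction h with
  | refl => exact hp
  | tail _ h ih =>
    obtain ⟨x, hx, hvx⟩ := hv _ h
    rcases Finset.mem_insert.1 hx with rfl | hx
    · exact absurd ih (litTrue_compl.1 hvx)
    · exact Finset.mem_singleton.1 hx ▸ hvx

theorem Reach.implies {F : ClauseSet} {p q : Literal} (h : Reach F p q) :
    Implies F {compl p, q} := by
  intro v hv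
  by_cases hp : LitTrue v p
  · exact ⟨q, by simp, h.sound hv hp⟩
  · exact ⟨compl p, by simp, litTrue_compl.2 hp⟩

/-- No literal is equivalent to its complement. -/
def NoClash (F : ClauseSet) : Prop := ∀ x, ¬ (Reach F x (compl x) ∧ Reach F (compl x) x)

/-- A maximal closed and clash-free set containing `T`, given by Zorn's lemma, decides every
literal: if neither `x` nor `compl x` belongs to it, one of them does not reach its complement by
`NoClash`, and everything reachable from that one can be added. -/
theorem exists_respecting {F : ClauseSet} (hF : NoClash F) (T : Set Literal)
    (hcl : ∀ p ∈ T, ∀ q, Reach F p q → q ∈ T) (hco : ∀ p ∈ T, compl p ∉ T) :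
    ∃ v : ℕ → Bool, (∀ x ∈ T, LitTrue v x) ∧
      ∀ p q, Reach F p q → LitTrue v p → LitTrue v q := by
  classical
  obtain ⟨M, hTM, hM⟩ := zorn_subset_nonempty
    {T : Set Literal | (∀ p ∈ T, ∀ q, Reach F p q → q ∈ T) ∧ ∀ p ∈ T, compl p ∉ T} (by
      intro c hc hchain _
      refine ⟨⋃₀ c, ⟨?_, ?_⟩, fun s hs => Set.subset_sUnion_of_mem hs⟩
      · rintro p ⟨t, ht, hp⟩ q hq
        exact ⟨t, ht, (hc ht).1 p hp q hq⟩
      · rintro p ⟨t, ht, hp⟩ ⟨t', ht', hp'⟩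
        rcases hchain.total ht ht' with h | h
        · exact (hc ht').2 p (h hp) hp'
        · exact (hc ht).2 p hp (h hp')) T ⟨hcl, hco⟩
  obtain ⟨hMcl, hMco⟩ := hM.prop
  have hext : ∀ x, ¬ Reach F x (compl x) → compl x ∉ M → x ∈ M := by
    intro x hx hxM
    have hmem : M ∪ {y | Reach F x y} ∈ {T : Set Literal |
        (∀ p ∈ T, ∀ q, Reach F p q → q ∈ T) ∧ ∀ p ∈ T, compl p ∉ T} := by
      have hMx : ∀ p ∈ M, ¬ Reach F x (compl p) := fun p hp h =>
        hxM (hMcl p hp _ (by simpa using h.skew))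
      refine ⟨?_, ?_⟩
      · rintro p (hp | hp) q hq
        · exact .inl (hMcl p hp q hq)
        · exact .inr (Relation.ReflTransGen.trans hp hq)
      · rintro p (hp | hp) (hp' | hp')
        · exact hMco p hp hp'
        · exact hMx p hp hp'
        · exact hMx _ hp' (by simpa using hp)
        -- If `x` reaches both `p` and `compl p`, then skew symmetry gives a path from `p` to `compl
        -- x`, so `x` reaches its complement.
        · refine hx (Relation.ReflTransGen.trans hp ?_)
          have := Reach.skew hp'
          rwa [compl_compl] at this
    exact hM.le_of_ge hmem Set.subset_union_left (.inr .refl)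
  have htot : ∀ x, compl x ∉ M → x ∈ M := by
    intro x hx
    by_contra hx'
    by_cases h₁ : Reach F x (compl x)
    · by_cases h₂ : Reach F (compl x) x
      · exact hF x ⟨h₁, h₂⟩
      · exact hx (hext (compl x) (by simpa using h₂) (by simpa using hx'))
    · exact hx' (hext x h₁ hx)
  have hv : ∀ x, LitTrue (fun n => decide ((n, true) ∈ M)) x ↔ x ∈ M := by
    rintro ⟨n, _ | _⟩
    · simp only [LitTrue, decide_eq_false_iff_not]
      exact ⟨fun h => htot _ h, fun h => hMco _ h⟩
    · simp [LitTrue]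
  exact ⟨_, fun x hx => (hv x).2 (hTM hx), fun p q h hp => (hv q).2 (hMcl p ((hv p).1 hp) q h)⟩

theorem exists_eq_pair {C : Finset Literal} (h0 : C ≠ ∅) (h2 : C.card ≤ 2) :
    ∃ p q, C = {compl p, q} := by
  have h1 : 1 ≤ C.card := Finset.card_pos.2 (Finset.nonempty_iff_ne_empty.2 h0)
  rcases (by omega : C.card = 1 ∨ C.card = 2) with h | h
  · obtain ⟨a, rfl⟩ := Finset.card_eq_one.1 h
    -- A unit clause `{a}` is the arc from `compl a` to `a`.
    exact ⟨compl a, a, by simp⟩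
  · obtain ⟨a, b, _, rfl⟩ := Finset.card_eq_two.1 h
    exact ⟨compl a, b, by simp⟩

theorem satCNF_of_respects {F : ClauseSet} (hF : IsTwoCNF F) (h0 : ∅ ∉ F) {v : ℕ → Bool}
    (h : ∀ p q, Arc F p q → LitTrue v p → LitTrue v q) : SatCNF v F := by
  intro C hC
  obtain ⟨p, q, rfl⟩ := exists_eq_pair (fun e => h0 (e ▸ hC)) (hF.2 C hC)
  by_cases hp : LitTrue v p
  · exact ⟨q, by simp, h p q hC hp⟩
  · exact ⟨compl p, by simp, litTrue_compl.2 hp⟩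

theorem satisfiable_iff {F : ClauseSet} (hF : IsTwoCNF F) :
    Satisfiable F ↔ ∅ ∉ F ∧ NoClash F := by
  constructor
  · rintro ⟨v, hv⟩
    refine ⟨fun h => not_satCNF_of_empty_mem h hv, fun x h => ?_⟩
    by_cases hx : LitTrue v x
    · exact litTrue_compl.1 (h.1.sound hv hx) hx
    · exact hx (h.2.sound hv (litTrue_compl.2 hx))
  · rintro ⟨h0, h⟩
    obtain ⟨v, -, hv⟩ := exists_respecting h ∅ (by simp) (by simp)
    exact ⟨v, satCNF_of_respects hF h0 fun p q hpq => hv p q (.single hpq)⟩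

/-- Otherwise the literals reachable from the complements of the literals of `C` form a closed set
without clashes. It extends to a model of `F`, and this model falsifies `C`. -/
theorem exists_reach_of_implies {F : ClauseSet} (hF : IsTwoCNF F) (hs : Satisfiable F)
    {C : Finset Literal} (h : Implies F C) : ∃ a ∈ C, ∃ b ∈ C, Reach F (compl a) b := by
  obtain ⟨h0, hcl⟩ := (satisfiable_iff hF).1 hs
  by_contra hcon
  obtain ⟨v, hvT, hv⟩ := exists_respecting hcl {y | ∃ a ∈ C, Reach F (compl a) y}
    (fun p ⟨a, ha, hp⟩ q hq => ⟨a, ha, Relation.ReflTransGen.trans hp hq⟩)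
    (fun p ⟨a, ha, hp⟩ ⟨b, hb, hp'⟩ =>
      hcon ⟨a, ha, b, hb, Relation.ReflTransGen.trans hp hp'.skew'⟩)
  obtain ⟨x, hx, hvx⟩ := h v (satCNF_of_respects hF h0 fun p q hpq => hv p q (.single hpq))
  exact litTrue_compl.1 (hvT (compl x) ⟨x, hx, .refl⟩) hvx

theorem forced_iff_reach {F : ClauseSet} (hF : IsTwoCNF F) (hs : Satisfiable F) {x : Literal} :
    Forced F x ↔ Reach F (compl x) x := by
  constructor
  · intro h
    obtain ⟨a, ha, b, hb, h⟩ := exists_reach_of_implies hF hs h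
    rw [Finset.mem_singleton] at ha hb
    rwa [ha, hb] at h
  · intro h
    simpa [Forced] using h.implies

/-- If `p` is not false and `q` is not forced, then `F ⊨ p → q` is witnessed by a path. -/
theorem reach_of_implies_pair {F : ClauseSet} (hF : IsTwoCNF F) (hs : Satisfiable F)
    {p q : Literal} (h : Implies F {compl p, q}) (hp : ¬ Forced F (compl p)) (hq : ¬ Forced F q) :
    Reach F p q := by
  obtain ⟨a, ha, b, hb, hr⟩ := exists_reach_of_implies hF hs h
  rw [forced_iff_reach hF hs] at hp hq
  rw [Finset.mem_insert, Finset.mem_singleton] at ha hb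
  rcases ha with rfl | rfl <;> rcases hb with rfl | rfl
  · exact absurd hr hp
  · simpa using hr
  · exact hr.skew'
  · exact absurd hr hq

theorem IsPrimeImplicate.eq_empty_of_unsatisfiable {F : ClauseSet} (hs : ¬ Satisfiable F)
    {C : Finset Literal} (hC : IsPrimeImplicate F C) : C = ∅ := by
  by_contra hne
  exact hC.2.2 ∅ (Finset.empty_ssubset.2 (Finset.nonempty_iff_ne_empty.2 hne))
    fun v hv => absurd ⟨v, hv⟩ hs

theorem IsPrimeImplicate.eq_of_reach {F : ClauseSet} {C : Finset Literal}
    (hC : IsPrimeImplicate F C) {a b : Literal} (ha : a ∈ C) (hb : b ∈ C)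
    (h : Reach F (compl a) b) : C = {a, b} := by
  by_contra hne
  have hsub : {a, b} ⊆ C := by
    intro x hx
    rw [Finset.mem_insert, Finset.mem_singleton] at hx
    rcases hx with rfl | rfl <;> assumption
  refine hC.2.2 {a, b} (hsub.ssubset_of_ne (Ne.symm hne)) ?_
  simpa using h.implies

theorem IsPrimeImplicate.card_le_two {F : ClauseSet} (hF : IsTwoCNF F) {C : Finset Literal}
    (hC : IsPrimeImplicate F C) : C.card ≤ 2 := by
  by_cases hs : Satisfiable F
  · obtain ⟨a, ha, b, hb, h⟩ := exists_reach_of_implies hF hs hC.2.1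
    rw [hC.eq_of_reach ha hb h]
    exact Finset.card_le_two
  · simp [hC.eq_empty_of_unsatisfiable hs]

theorem IsPrimeImplicate.ne_empty {F : ClauseSet} (hs : Satisfiable F) {C : Finset Literal}
    (hC : IsPrimeImplicate F C) : C ≠ ∅ := by
  rintro rfl
  obtain ⟨v, hv⟩ := hs
  obtain ⟨x, hx, _⟩ := hC.2.1 v hv
  exact absurd hx (Finset.notMem_empty x)

/-- Unit propagation along the path: branching on the next vertex `r`, the branch with `r` false is
closed by the first arc, and the other branch continues with a shorter path. -/
theorem Reach.ref {F : ClauseSet} {p q : Literal} (h : Reach F p q) (hne : p ≠ q)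
    {B : Finset Literal} (hp : compl p ∈ B) (hq : q ∈ B) : Ref F 1 B := by
  induction h using Relation.ReflTransGen.head_induction_on generalizing B with
  | refl => exact absurd rfl hne
  | @head p r hpr _ ih =>
    by_cases e : r = q
    · subst e
      refine .base hpr fun x hx => ?_
      rw [Finset.mem_insert, Finset.mem_singleton] at hx
      rcases hx with rfl | rfl <;> assumption
    · refine .step r (.base hpr fun x hx => ?_)
        (ih e (Finset.mem_insert_self _ _) (Finset.mem_insert_of_mem hq))
      rw [Finset.mem_insert, Finset.mem_singleton] at hx
      rcases hx with rfl | rfl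
      · exact Finset.mem_insert_of_mem hp
      · exact Finset.mem_insert_self _ _

theorem IsEquivPrimeSubset.isTwoCNF {F G : ClauseSet} (hF : IsTwoCNF F)
    (hG : IsEquivPrimeSubset F G) : IsTwoCNF G :=
  ⟨fun C hC => (hG.1 C hC).1, fun C hC => (hG.1 C hC).card_le_two hF⟩

theorem IsEquivPrimeSubset.eq_of_unsatisfiable {F G : ClauseSet} (hG : IsEquivPrimeSubset F G)
    (hs : ¬ Satisfiable F) : G = {∅} := by
  refine Finset.eq_singleton_iff_nonempty_unique_mem.2
    ⟨Finset.nonempty_iff_ne_empty.2 ?_, fun C hC => (hG.1 C hC).eq_empty_of_unsatisfiable hs⟩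
  rintro rfl
  exact hs (hG.2.satisfiable ⟨fun _ => true, fun C hC => absurd hC (Finset.notMem_empty C)⟩)

/-- In the satisfiable case `G` is itself of length at most 2, so each of its implicates is
witnessed by a path in the digraph of `G`; `Reach.ref` applies. -/
theorem IsEquivPrimeSubset.hardness_le_one {F G : ClauseSet} (hF : IsTwoCNF F)
    (hG : IsEquivPrimeSubset F G) : hardness G ≤ 1 := by
  have h := hardness_le_iff (F := G) (k := 1)
  rw [Nat.cast_one] at h
  refine h.2 fun C hC hGC => ?_
  by_cases hs : Satisfiable F
  · obtain ⟨a, ha, b, hb, hr⟩ := exists_reach_of_implies (hG.isTwoCNF hF)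
      (hG.2.symm.satisfiable hs) hGC
    exact hr.ref (fun e => hC a ha (e ▸ hb)) (by simpa using ha) hb
  · rw [hG.eq_of_unsatisfiable hs]
    exact .base (Finset.mem_singleton_self _) (Finset.empty_subset _)

theorem IsEquivKBase.isKBase_one {F G : ClauseSet} (hF : IsTwoCNF F)
    (h : IsEquivKBase ⊤ F G) : IsKBase 1 G :=
  ⟨h.1.1, h.isEquivPrimeSubset.hardness_le_one hF, fun H hH =>
    .inl ((h.1.2.2 H hH).resolve_right not_top_lt)⟩

/-- Removing a clause contradicts minimality, and removing a literal contradicts primality. Hardness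
plays no role from level 1 on. -/
theorem IsSmallestPrimeSubset.isEquivKBase {F G : ClauseSet} (hF : IsTwoCNF F)
    (hG : IsSmallestPrimeSubset F G) {k : ℕ∞} (hk : 1 ≤ k) : IsEquivKBase k F G := by
  refine ⟨⟨fun C hC => (hG.1.1 C hC).1, (hG.1.hardness_le_one hF).trans hk, ?_⟩, hG.1.2⟩
  rintro H (⟨C, hC, rfl⟩ | ⟨C, hC, x, hx, rfl⟩)
  · refine .inl fun he => ?_
    have := hG.2 (G.erase C) ⟨fun D hD => hG.1.1 D (Finset.mem_of_mem_erase hD), he.trans hG.1.2⟩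
    exact absurd (Finset.card_erase_lt_of_mem hC) (not_lt.2 this)
  · exact .inl (not_equivalent_shorten hG.1.2 (hG.1.1 C hC) hx)

theorem IsEquivPrimeSubset.exists_smallest {F G : ClauseSet} (hG : IsEquivPrimeSubset F G) :
    ∃ S, IsSmallestPrimeSubset F S := by
  obtain ⟨S, hS, hmin⟩ := WellFounded.has_min (measure numClauses).wf
    {G | IsEquivPrimeSubset F G} ⟨G, hG⟩
  exact ⟨S, hS, fun H hH => not_lt.1 (hmin H hH)⟩

theorem isShortestKBase_iff_isSmallestPrimeSubset {F G : ClauseSet} (hF : IsTwoCNF F) {k : ℕ∞}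
    (hk : 1 ≤ k) : IsShortestKBase numClauses k F G ↔ IsSmallestPrimeSubset F G := by
  constructor
  · intro h
    refine ⟨h.1.isEquivPrimeSubset, fun H hH => ?_⟩
    obtain ⟨S, hS⟩ := hH.exists_smallest
    exact (h.2 S (hS.isEquivKBase hF hk)).trans (hS.2 H hH)
  · exact fun h => ⟨h.isEquivKBase hF hk, fun H hH => h.2 H hH.isEquivPrimeSubset⟩

theorem IsPrimeImplicate.forced_of_card_eq_one {F : ClauseSet} {C : Finset Literal}
    (hC : IsPrimeImplicate F C) (h : C.card = 1) : ∃ x, C = {x} ∧ Forced F x := by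
  obtain ⟨x, rfl⟩ := Finset.card_eq_one.1 h
  exact ⟨x, rfl, hC.2.1⟩

theorem IsEquivPrimeSubset.filter_card_one_subset {F G H : ClauseSet} (hs : Satisfiable F)
    (hG : IsEquivPrimeSubset F G) (hH : IsEquivPrimeSubset F H) :
    G.filter (fun C => C.card = 1) ⊆ H.filter (fun C => C.card = 1) := by
  intro C hC
  obtain ⟨hC, h1⟩ := Finset.mem_filter.1 hC
  obtain ⟨x, rfl, hx⟩ := (hG.1 C hC).forced_of_card_eq_one h1
  exact Finset.mem_filter.2 ⟨hH.unit_mem_of_forced hs hx, h1⟩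

/-- Clauses have length 1 or 2, and the set of unit clauses is the same for all equivalent sets of
prime implicates. The two measures are thus related by one fixed affine function. -/
theorem IsEquivPrimeSubset.numLitOcc_add {F G : ClauseSet} (hF : IsTwoCNF F) (hs : Satisfiable F)
    (hG : IsEquivPrimeSubset F G) :
    numLitOcc G + (G.filter fun C => C.card = 1).card = 2 * numClauses G := by
  rw [numLitOcc, Finset.card_filter, ← Finset.sum_add_distrib, numClauses, mul_comm,
    ← smul_eq_mul, ← Finset.sum_const]
  refine Finset.sum_congr rfl fun C hC => ?_
  have h2 := (hG.1 C hC).card_le_two hF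
  have h1 := Finset.card_pos.2 (Finset.nonempty_iff_ne_empty.2 ((hG.1 C hC).ne_empty hs))
  split_ifs with h <;> omega

theorem isShortestKBase_numClauses_iff {F G : ClauseSet} (hF : IsTwoCNF F) {k : ℕ∞} :
    IsShortestKBase numClauses k F G ↔ IsShortestKBase numLitOcc k F G := by
  refine and_congr_right fun hG => forall₂_congr fun H hH => ?_
  by_cases hs : Satisfiable F
  · have h₁ := hG.isEquivPrimeSubset.numLitOcc_add hF hs
    have h₂ := hH.isEquivPrimeSubset.numLitOcc_add hF hs
    rw [(hG.isEquivPrimeSubset.filter_card_one_subset hs hH.isEquivPrimeSubset).antisymm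
      (hH.isEquivPrimeSubset.filter_card_one_subset hs hG.isEquivPrimeSubset)] at h₁
    omega
  · rw [hG.isEquivPrimeSubset.eq_of_unsatisfiable hs, hH.isEquivPrimeSubset.eq_of_unsatisfiable hs]
    simp

theorem card_eq_two_of_not_forced {F : ClauseSet} (hF : IsTwoCNF F) (hs : Satisfiable F)
    (h : ∀ x, ¬ Forced F x) :
    (∀ C ∈ F, C.card = 2) ∧ ∀ C, IsPrimeImplicate F C → C.card = 2 := by
  have key : ∀ C : Finset Literal, C.card ≤ 2 → Implies F C → C.card = 2 := by
    intro C h2 hC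
    by_contra hne
    have h1 : C.card ≤ 1 := by omega
    obtain ⟨v, hv⟩ := hs
    obtain ⟨x, hx, _⟩ := hC v hv
    refine h x (hC.mono fun y hy => ?_)
    exact Finset.mem_singleton.2 (Finset.card_le_one.1 h1 y hy x hx)
  exact ⟨fun C hC => key C (hF.2 C hC) (implies_of_mem hC),
    fun C hC => key C (hC.card_le_two hF) hC.2.1⟩

/-! ### A smallest equivalent set of prime implicates -/

theorem Reach.trans {F : ClauseSet} {p q r : Literal} (h : Reach F p q) (h' : Reach F q r) :
    Reach F p r := Relation.ReflTransGen.trans h h'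

/-- Neither `p` nor its complement is forced. -/
def Free (F : ClauseSet) (p : Literal) : Prop := ¬ Reach F p (compl p) ∧ ¬ Reach F (compl p) p

/-- `p` and `q` are in the same strong component. -/
def Sim (F : ClauseSet) (p q : Literal) : Prop := Reach F p q ∧ Reach F q p

/-- `p` has the least rank in its strong component. -/
def LeastIn (F : ClauseSet) (ρ : ℕ → ℕ) (p : Literal) : Prop := ∀ r, Sim F p r → ρ p.1 ≤ ρ r.1

/-- `p` has the greatest rank in its strong component. -/
def GreatestIn (F : ClauseSet) (ρ : ℕ → ℕ) (p : Literal) : Prop := ∀ r, Sim F p r → ρ r.1 ≤ ρ p.1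

/-- The least element of the strong component of `p` is a positive literal. -/
def PositiveIn (F : ClauseSet) (ρ : ℕ → ℕ) (p : Literal) : Prop :=
  ∃ r, Sim F p r ∧ LeastIn F ρ r ∧ r.2 = true

/-- `q` follows `p` in the cyclic order of the strong component of `p`. -/
def NextIn (F : ClauseSet) (ρ : ℕ → ℕ) (p q : Literal) : Prop :=
  (ρ p.1 < ρ q.1 ∧ ∀ r, Sim F p r → ¬ (ρ p.1 < ρ r.1 ∧ ρ r.1 < ρ q.1)) ∨
    (GreatestIn F ρ p ∧ LeastIn F ρ q)

/-- There is no strong component strictly between those of `p` and `q`. -/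
def Cover (F : ClauseSet) (p q : Literal) : Prop :=
  ∀ r, Reach F p r → Reach F r q → Reach F r p ∨ Reach F q r

/-- The implication from `p` to `q` is selected. -/
def Keep (F : ClauseSet) (ρ : ℕ → ℕ) (p q : Literal) : Prop :=
  Reach F p q ∧ (p = compl q ∨ Free F p ∧ Free F q ∧ p ≠ q ∧
    (Reach F q p ∧ PositiveIn F ρ p ∧ NextIn F ρ p q ∨
      ¬ Reach F q p ∧ Cover F p q ∧ LeastIn F ρ p ∧ LeastIn F ρ q))

/-- The rank distinguishes the variables of each strong component. -/
def RankInj (F : ClauseSet) (ρ : ℕ → ℕ) : Prop :=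
  ∀ p q, Sim F p q → ρ p.1 = ρ q.1 → p.1 = q.1

section

variable {F : ClauseSet} {ρ : ℕ → ℕ} {p q r : Literal}

theorem Sim.refl : Sim F p p := ⟨.refl, .refl⟩

theorem Sim.symm (h : Sim F p q) : Sim F q p := ⟨h.2, h.1⟩

theorem Sim.trans (h : Sim F p q) (h' : Sim F q r) : Sim F p r :=
  ⟨h.1.trans h'.1, h'.2.trans h.2⟩

theorem Sim.skew (h : Sim F p q) : Sim F (compl p) (compl q) := ⟨h.2.skew, h.1.skew⟩

theorem Free.skew (h : Free F p) : Free F (compl p) := by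
  simpa [Free] using h.symm

/-- A path from `r` to `compl r` extends, by skew symmetry, to one from `p` to `compl p`; dually for
`q`. -/
theorem Free.between (hp : Free F p) (hq : Free F q) (h₁ : Reach F p r) (h₂ : Reach F r q) :
    Free F r :=
  ⟨fun h => hp.1 (h₁.trans (h.trans h₁.skew)), fun h => hq.2 (h₂.skew.trans (h.trans h₂))⟩

theorem Sim.free (h : Sim F p q) (hp : Free F p) : Free F q := hp.between hp h.1 h.2

/-- The component of a free literal contains no complementary pair, so within it a literal is
determined by its variable. -/
theorem Sim.eq_of_rank (hρ : RankInj F ρ) (hp : Free F p) (h : Sim F p q)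
    (e : ρ p.1 = ρ q.1) : p = q := by
  rcases eq_or_eq_compl (hρ p q h e).symm with e | e
  · exact e.symm
  · exact absurd (e ▸ h.1) hp.1

theorem LeastIn.eq (hρ : RankInj F ρ) (hp : Free F p) (h : Sim F p q) (h₁ : LeastIn F ρ p)
    (h₂ : LeastIn F ρ q) : p = q :=
  h.eq_of_rank hρ hp (le_antisymm (h₁ q h) (h₂ p h.symm))

/-- Ranks ignore signs, so complementary components have complementary representatives. -/
theorem LeastIn.skew (h : LeastIn F ρ p) : LeastIn F ρ (compl p) := fun r hr =>
  h (compl r) (by simpa using hr.skew)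

theorem PositiveIn.of_sim (h : PositiveIn F ρ p) (hs : Sim F p q) : PositiveIn F ρ q :=
  let ⟨r, hr, h'⟩ := h
  ⟨r, hs.symm.trans hr, h'⟩

theorem exists_leastIn (F : ClauseSet) (ρ : ℕ → ℕ) (p : Literal) :
    ∃ l, Sim F p l ∧ LeastIn F ρ l := by
  obtain ⟨l, hl, hmin⟩ := WellFounded.has_min (measure fun l : Literal => ρ l.1).wf
    {l | Sim F p l} ⟨p, Sim.refl⟩
  exact ⟨l, hl, fun r hr => not_lt.1 (hmin r (hl.trans hr))⟩

/-- Together with `PositiveIn.not_compl` this singles out exactly one component of each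
complementary pair of free components. -/
theorem positiveIn_or (F : ClauseSet) (ρ : ℕ → ℕ) (p : Literal) :
    PositiveIn F ρ p ∨ PositiveIn F ρ (compl p) := by
  obtain ⟨l, hl, hmin⟩ := exists_leastIn F ρ p
  cases h : l.2
  · exact .inr ⟨compl l, hl.skew, hmin.skew, by simp [compl, h]⟩
  · exact .inl ⟨l, hl, hmin, h⟩

theorem PositiveIn.not_compl (hρ : RankInj F ρ) (hp : Free F p) (h : PositiveIn F ρ p) :
    ¬ PositiveIn F ρ (compl p) := by
  rintro ⟨s, hs, hsl, hs2⟩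
  obtain ⟨r, hr, hrl, hr2⟩ := h
  have hsim : Sim F r (compl s) := hr.symm.trans (by simpa using hs.skew)
  have e := hrl.eq hρ (hr.free hp) hsim hsl.skew
  rw [e] at hr2
  simp [compl, hs2] at hr2

theorem NextIn.unique (hρ : RankInj F ρ) (hp : Free F p) (hq : Sim F p q) (hr : Sim F p r)
    (h₁ : NextIn F ρ p q) (h₂ : NextIn F ρ p r) : q = r := by
  have hqr := hq.symm.trans hr
  rcases h₁ with ⟨h₁, h₁'⟩ | ⟨h₁, h₁'⟩ <;> rcases h₂ with ⟨h₂, h₂'⟩ | ⟨h₂, h₂'⟩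
  · refine hqr.eq_of_rank hρ (hq.free hp) (le_antisymm ?_ ?_)
    · exact not_lt.1 fun h => h₁' r hr ⟨h₂, h⟩
    · exact not_lt.1 fun h => h₂' q hq ⟨h₁, h⟩
  · exact absurd (h₂ q hq) (not_le.2 h₁)
  · exact absurd (h₁ r hr) (not_le.2 h₂)
  · exact h₁'.eq hρ (hq.free hp) hqr h₂'

theorem Arc.mem_lits (h : Arc F p q) : p ∈ lits F ∧ q ∈ lits F :=
  ⟨KBase.mem_lits.2 ⟨_, h, .inr (by simp)⟩, KBase.mem_lits.2 ⟨_, h, .inl (by simp)⟩⟩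

theorem Reach.eq_or_mem_lits (h : Reach F p q) : p = q ∨ p ∈ lits F ∧ q ∈ lits F := by
  rcases Relation.ReflTransGen.cases_head h with e | ⟨r, hr, _⟩
  · exact .inl e
  · rcases Relation.ReflTransGen.cases_tail h with e | ⟨s, _, hs⟩
    · exact .inl e.symm
    · exact .inr ⟨hr.mem_lits.1, hs.mem_lits.2⟩

/-- There are infinitely many literals, but a component lies within the finitely many occurring
ones, or consists of `p` alone. -/
theorem exists_greatest (F : ClauseSet) (ρ : ℕ → ℕ) (p : Literal) (P : Literal → Prop)
    (hp : P p) : ∃ m, Sim F p m ∧ P m ∧ ∀ r, Sim F p r → P r → ρ r.1 ≤ ρ m.1 := by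
  classical
  obtain ⟨m, hm, hmax⟩ := Finset.exists_max_image
    ((insert p (lits F)).filter fun r => Sim F p r ∧ P r) (fun r => ρ r.1)
    ⟨p, Finset.mem_filter.2 ⟨Finset.mem_insert_self _ _, Sim.refl, hp⟩⟩
  obtain ⟨-, hm, hPm⟩ := Finset.mem_filter.1 hm
  refine ⟨m, hm, hPm, fun r hr hPr => hmax r (Finset.mem_filter.2 ⟨?_, hr, hPr⟩)⟩
  rcases hr.1.eq_or_mem_lits with e | h
  · exact e ▸ Finset.mem_insert_self _ _
  · exact Finset.mem_insert_of_mem h.2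

end

/-! ### The selected implications generate all implications -/

section respects

variable {F : ClauseSet} {ρ : ℕ → ℕ} {v : ℕ → Bool}

theorem litTrue_of_forcing (hv : ∀ p q, Keep F ρ p q → LitTrue v p → LitTrue v q) {q : Literal}
    (h : Reach F (compl q) q) : LitTrue v q := by
  by_contra hq
  exact hq (hv _ _ ⟨h, .inl rfl⟩ (litTrue_compl.2 hq))

/-- Truth moves upwards along the cycle: the predecessor of `r` is the literal of the component with
the greatest rank below that of `r`. -/
theorem litTrue_of_rank_le (hρ : RankInj F ρ)
    (hv : ∀ p q, Keep F ρ p q → LitTrue v p → LitTrue v q) {p : Literal} (hp : Free F p)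
    (hpos : PositiveIn F ρ p) (hvp : LitTrue v p) {r : Literal} (hr : Sim F p r)
    (hle : ρ p.1 ≤ ρ r.1) : LitTrue v r := by
  generalize hn : ρ r.1 = n
  induction n using Nat.strong_induction_on generalizing r with
  | _ n ih =>
  rcases hle.eq_or_lt with e | hlt
  · rwa [← hr.eq_of_rank hρ hp e]
  · obtain ⟨s, hs, hsr, hmax⟩ := exists_greatest F ρ p (fun s => ρ s.1 < ρ r.1) hlt
    have hvs := ih _ (hn ▸ hsr) hs (hmax p Sim.refl hlt) rfl
    have hsim := hs.symm.trans hr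
    refine hv s r ⟨hsim.1, .inr ⟨hs.free hp, hr.free hp, ?_, .inl ⟨hsim.2, hpos.of_sim hs,
      .inl ⟨hsr, fun t ht h => ?_⟩⟩⟩⟩ hvs
    · rintro rfl
      exact lt_irrefl _ hsr
    · exact absurd h.1 (not_lt.2 (hmax t (hs.trans ht) h.2))

/-- Once around the cycle: from `p` up to the greatest element, over the closing arc to the least
one, and up again to `q`. -/
theorem litTrue_of_sim_positive (hρ : RankInj F ρ)
    (hv : ∀ p q, Keep F ρ p q → LitTrue v p → LitTrue v q) {p q : Literal} (hp : Free F p)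
    (hpos : PositiveIn F ρ p) (h : Sim F p q) (hvp : LitTrue v p) : LitTrue v q := by
  obtain ⟨m, hm, -, hmax⟩ := exists_greatest F ρ p (fun _ => True) trivial
  obtain ⟨l, hl, hmin⟩ := exists_leastIn F ρ p
  have hvm := litTrue_of_rank_le hρ hv hp hpos hvp hm (hmax p Sim.refl trivial)
  have hml := hm.symm.trans hl
  have hvl : LitTrue v l := by
    by_cases e : m = l
    · exact e ▸ hvm
    · exact hv m l ⟨hml.1, .inr ⟨hm.free hp, hl.free hp, e, .inl ⟨hml.2, hpos.of_sim hm,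
        .inr ⟨fun r hr => hmax r (hm.trans hr) trivial, hmin⟩⟩⟩⟩ hvm
  have hlq := hl.symm.trans h
  exact litTrue_of_rank_le hρ hv (hl.free hp) (hpos.of_sim hl) hvl hlq (hmin q hlq)

/-- No cycle is selected in a component that is not positive; there the contrapositive is followed
in the complementary component. -/
theorem litTrue_of_sim (hρ : RankInj F ρ)
    (hv : ∀ p q, Keep F ρ p q → LitTrue v p → LitTrue v q) {p q : Literal} (hp : Free F p)
    (h : Sim F p q) (hvp : LitTrue v p) : LitTrue v q := by
  rcases positiveIn_or F ρ p with hpos | hpos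
  · exact litTrue_of_sim_positive hρ hv hp hpos h hvp
  · by_contra hq
    exact litTrue_compl.1 (litTrue_of_sim_positive hρ hv (h.free hp).skew
      (hpos.of_sim h.skew) h.symm.skew (litTrue_compl.2 hq)) hvp

theorem Cover.of_sim {p q p' q' : Literal} (h : Cover F p q) (hp : Sim F p p') (hq : Sim F q q') :
    Cover F p' q' := fun r h₁ h₂ =>
  (h r (hp.1.trans h₁) (h₂.trans hq.2)).imp (fun h => h.trans hp.1) fun h => hq.2.trans h

/-- Induction on the number of literals between `p` and `q`. A covering pair is handled by the arc
between the representatives; otherwise an intermediate component splits the interval into two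
smaller ones. -/
theorem litTrue_of_not_reach (hρ : RankInj F ρ)
    (hv : ∀ p q, Keep F ρ p q → LitTrue v p → LitTrue v q) {p q : Literal} (hp : Free F p)
    (hq : Free F q) (h : Reach F p q) (hn : ¬ Reach F q p) (hvp : LitTrue v p) :
    LitTrue v q := by
  classical
  generalize hc : ((lits F).filter fun r => Reach F p r ∧ Reach F r q).card = n
  induction n using Nat.strong_induction_on generalizing p q with
  | _ n ih =>
  have hmem : p ∈ lits F ∧ q ∈ lits F := h.eq_or_mem_lits.resolve_left fun e => hn (e ▸ h)
  by_cases hcov : Cover F p q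
  · obtain ⟨a, ha, hamin⟩ := exists_leastIn F ρ p
    obtain ⟨b, hb, hbmin⟩ := exists_leastIn F ρ q
    have hva := litTrue_of_sim hρ hv hp ha hvp
    have hba : ¬ Reach F b a := fun h' => hn (hb.1.trans (h'.trans ha.2))
    have hab : Reach F a b := ha.2.trans (h.trans hb.1)
    have hvb := hv a b ⟨hab, .inr ⟨ha.free hp, hb.free hq, fun e => hba (e ▸ hab),
      .inr ⟨hba, hcov.of_sim ha hb, hamin, hbmin⟩⟩⟩ hva
    exact litTrue_of_sim hρ hv (hb.free hq) hb.symm hvb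
  · simp only [Cover] at hcov
    push Not at hcov
    obtain ⟨r, hpr, hrq, hrp, hqr⟩ := hcov
    have hr := hp.between hq hpr hrq
    have hvr : LitTrue v r := by
      refine ih _ ?_ hp hr hpr hrp hvp rfl
      rw [← hc]
      refine Finset.card_lt_card (Finset.ssubset_iff_of_subset ?_ |>.2 ⟨q, ?_, ?_⟩)
      · intro s hs
        obtain ⟨hs, h₁, h₂⟩ := Finset.mem_filter.1 hs
        exact Finset.mem_filter.2 ⟨hs, h₁, h₂.trans hrq⟩
      · exact Finset.mem_filter.2 ⟨hmem.2, h, .refl⟩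
      · exact fun hs => hqr (Finset.mem_filter.1 hs).2.2
    refine ih _ ?_ hr hq hrq hqr hvr rfl
    rw [← hc]
    refine Finset.card_lt_card (Finset.ssubset_iff_of_subset ?_ |>.2 ⟨p, ?_, ?_⟩)
    · intro s hs
      obtain ⟨hs, h₁, h₂⟩ := Finset.mem_filter.1 hs
      exact Finset.mem_filter.2 ⟨hs, hpr.trans h₁, h₂⟩
    · exact Finset.mem_filter.2 ⟨hmem.1, .refl, h⟩
    · exact fun hs => hrp (Finset.mem_filter.1 hs).2.1

/-- The selected units make forced literals true. When neither `compl p` nor `q` is forced, the path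
makes both `p` and `q` free. -/
theorem litTrue_of_reach (hρ : RankInj F ρ)
    (hv : ∀ p q, Keep F ρ p q → LitTrue v p → LitTrue v q) {p q : Literal} (h : Reach F p q)
    (hvp : LitTrue v p) : LitTrue v q := by
  have h₁ : ¬ Reach F p (compl p) := fun h' =>
    litTrue_compl.1 (litTrue_of_forcing hv (q := compl p) (by simpa using h')) hvp
  by_cases h₂ : Reach F (compl q) q
  · exact litTrue_of_forcing hv h₂
  have hp : Free F p := ⟨h₁, fun h' => h₂ (h.skew.trans (h'.trans h))⟩
  have hq : Free F q := ⟨fun h' => h₁ (h.trans (h'.trans h.skew)), h₂⟩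
  by_cases h' : Reach F q p
  · exact litTrue_of_sim hρ hv hp ⟨h, h'⟩ hvp
  · exact litTrue_of_not_reach hρ hv hp hq h h' hvp

end respects

/-! ### Minimality of the selection -/

section optimal

variable {F G H : ClauseSet} {ρ : ℕ → ℕ}

theorem Free.not_forced (hF : IsTwoCNF F) (hs : Satisfiable F) {p : Literal} (h : Free F p) :
    ¬ Forced F p ∧ ¬ Forced F (compl p) := by
  rw [forced_iff_reach hF hs, forced_iff_reach hF hs, compl_compl]
  exact ⟨h.2, h.1⟩

theorem isPrimeImplicate_pair (hF : IsTwoCNF F) (hs : Satisfiable F) {p q : Literal}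
    (h : Reach F p q) (hpq : p = compl q ∨ Free F p ∧ Free F q ∧ p ≠ q) :
    IsPrimeImplicate F {compl p, q} := by
  rcases hpq with rfl | ⟨hp, hq, hne⟩
  · rw [compl_compl, Finset.pair_eq_singleton]
    exact isPrimeImplicate_of_forced hs ((forced_iff_reach hF hs).2 h)
  · refine ⟨isClause_insert (isClause_singleton q) (by simpa using hne), h.implies,
      fun D hD hFD => ?_⟩
    obtain ⟨E, hED, hE⟩ := exists_primeImplicate_subset
      ((isClause_insert (isClause_singleton q) (by simpa using hne)).subset hD.subset) hFD
    have hcard : E.card ≤ 1 := by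
      have := Finset.card_lt_card (hED.trans_ssubset hD)
      have := Finset.card_le_two (a := compl p) (b := q)
      omega
    have hpos := Finset.card_pos.2 (Finset.nonempty_iff_ne_empty.2 (hE.ne_empty hs))
    obtain ⟨x, rfl, hx⟩ := hE.forced_of_card_eq_one (by omega)
    have hxm := hD.subset (hED (Finset.mem_singleton_self x))
    rw [Finset.mem_insert, Finset.mem_singleton] at hxm
    rcases hxm with rfl | rfl
    · exact (hp.not_forced hF hs).2 hx
    · exact (hq.not_forced hF hs).1 hx

theorem Keep.isPrimeImplicate (hF : IsTwoCNF F) (hs : Satisfiable F) {p q : Literal}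
    (h : Keep F ρ p q) : IsPrimeImplicate F {compl p, q} :=
  isPrimeImplicate_pair hF hs h.1 (h.2.imp_right fun h => ⟨h.1, h.2.1, h.2.2.1⟩)

theorem isEquivPrimeSubset_of_keep (hF : IsTwoCNF F) (hs : Satisfiable F) (hρ : RankInj F ρ)
    (hG : ∀ C, C ∈ G ↔ ∃ p q, Keep F ρ p q ∧ C = {compl p, q}) : IsEquivPrimeSubset F G := by
  have hp : ∀ C ∈ G, IsPrimeImplicate F C := fun C hC => by
    obtain ⟨p, q, h, rfl⟩ := (hG C).1 hC
    exact h.isPrimeImplicate hF hs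
  refine ⟨hp, fun v => ⟨fun hv => ?_, fun hv C hC => (hp C hC).2.1 v hv⟩⟩
  have hk : ∀ p q, Keep F ρ p q → LitTrue v p → LitTrue v q := fun p q h hvp =>
    (show Reach G p q from .single ((hG _).2 ⟨p, q, h, rfl⟩)).sound hv hvp
  exact satCNF_of_respects hF ((satisfiable_iff hF).1 hs).1 fun p q hpq =>
    litTrue_of_reach hρ hk (.single hpq)

/-- An arc of `H` is only an implication of `F`, witnessed by a path when its ends are not forced
either way. Between free literals this is guaranteed, since otherwise `q` or `compl p` would be
forced. -/
theorem reach_of_between (hF : IsTwoCNF F) (hs : Satisfiable F) (he : Equivalent H F)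
    {p q r : Literal} (hp : Free F p) (hq : Free F q) (h₁ : Reach H p r) (h₂ : Reach H r q) :
    Reach F p r ∧ Reach F r q := by
  have hpf := (hp.not_forced hF hs).2
  have hqf := (hq.not_forced hF hs).1
  have hrf : ¬ Forced F r := fun h => hqf fun v hv =>
    ⟨q, by simp, h₂.sound ((he v).2 hv) (litTrue_of_forced h hv)⟩
  have hrf' : ¬ Forced F (compl r) := fun h => hpf fun v hv =>
    ⟨compl p, by simp, litTrue_compl.2 fun hvp =>
      litTrue_compl.1 (litTrue_of_forced h hv) (h₁.sound ((he v).2 hv) hvp)⟩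
  exact ⟨reach_of_implies_pair hF hs (he.implies_iff.1 h₁.implies) hpf hrf,
    reach_of_implies_pair hF hs (he.implies_iff.1 h₂.implies) hrf' hqf⟩

theorem reach_of_equivalent (hF : IsTwoCNF F) (hs : Satisfiable F) (hH : IsEquivPrimeSubset F H)
    {p q : Literal} (hp : Free F p) (hq : Free F q) (h : Reach F p q) : Reach H p q := by
  refine reach_of_implies_pair (hH.isTwoCNF hF) (hH.2.symm.satisfiable hs)
    (hH.2.implies_iff.2 h.implies) ?_ ?_
  · exact fun h => (hp.not_forced hF hs).2 (hH.2.implies_iff.1 h)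
  · exact fun h => (hq.not_forced hF hs).1 (hH.2.implies_iff.1 h)

theorem exists_crossing {α : Type*} {r : α → α → Prop} {a b : α}
    (h : Relation.ReflTransGen r a b) {P : α → Prop} (ha : P a) (hb : ¬ P b) :
    ∃ c d, Relation.ReflTransGen r a c ∧ r c d ∧ Relation.ReflTransGen r d b ∧ P c ∧ ¬ P d := by
  induction h using Relation.ReflTransGen.head_induction_on with
  | refl => exact absurd ha hb
  | @head a c hac hcb ih =>
    by_cases hc : P c
    · obtain ⟨c', d, h₁, h₂⟩ := ih hc
      exact ⟨c', d, .head hac h₁, h₂⟩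
    · exact ⟨a, c, .refl, hac, hcb, ha, hc⟩

/-- The clause `D` does the work of the selected clause `C`. -/
def Matches (F : ClauseSet) (ρ : ℕ → ℕ) (C D : Finset Literal) : Prop :=
  ∃ p q, Keep F ρ p q ∧ C = {compl p, q} ∧ (p = compl q ∧ D = C ∨
    p ≠ compl q ∧ ∃ p' q', D = {compl p', q'} ∧ Sim F p p' ∧ Sim F q q' ∧ (Reach F q p → p' = p))

/-- A cycle arc from `p` is matched with the first arc of a path from `p` to `q` in `H`, which stays
in the component. For an arc between components, such a path contains an arc leaving the component
of `p`; by the covering property it ends in that of `q`. -/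
theorem Keep.exists_matches (hF : IsTwoCNF F) (hs : Satisfiable F) (hH : IsEquivPrimeSubset F H)
    {p q : Literal} (h : Keep F ρ p q) : ∃ D ∈ H, Matches F ρ {compl p, q} D := by
  by_cases hpq : p = compl q
  · refine ⟨_, ?_, p, q, h, rfl, .inl ⟨hpq, rfl⟩⟩
    have h1 := h.1
    rw [hpq, compl_compl, Finset.pair_eq_singleton]
    exact hH.unit_mem_of_forced hs ((forced_iff_reach hF hs).2 (hpq ▸ h1))
  obtain ⟨hp, hq, hne, hcase⟩ := h.2.resolve_left hpq
  have hr := reach_of_equivalent hF hs hH hp hq h.1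
  rcases hcase with ⟨hqp, -, -⟩ | ⟨hqp, hcov, -, -⟩
  · rcases Relation.ReflTransGen.cases_head hr with e | ⟨s, hps, hsq⟩
    · exact absurd e hne
    · obtain ⟨h₁, h₂⟩ := reach_of_between hF hs hH.2 hp hq (.single hps) hsq
      exact ⟨_, hps, p, q, h, rfl, .inr ⟨hpq, p, s, rfl, Sim.refl, ⟨hqp.trans h₁, h₂⟩,
        fun _ => rfl⟩⟩
  · obtain ⟨c, d, hpc, hcd, hdq, hc, hd⟩ := exists_crossing hr (P := fun r => Reach F r p) .refl hqp
    obtain ⟨h₁, -⟩ := reach_of_between hF hs hH.2 hp hq hpc (.head hcd hdq)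
    obtain ⟨h₃, h₄⟩ := reach_of_between hF hs hH.2 hp hq (.tail hpc hcd) hdq
    exact ⟨_, hcd, p, q, h, rfl, .inr ⟨hpq, c, d, rfl, ⟨h₁, hc⟩,
      ⟨(hcov d h₃ h₄).resolve_left hd, h₄⟩, fun h' => absurd h' hqp⟩⟩

theorem pair_eq_pair_iff {a b c d : Literal} :
    ({a, b} : Finset Literal) = {c, d} ↔ a = c ∧ b = d ∨ a = d ∧ b = c := by
  rw [← Finset.coe_inj]
  simp only [Finset.coe_insert, Finset.coe_singleton]
  exact Set.pair_eq_pair_iff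

/-- The clause `D` can be read as an arc in two skew ways. If both matches use the same reading, the
components agree; a cycle arc is fixed by its tail and an arc between components by the
representatives. Opposite readings exchange components with their complements: for cycles only one
of these is positive, and for arcs between components the result is the same clause. -/
theorem Matches.unique (hρ : RankInj F ρ) {C₁ C₂ D : Finset Literal} (h₁ : Matches F ρ C₁ D)
    (h₂ : Matches F ρ C₂ D) : C₁ = C₂ := by
  -- A unit clause cannot match a pair of free literals: its arc leads from `p'` to `compl p'`.
  have mixed : ∀ {p q p' q' a : Literal}, Keep F ρ p q → p ≠ compl q → Sim F p p' → Sim F q q' →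
      ({compl p', q'} : Finset Literal) ≠ {a} := by
    intro p q p' q' a hk hne hp hq e
    have e₁ : compl p' = a := by
      have : compl p' ∈ ({a} : Finset Literal) := e ▸ (by simp)
      simpa using this
    have e₂ : q' = a := by
      have : q' ∈ ({a} : Finset Literal) := e ▸ (by simp)
      simpa using this
    have hfree := (hk.2.resolve_left hne).1
    refine (hp.free hfree).1 ?_
    rw [e₁, ← e₂]
    exact hp.2.trans (hk.1.trans hq.1)
  obtain ⟨p₁, q₁, hk₁, rfl, h₁⟩ := h₁
  obtain ⟨p₂, q₂, hk₂, rfl, h₂⟩ := h₂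
  rcases h₁ with ⟨e₁, rfl⟩ | ⟨e₁, p₁', q₁', rfl, hp₁, hq₁, hs₁⟩
  · rcases h₂ with ⟨e₂, e⟩ | ⟨e₂, p₂', q₂', e, hp₂, hq₂, hs₂⟩
    · exact e
    · rw [e₁, compl_compl, Finset.pair_eq_singleton] at e
      exact absurd e.symm (mixed hk₂ e₂ hp₂ hq₂)
  · rcases h₂ with ⟨e₂, e⟩ | ⟨e₂, p₂', q₂', e, hp₂, hq₂, hs₂⟩
    · rw [e₂, compl_compl, Finset.pair_eq_singleton] at e
      exact absurd e (mixed hk₁ e₁ hp₁ hq₁)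
    · obtain ⟨f₁, g₁, n₁, c₁⟩ := hk₁.2.resolve_left e₁
      obtain ⟨f₂, g₂, n₂, c₂⟩ := hk₂.2.resolve_left e₂
      rcases pair_eq_pair_iff.1 e with ⟨e₃, rfl⟩ | ⟨e₃, e₄⟩
      · obtain rfl := compl_inj.1 e₃
        have hp : Sim F p₁ p₂ := hp₁.trans hp₂.symm
        have hq : Sim F q₁ q₂ := hq₁.trans hq₂.symm
        rcases c₁ with ⟨r₁, -, x₁⟩ | ⟨r₁, -, l₁, m₁⟩
        · have r₂ : Reach F q₂ p₂ := hq.2.trans (r₁.trans hp.1)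
          obtain rfl : p₁ = p₂ := (hs₁ r₁).symm.trans (hs₂ r₂)
          rcases c₂ with ⟨-, -, x₂⟩ | ⟨r₂', -⟩
          · rw [x₁.unique hρ f₁ ⟨hk₁.1, r₁⟩ ⟨hk₂.1, r₂⟩ x₂]
          · exact absurd r₂ r₂'
        · rcases c₂ with ⟨r₂, -, -⟩ | ⟨-, -, l₂, m₂⟩
          · exact absurd (hq.1.trans (r₂.trans hp.2)) r₁
          · rw [l₁.eq hρ f₁ hp l₂, m₁.eq hρ g₁ hq m₂]
      · have hp : Sim F p₁ (compl q₂) := by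
          have := hp₁.trans (q := p₁') (r := compl q₂) ?_
          · exact this
          · rw [← compl_eq_comm.1 e₃]
            exact hq₂.symm.skew
        have hq : Sim F q₁ (compl p₂) := by
          rw [e₄] at hq₁
          exact hq₁.trans hp₂.symm.skew
        rcases c₁ with ⟨r₁, w₁, -⟩ | ⟨r₁, -, l₁, m₁⟩
        · have r₂ : Reach F q₂ p₂ := by
            have := hq.2.trans (r₁.trans hp.1)
            exact this.skew'
          rcases c₂ with ⟨-, w₂, -⟩ | ⟨r₂', -⟩
          -- The component of `p₁` is also that of `compl p₂`, so two complementary components would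
          -- both be positive.
          · refine absurd (w₁.of_sim (Sim.trans ⟨hk₁.1, r₁⟩ hq)) (w₂.not_compl hρ f₂)
          · exact absurd r₂ r₂'
        · rcases c₂ with ⟨r₂, -, -⟩ | ⟨-, -, l₂, m₂⟩
          · exact absurd (hq.1.trans (r₂.skew.trans hp.2)) r₁
          · rw [l₁.eq hρ f₁ hp m₂.skew, m₁.eq hρ g₁ hq l₂.skew, compl_compl, Finset.pair_comm]

theorem isSmallestPrimeSubset_of_keep (hF : IsTwoCNF F) (hs : Satisfiable F) (hρ : RankInj F ρ)
    (hG : ∀ C, C ∈ G ↔ ∃ p q, Keep F ρ p q ∧ C = {compl p, q}) : IsSmallestPrimeSubset F G := by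
  refine ⟨isEquivPrimeSubset_of_keep hF hs hρ hG, fun H hH => ?_⟩
  refine Finset.card_le_card_of_forall_subsingleton (Matches F ρ) (fun C hC => ?_) fun D _ => ?_
  · obtain ⟨p, q, hk, rfl⟩ := (hG C).1 hC
    exact hk.exists_matches hF hs hH
  · rintro C₁ ⟨-, h₁⟩ C₂ ⟨-, h₂⟩
    exact h₁.unique hρ h₂

theorem isPrimeImplicate_iff_reach (hF : IsTwoCNF F) (hs : Satisfiable F) {C : Finset Literal} :
    IsPrimeImplicate F C ↔ ∃ p q, (Reach F p q ∧ (p = compl q ∨ Free F p ∧ Free F q ∧ p ≠ q)) ∧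
      C = {compl p, q} := by
  constructor
  · intro h
    obtain ⟨a, ha, b, hb, hr⟩ := exists_reach_of_implies hF hs h.2.1
    have e := h.eq_of_reach ha hb hr
    refine ⟨compl a, b, ⟨hr, ?_⟩, by simpa using e⟩
    by_cases hab : a = b
    · exact .inl (by rw [hab])
    · have hnf : ∀ x ∈ C, ¬ Forced F x := fun x hx hf => by
        have := h.eq_of_forced hf hx
        rw [this, Finset.mem_singleton] at ha hb
        exact hab (ha.trans hb.symm)
      have hnf' : ∀ x ∈ C, ¬ Forced F (compl x) := fun x hx hf =>
        h.compl_notMem_of_forced hf (by simpa using hx)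
      have hfree : ∀ x ∈ C, Free F x := fun x hx => by
        have h₁ := hnf x hx
        have h₂ := hnf' x hx
        rw [forced_iff_reach hF hs] at h₁ h₂
        exact ⟨by simpa using h₂, h₁⟩
      exact .inr ⟨(hfree a ha).skew, hfree b hb, fun e => h.1 a ha (e ▸ hb)⟩
  · rintro ⟨p, q, ⟨h, hpq⟩, rfl⟩
    exact isPrimeImplicate_pair hF hs h hpq

end optimal

/-! ### The algorithm -/

/-- The variables of a formula. -/
def varList (L : Formula) : List ℕ := L.flatMap fun C => C.map fun x => x.1

/-- The literals whose variable occurs in a formula. -/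
def litList (L : Formula) : List Literal := (varList L).flatMap fun n => [(n, true), (n, false)]

/-- All pairs of elements of a list. -/
def pairs (V : List Literal) : List (Literal × Literal) := V.flatMap fun p => V.map fun q => (p, q)

/-- Membership in a relation given as a list of pairs. -/
def relMem (R : List (Literal × Literal)) (p q : Literal) : Bool :=
  R.any fun a => decide (a.1 = p) && decide (a.2 = q)

/-- `{¬p, q}` is a clause of the formula. -/
def arcTest (L : Formula) (p q : Literal) : Bool :=
  L.any fun C => (C.any fun c => decide (c = compl p)) && ((C.any fun c => decide (c = q)) &&
    C.all fun c => decide (c = compl p) || decide (c = q))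

/-- The pairs `(p, q)` which are equal or joined by an arc. -/
def arcList (L : Formula) : List (Literal × Literal) :=
  (pairs (litList L)).filter fun a => decide (a.1 = a.2) || arcTest L a.1 a.2

/-- One round of the transitive closure algorithm, with pivot `v`. -/
def pivotStep (V : List Literal) (R : List (Literal × Literal)) (v : Literal) :
    List (Literal × Literal) :=
  (pairs V).filter fun a => relMem R a.1 a.2 || (relMem R a.1 v && relMem R v a.2)

/-- The reachability relation of the implication digraph, by Warshall's algorithm. -/
def reachList (L : Formula) : List (Literal × Literal) :=
  (litList L).foldl (pivotStep (litList L)) (arcList L)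

/-- The data used for the selection of clauses: the variables, the literals, and the reachability
relation. -/
abbrev Env : Type := List ℕ × List Literal × List (Literal × Literal)

/-- The data of a formula. -/
def envOf (L : Formula) : Env := (varList L, litList L, reachList L)

namespace Env

/-- `p` reaches `q`. -/
def reach (e : Env) (p q : Literal) : Bool := relMem e.2.2 p q

/-- `p` and `q` reach each other. -/
def sim (e : Env) (p q : Literal) : Bool := e.reach p q && e.reach q p

/-- Neither `p` nor its complement is forced. -/
def free (e : Env) (p : Literal) : Bool := !e.reach p (compl p) && !e.reach (compl p) p

/-- The variable of `p` does not occur later than that of `q`. -/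
def rankLe (e : Env) (p q : Literal) : Bool :=
  decide ((e.1.filter fun n => decide (n = p.1) || decide (n = q.1)).headD p.1 = p.1)

/-- `p` has the least rank in its strong component. -/
def least (e : Env) (p : Literal) : Bool := e.2.1.all fun r => !e.sim p r || e.rankLe p r

/-- `p` has the greatest rank in its strong component. -/
def greatest (e : Env) (p : Literal) : Bool := e.2.1.all fun r => !e.sim p r || e.rankLe r p

/-- The least element of the strong component of `p` is a positive literal. -/
def positive (e : Env) (p : Literal) : Bool :=
  e.2.1.any fun r => e.sim p r && (e.least r && r.2)

/-- `q` follows `p` in the cyclic order of the strong component of `p`. -/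
def next (e : Env) (p q : Literal) : Bool :=
  (!e.rankLe q p && e.2.1.all fun r => !e.sim p r || (e.rankLe r p || e.rankLe q r)) ||
    (e.greatest p && e.least q)

/-- There is no strong component strictly between those of `p` and `q`. -/
def cover (e : Env) (p q : Literal) : Bool :=
  e.2.1.all fun r => !e.reach p r || (!e.reach r q || (e.reach r p || e.reach q r))

/-- The clause `{¬p, q}` is a prime implicate. -/
def prime (e : Env) (p q : Literal) : Bool :=
  e.reach p q && (decide (p = compl q) || (e.free p && (e.free q && !decide (p = q))))

/-- The clause `{¬p, q}` is selected. -/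
def keep (e : Env) (p q : Literal) : Bool :=
  e.reach p q && (decide (p = compl q) || (e.free p && (e.free q && (!decide (p = q) &&
    ((e.reach q p && (e.positive p && e.next p q)) ||
      (!e.reach q p && (e.cover p q && (e.least p && e.least q))))))))

/-- Some literal is equivalent to its complement. -/
def clash (e : Env) : Bool := e.2.1.any fun p => e.sim p (compl p)

/-- The clauses `{¬p, q}` for the pairs `(p, q)` satisfying a condition. -/
def select (c : Env → Literal → Literal → Bool) (e : Env) : Formula :=
  ((pairs e.2.1).filter fun a => c e a.1 a.2).map fun a => [compl a.1, a.2]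

end Env

/-- The algorithm for a selection criterion: the empty clause if the formula is unsatisfiable,
and the selected clauses otherwise. -/
def selectBase (c : Env → Literal → Literal → Bool) (L : Formula) : Formula :=
  bif (L.any fun C => C.isEmpty) || (envOf L).clash then [[]] else (envOf L).select c

/-! ### Running time -/

theorem sz_filter_le {α : Type} [Enc α] (l : List α) (p : α → Bool) : sz (l.filter p) ≤ sz l := by
  induction l with
  | nil => simp
  | cons a l ih =>
    rw [List.filter_cons]
    split_ifs <;> simp <;> omega

namespace PF

variable {α : Type} [Enc α]

theorem varList : PF varList := PF.id.flatMap (snd.map (fst.comp snd))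

theorem litList : PF litList :=
  varList.flatMap (f := fun y : Formula × ℕ => [(y.2, true), (y.2, false)])
    ((snd.pair (const true)).cons ((snd.pair (const false)).cons (const [])))

theorem pairs {V : α → List Literal} (hV : PF V) : PF (fun x => pairs (V x)) :=
  hV.flatMap (f := fun y : α × Literal => (V y.1).map fun q => (y.2, q))
    ((hV.comp fst).map (f := fun z : (α × Literal) × Literal => (z.1.2, z.2))
      ((snd.comp fst).pair snd))

theorem relMem {R : α → List (Literal × Literal)} {f g : α → Literal} (hR : PF R) (hf : PF f)
    (hg : PF g) : PF (fun x => relMem (R x) (f x) (g x)) :=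
  hR.any (f := fun y : α × Literal × Literal => decide (y.2.1 = f y.1) && decide (y.2.2 = g y.1))
    (((fst.comp snd).eqLit (hf.comp fst)).and ((snd.comp snd).eqLit (hg.comp fst)))

theorem arcTest {L : α → Formula} {f g : α → Literal} (hL : PF L) (hf : PF f) (hg : PF g) :
    PF (fun x => arcTest (L x) (f x) (g x)) := by
  have h₁ : PF fun z : (α × List Literal) × Literal => decide (z.2 = KBase.compl (f z.1.1)) :=
    snd.eqLit (hf.comp (fst.comp fst)).compl
  have h₂ : PF fun z : (α × List Literal) × Literal => decide (z.2 = g z.1.1) :=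
    snd.eqLit (hg.comp (fst.comp fst))
  exact hL.any (f := fun y : α × List Literal =>
    (y.2.any fun c => decide (c = KBase.compl (f y.1))) && ((y.2.any fun c => decide (c = g y.1)) &&
      y.2.all fun c => decide (c = KBase.compl (f y.1)) || decide (c = g y.1)))
    ((snd.any h₁).and ((snd.any h₂).and (snd.all (h₁.or h₂))))

theorem arcList : PF arcList :=
  (pairs litList).filter
    (f := fun y : Formula × Literal × Literal => decide (y.2.1 = y.2.2) ||
      KBase.arcTest y.1 y.2.1 y.2.2)
    (((fst.comp snd).eqLit (snd.comp snd)).or (arcTest fst (fst.comp snd) (snd.comp snd)))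

/-- Every round returns a sublist of the pairs of literals, so the accumulator is bounded
independently of the number of rounds. -/
theorem reachList : PF reachList := by
  have hs : PF fun y : Formula × List (Literal × Literal) × Literal =>
      pivotStep (KBase.litList y.1) y.2.1 y.2.2 := by
    have h₁ : PF fun z : (Formula × List (Literal × Literal) × Literal) × Literal × Literal =>
      z.1.2.1 := fst.comp (snd.comp fst)
    have h₂ : PF fun z : (Formula × List (Literal × Literal) × Literal) × Literal × Literal =>
      z.1.2.2 := snd.comp (snd.comp fst)
    exact (pairs (litList.comp fst)).filter
      (f := fun z : (Formula × List (Literal × Literal) × Literal) × Literal × Literal =>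
        KBase.relMem z.1.2.1 z.2.1 z.2.2 ||
          (KBase.relMem z.1.2.1 z.2.1 z.1.2.2 && KBase.relMem z.1.2.1 z.1.2.2 z.2.2))
      ((relMem h₁ (fst.comp snd) (snd.comp snd)).or
        ((relMem h₁ (fst.comp snd) h₂).and (relMem h₁ h₂ (snd.comp snd))))
  obtain ⟨q, hq⟩ := (pairs litList).size_le
  exact litList.foldl arcList hs q fun L R v _ =>
    (sz_filter_le _ _).trans ((hq L).trans (Nat.le_add_left _ _))

theorem envOf : PF envOf := varList.pair (litList.pair reachList)

variable {e : α → Env} {f g : α → Literal}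

theorem envReach (he : PF e) (hf : PF f) (hg : PF g) : PF (fun x => (e x).reach (f x) (g x)) :=
  relMem (snd.comp (snd.comp he)) hf hg

theorem envSim (he : PF e) (hf : PF f) (hg : PF g) : PF (fun x => (e x).sim (f x) (g x)) :=
  (envReach he hf hg).and (envReach he hg hf)

theorem envFree (he : PF e) (hf : PF f) : PF (fun x => (e x).free (f x)) :=
  (envReach he hf hf.compl).not.and (envReach he hf.compl hf).not

theorem envRankLe (he : PF e) (hf : PF f) (hg : PF g) : PF (fun x => (e x).rankLe (f x) (g x)) :=
  (((fst.comp he).filter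
    (f := fun y : α × ℕ => decide (y.2 = (f y.1).1) || decide (y.2 = (g y.1).1))
    ((snd.eqNat (fst.comp (hf.comp fst))).or (snd.eqNat (fst.comp (hg.comp fst))))).headD
      (fst.comp hf)).eqNat (fst.comp hf)

theorem envLits (he : PF e) : PF (fun x => (e x).2.1) := fst.comp (snd.comp he)

theorem envLeast (he : PF e) (hf : PF f) : PF (fun x => (e x).least (f x)) :=
  (envLits he).all
    (f := fun y : α × Literal => !(e y.1).sim (f y.1) y.2 || (e y.1).rankLe (f y.1) y.2)
    ((envSim (he.comp fst) (hf.comp fst) snd).not.or (envRankLe (he.comp fst) (hf.comp fst) snd))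

theorem envGreatest (he : PF e) (hf : PF f) : PF (fun x => (e x).greatest (f x)) :=
  (envLits he).all
    (f := fun y : α × Literal => !(e y.1).sim (f y.1) y.2 || (e y.1).rankLe y.2 (f y.1))
    ((envSim (he.comp fst) (hf.comp fst) snd).not.or (envRankLe (he.comp fst) snd (hf.comp fst)))

theorem envPositive (he : PF e) (hf : PF f) : PF (fun x => (e x).positive (f x)) :=
  (envLits he).any
    (f := fun y : α × Literal => (e y.1).sim (f y.1) y.2 && ((e y.1).least y.2 && y.2.2))
    ((envSim (he.comp fst) (hf.comp fst) snd).and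
      ((envLeast (he.comp fst) snd).and (snd.comp snd)))

theorem envNext (he : PF e) (hf : PF f) (hg : PF g) : PF (fun x => (e x).next (f x) (g x)) :=
  ((envRankLe he hg hf).not.and ((envLits he).all
    (f := fun y : α × Literal => !(e y.1).sim (f y.1) y.2 ||
      ((e y.1).rankLe y.2 (f y.1) || (e y.1).rankLe (g y.1) y.2))
    ((envSim (he.comp fst) (hf.comp fst) snd).not.or
      ((envRankLe (he.comp fst) snd (hf.comp fst)).or
        (envRankLe (he.comp fst) (hg.comp fst) snd))))).or
    ((envGreatest he hf).and (envLeast he hg))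

theorem envCover (he : PF e) (hf : PF f) (hg : PF g) : PF (fun x => (e x).cover (f x) (g x)) :=
  (envLits he).all
    (f := fun y : α × Literal => !(e y.1).reach (f y.1) y.2 || (!(e y.1).reach y.2 (g y.1) ||
      ((e y.1).reach y.2 (f y.1) || (e y.1).reach (g y.1) y.2)))
    ((envReach (he.comp fst) (hf.comp fst) snd).not.or
      ((envReach (he.comp fst) snd (hg.comp fst)).not.or
        ((envReach (he.comp fst) snd (hf.comp fst)).or
          (envReach (he.comp fst) (hg.comp fst) snd))))

theorem envPrime (he : PF e) (hf : PF f) (hg : PF g) : PF (fun x => (e x).prime (f x) (g x)) :=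
  (envReach he hf hg).and ((hf.eqLit hg.compl).or
    ((envFree he hf).and ((envFree he hg).and (hf.eqLit hg).not)))

theorem envKeep (he : PF e) (hf : PF f) (hg : PF g) : PF (fun x => (e x).keep (f x) (g x)) :=
  (envReach he hf hg).and ((hf.eqLit hg.compl).or ((envFree he hf).and ((envFree he hg).and
    ((hf.eqLit hg).not.and
      (((envReach he hg hf).and ((envPositive he hf).and (envNext he hf hg))).or
        ((envReach he hg hf).not.and ((envCover he hf hg).and
          ((envLeast he hf).and (envLeast he hg)))))))))

theorem envClash (he : PF e) : PF (fun x => (e x).clash) :=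
  (envLits he).any (f := fun y : α × Literal => (e y.1).sim y.2 (KBase.compl y.2))
    (envSim (he.comp fst) snd snd.compl)

theorem selectBase {c : Env → Literal → Literal → Bool}
    (hc : PF fun y : Formula × Literal × Literal => c (KBase.envOf y.1) y.2.1 y.2.2) :
    PF (selectBase c) :=
  ((PF.id.any snd.isEmpty).or (envClash envOf)).cond (const [[]])
    (((pairs (envLits envOf)).filter hc).map
      ((fst.comp snd).compl.cons ((snd.comp snd).cons (const []))))

theorem selectBase_prime : PF (KBase.selectBase Env.prime) :=
  selectBase (envPrime (envOf.comp fst) (fst.comp snd) (snd.comp snd))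

theorem selectBase_keep : PF (KBase.selectBase Env.keep) :=
  selectBase (envKeep (envOf.comp fst) (fst.comp snd) (snd.comp snd))

end PF

/-! ### Correctness of the algorithm -/

theorem mem_toClauseSet {L : Formula} {C : Finset Literal} :
    C ∈ toClauseSet L ↔ ∃ l ∈ L, l.toFinset = C := by
  simp [toClauseSet]

theorem mem_litList {L : Formula} {p : Literal} : p ∈ litList L ↔ p.1 ∈ varList L := by
  simp only [litList, List.mem_flatMap, List.mem_cons, List.not_mem_nil, or_false]
  constructor
  · rintro ⟨n, hn, rfl | rfl⟩ <;> exact hn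
  · intro h
    refine ⟨p.1, h, ?_⟩
    rcases p with ⟨n, _ | _⟩ <;> simp

theorem mem_varList {L : Formula} {n : ℕ} : n ∈ varList L ↔ ∃ C ∈ L, ∃ x ∈ C, x.1 = n := by
  simp [varList]

theorem mem_litList_iff_mem_lits {L : Formula} {p : Literal} :
    p ∈ litList L ↔ p ∈ lits (toClauseSet L) := by
  rw [mem_litList, mem_varList, mem_lits]
  constructor
  · rintro ⟨C, hC, x, hx, e⟩
    refine ⟨_, mem_toClauseSet.2 ⟨C, hC, rfl⟩, ?_⟩
    rw [List.mem_toFinset, List.mem_toFinset]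
    rcases eq_or_eq_compl e with rfl | rfl
    · exact .inl hx
    · exact .inr hx
  · rintro ⟨D, hD, h⟩
    obtain ⟨C, hC, rfl⟩ := mem_toClauseSet.1 hD
    rw [List.mem_toFinset, List.mem_toFinset] at h
    rcases h with h | h
    · exact ⟨C, hC, p, h, rfl⟩
    · exact ⟨C, hC, compl p, h, rfl⟩

theorem mem_pairs {V : List Literal} {a : Literal × Literal} :
    a ∈ pairs V ↔ a.1 ∈ V ∧ a.2 ∈ V := by
  rcases a with ⟨p, q⟩
  simp [pairs]

theorem relMem_iff {R : List (Literal × Literal)} {p q : Literal} :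
    relMem R p q = true ↔ (p, q) ∈ R := by
  simp only [relMem, List.any_eq_true, Bool.and_eq_true, decide_eq_true_eq]
  constructor
  · rintro ⟨⟨a, b⟩, h, rfl, rfl⟩
    exact h
  · exact fun h => ⟨_, h, rfl, rfl⟩

/-- Lists may contain repetitions and any order, so both inclusions are tested rather than equality
of lists. -/
theorem arcTest_iff {L : Formula} {p q : Literal} :
    arcTest L p q = true ↔ Arc (toClauseSet L) p q := by
  rw [Arc, mem_toClauseSet]
  simp only [arcTest, List.any_eq_true, Bool.and_eq_true, List.all_eq_true, Bool.or_eq_true,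
    decide_eq_true_eq]
  refine exists_congr fun C => and_congr_right fun _ => ?_
  constructor
  · rintro ⟨⟨_, h₁, rfl⟩, ⟨_, h₂, rfl⟩, h⟩
    ext x
    rw [List.mem_toFinset, Finset.mem_insert, Finset.mem_singleton]
    refine ⟨h x, ?_⟩
    rintro (rfl | rfl) <;> assumption
  · intro h
    have hm : ∀ x, x ∈ C ↔ x = compl p ∨ x = q := fun x => by
      rw [← List.mem_toFinset, h, Finset.mem_insert, Finset.mem_singleton]
    exact ⟨⟨_, (hm _).2 (.inl rfl), rfl⟩, ⟨_, (hm _).2 (.inr rfl), rfl⟩, fun x hx => (hm x).1 hx⟩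

theorem mem_arcList {L : Formula} {p q : Literal} :
    (p, q) ∈ arcList L ↔ (p ∈ litList L ∧ q ∈ litList L) ∧ (p = q ∨ Arc (toClauseSet L) p q) := by
  simp only [arcList, List.mem_filter, mem_pairs, Bool.or_eq_true, decide_eq_true_eq, arcTest_iff]

theorem mem_pivotStep {V : List Literal} {R : List (Literal × Literal)} {v p q : Literal} :
    (p, q) ∈ pivotStep V R v ↔
      (p ∈ V ∧ q ∈ V) ∧ ((p, q) ∈ R ∨ (p, v) ∈ R ∧ (v, q) ∈ R) := by
  simp only [pivotStep, List.mem_filter, mem_pairs, Bool.or_eq_true, Bool.and_eq_true, relMem_iff]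

theorem foldl_pivotStep_sound {F : ClauseSet} {V : List Literal} (l : List Literal)
    {R : List (Literal × Literal)} (hR : ∀ p q, (p, q) ∈ R → Reach F p q) {p q : Literal}
    (h : (p, q) ∈ l.foldl (pivotStep V) R) : Reach F p q := by
  induction l generalizing R with
  | nil => exact hR p q h
  | cons v l ih =>
    refine ih (fun p q h => ?_) h
    rcases (mem_pivotStep.1 h).2 with h | ⟨h₁, h₂⟩
    · exact hR p q h
    · exact (hR p v h₁).trans (hR v q h₂)

/-- Warshall's invariant, with `P` the set of pivots already treated: pairs can be composed at every
such pivot, and a further round preserves this. -/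
theorem foldl_pivotStep_complete {V : List Literal} (l : List Literal) (P : Literal → Prop)
    {R : List (Literal × Literal)} (hV : ∀ p q, (p, q) ∈ R → p ∈ V ∧ q ∈ V)
    (hP : ∀ v, P v → ∀ p q, (p, v) ∈ R → (v, q) ∈ R → (p, q) ∈ R) :
    (∀ p q, (p, q) ∈ R → (p, q) ∈ l.foldl (pivotStep V) R) ∧
    ∀ v, P v ∨ v ∈ l → ∀ p q, (p, v) ∈ l.foldl (pivotStep V) R →
      (v, q) ∈ l.foldl (pivotStep V) R → (p, q) ∈ l.foldl (pivotStep V) R := by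
  induction l generalizing R P with
  | nil => exact ⟨fun p q h => h, fun v hv => hP v (hv.resolve_right (List.not_mem_nil))⟩
  | cons w l ih =>
    have hsub : ∀ p q, (p, q) ∈ R → (p, q) ∈ pivotStep V R w := fun p q h =>
      mem_pivotStep.2 ⟨hV p q h, .inl h⟩
    obtain ⟨h₁, h₂⟩ := ih (fun v => P v ∨ v = w) (R := pivotStep V R w)
      (fun p q h => (mem_pivotStep.1 h).1) (by
        intro v hv p q hpv hvq
        obtain ⟨⟨hp, -⟩, hpv⟩ := mem_pivotStep.1 hpv
        obtain ⟨⟨-, hq⟩, hvq⟩ := mem_pivotStep.1 hvq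
        refine mem_pivotStep.2 ⟨⟨hp, hq⟩, ?_⟩
        rcases hv with hv | rfl
        · rcases hpv with hpv | ⟨a₁, a₂⟩ <;> rcases hvq with hvq | ⟨b₁, b₂⟩
          · exact .inl (hP v hv p q hpv hvq)
          · exact .inr ⟨hP v hv p w hpv b₁, b₂⟩
          · exact .inr ⟨a₁, hP v hv w q a₂ hvq⟩
          · exact .inr ⟨a₁, b₂⟩
        · exact .inr ⟨hpv.elim id And.left, hvq.elim id And.right⟩)
    refine ⟨fun p q h => h₁ p q (hsub p q h), fun v hv => h₂ v ?_⟩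
    rcases hv with hv | hv
    · exact .inl (.inl hv)
    · rcases List.mem_cons.1 hv with hv | hv
      · exact .inl (.inr hv)
      · exact .inr hv

/-- Inner vertices of a path occur in the formula and have thus been pivots. The hypothesis on `p`
is needed for the empty path, which exists at every literal. -/
theorem mem_reachList {L : Formula} {p q : Literal} (hp : p ∈ litList L) :
    (p, q) ∈ reachList L ↔ Reach (toClauseSet L) p q := by
  constructor
  · refine foldl_pivotStep_sound _ fun p q h => ?_
    rcases (mem_arcList.1 h).2 with rfl | h
    · exact .refl
    · exact .single h
  · intro h
    obtain ⟨h₁, h₂⟩ := foldl_pivotStep_complete (V := litList L) (litList L) (fun _ => False)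
      (R := arcList L) (fun p q h => (mem_arcList.1 h).1) (fun _ h => h.elim)
    induction h with
    | refl => exact h₁ p p (mem_arcList.2 ⟨⟨hp, hp⟩, .inl rfl⟩)
    | @tail r s _ hrs ih =>
      have hm := hrs.mem_lits
      rw [← mem_litList_iff_mem_lits, ← mem_litList_iff_mem_lits] at hm
      exact h₂ r (.inr hm.1) p s ih (h₁ r s (mem_arcList.2 ⟨hm, .inr hrs⟩))

/-- Positions are compared without arithmetic: among the occurrences of `m` and `n`, the earliest
one decides. As `m` occurs, the filtered list is nonempty and the default value is never used. -/
theorem headD_filter_eq_iff {U : List ℕ} {m n : ℕ} (hm : m ∈ U) :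
    (U.filter fun k => decide (k = m) || decide (k = n)).headD m = m ↔
      U.idxOf m ≤ U.idxOf n := by
  induction U with
  | nil => simp at hm
  | cons k U ih =>
    by_cases h₁ : k = m
    · subst h₁
      simp
    · by_cases h₂ : k = n
      · subst h₂
        simp [h₁]
      · have hm' : m ∈ U := (List.mem_cons.1 hm).resolve_left (Ne.symm h₁)
        rw [List.filter_cons_of_neg (by simp [h₁, h₂]), ih hm', List.idxOf_cons_ne _ h₁,
          List.idxOf_cons_ne _ h₂]
        exact Nat.succ_le_succ_iff.symm

/-- The rank of a variable is the position of its first occurrence. -/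
def rank (L : Formula) (n : ℕ) : ℕ := (varList L).idxOf n

theorem compl_mem_litList {L : Formula} {p : Literal} (hp : p ∈ litList L) :
    compl p ∈ litList L := by
  have h := mem_litList.1 hp
  exact (mem_litList (p := compl p)).2 h

theorem Reach.mem_litList {L : Formula} {p q : Literal} (h : Reach (toClauseSet L) p q)
    (hp : p ∈ litList L) : q ∈ litList L := by
  rcases h.eq_or_mem_lits with rfl | h
  · exact hp
  · exact mem_litList_iff_mem_lits.2 h.2

theorem Reach.mem_litList_of_ne {L : Formula} {p q : Literal} (h : Reach (toClauseSet L) p q)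
    (hne : p ≠ q) : p ∈ litList L ∧ q ∈ litList L := by
  rw [mem_litList_iff_mem_lits, mem_litList_iff_mem_lits]
  exact h.eq_or_mem_lits.resolve_left hne

/-- Positions separate occurring variables, and a literal that does not occur is alone in its
component. -/
theorem rankInj_rank (L : Formula) : RankInj (toClauseSet L) (rank L) := by
  intro p q h e
  by_cases hpq : p = q
  · rw [hpq]
  · exact (List.idxOf_inj (mem_litList.1 (h.1.mem_litList_of_ne hpq).1)).1 e

/-! ### Correctness of the Boolean tests -/

section envOf

variable {L : Formula} {p q : Literal}

theorem envOf_reach (hp : p ∈ litList L) :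
    (envOf L).reach p q = true ↔ Reach (toClauseSet L) p q :=
  relMem_iff.trans (mem_reachList hp)

theorem envOf_sim (hp : p ∈ litList L) (hq : q ∈ litList L) :
    (envOf L).sim p q = true ↔ Sim (toClauseSet L) p q := by
  rw [Env.sim, Bool.and_eq_true, envOf_reach hp, envOf_reach hq, Sim]

theorem envOf_free (hp : p ∈ litList L) :
    (envOf L).free p = true ↔ Free (toClauseSet L) p := by
  rw [Env.free, Bool.and_eq_true, Bool.not_eq_true', Bool.not_eq_true', ← Bool.not_eq_true,
    ← Bool.not_eq_true, envOf_reach hp, envOf_reach (compl_mem_litList hp), Free]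

theorem envOf_rankLe (hp : p ∈ litList L) :
    (envOf L).rankLe p q = true ↔ rank L p.1 ≤ rank L q.1 := by
  rw [Env.rankLe, decide_eq_true_eq]
  exact headD_filter_eq_iff (mem_litList.1 hp)

/-- Quantifying over the listed literals is enough, because the component of a listed literal is
listed. -/
theorem envOf_all_sim (hp : p ∈ litList L) {c : Literal → Bool} {P : Literal → Prop}
    (h : ∀ r ∈ litList L, c r = true ↔ P r) :
    ((envOf L).2.1.all fun r => !(envOf L).sim p r || c r) = true ↔
      ∀ r, Sim (toClauseSet L) p r → P r := by
  simp only [List.all_eq_true, Bool.or_eq_true, Bool.not_eq_true', ← Bool.not_eq_true,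
    ← imp_iff_not_or]
  constructor
  · intro hall r hr
    have hm := hr.1.mem_litList hp
    exact (h r hm).1 (hall r hm ((envOf_sim hp hm).2 hr))
  · intro hall r hm hr
    exact (h r hm).2 (hall r ((envOf_sim hp hm).1 hr))

theorem envOf_least (hp : p ∈ litList L) :
    (envOf L).least p = true ↔ LeastIn (toClauseSet L) (rank L) p :=
  envOf_all_sim hp fun _ _ => envOf_rankLe hp

theorem envOf_greatest (hp : p ∈ litList L) :
    (envOf L).greatest p = true ↔ GreatestIn (toClauseSet L) (rank L) p :=
  envOf_all_sim hp fun _ hr => envOf_rankLe hr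

theorem envOf_positive (hp : p ∈ litList L) :
    (envOf L).positive p = true ↔ PositiveIn (toClauseSet L) (rank L) p := by
  simp only [Env.positive, List.any_eq_true, Bool.and_eq_true]
  constructor
  · rintro ⟨r, hm, hr, hl, h⟩
    exact ⟨r, (envOf_sim hp hm).1 hr, (envOf_least hm).1 hl, h⟩
  · rintro ⟨r, hr, hl, h⟩
    have hm := hr.1.mem_litList hp
    exact ⟨r, hm, (envOf_sim hp hm).2 hr, (envOf_least hm).2 hl, h⟩

theorem envOf_next (hp : p ∈ litList L) (hq : q ∈ litList L) :
    (envOf L).next p q = true ↔ NextIn (toClauseSet L) (rank L) p q := by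
  rw [Env.next, Bool.or_eq_true, Bool.and_eq_true, Bool.and_eq_true, envOf_greatest hp,
    envOf_least hq, NextIn, Bool.not_eq_true', ← Bool.not_eq_true, envOf_rankLe hq, not_le]
  refine or_congr_left (and_congr_right fun _ => envOf_all_sim hp fun r hr => ?_)
  rw [Bool.or_eq_true, envOf_rankLe hr, envOf_rankLe hq]
  omega

theorem envOf_cover (hp : p ∈ litList L) (hq : q ∈ litList L) :
    (envOf L).cover p q = true ↔ Cover (toClauseSet L) p q := by
  simp only [Env.cover, List.all_eq_true, Bool.or_eq_true, Bool.not_eq_true', ← Bool.not_eq_true,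
    ← imp_iff_not_or]
  constructor
  · intro hall r h₁ h₂
    have hm := h₁.mem_litList hp
    have := hall r hm ((envOf_reach hp).2 h₁) ((envOf_reach hm).2 h₂)
    rwa [envOf_reach hm, envOf_reach hq] at this
  · intro hall r hm h₁ h₂
    rw [envOf_reach hm, envOf_reach hq]
    exact hall r ((envOf_reach hp).1 h₁) ((envOf_reach hm).1 h₂)

theorem envOf_prime (hp : p ∈ litList L) (hq : q ∈ litList L) :
    (envOf L).prime p q = true ↔ Reach (toClauseSet L) p q ∧
      (p = compl q ∨ Free (toClauseSet L) p ∧ Free (toClauseSet L) q ∧ p ≠ q) := by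
  simp only [Env.prime, Bool.and_eq_true, Bool.or_eq_true, decide_eq_true_eq, Bool.not_eq_true',
    decide_eq_false_iff_not, envOf_reach hp, envOf_free hp, envOf_free hq, ne_eq]

theorem envOf_keep (hp : p ∈ litList L) (hq : q ∈ litList L) :
    (envOf L).keep p q = true ↔ Keep (toClauseSet L) (rank L) p q := by
  simp only [Env.keep, Keep, Bool.and_eq_true, Bool.or_eq_true, decide_eq_true_eq,
    Bool.not_eq_true', envOf_reach hp, envOf_reach hq, envOf_free hp,
    envOf_free hq, ne_eq, envOf_positive hp, envOf_next hp hq, envOf_cover hp hq, envOf_least hp,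
    envOf_least hq, ← Bool.not_eq_true]

theorem envOf_clash : (envOf L).clash = true ↔ ¬ NoClash (toClauseSet L) := by
  simp only [Env.clash, List.any_eq_true, NoClash, not_forall, not_not]
  constructor
  · rintro ⟨x, hx, h⟩
    exact ⟨x, (envOf_sim hx (compl_mem_litList hx)).1 h⟩
  · rintro ⟨x, h⟩
    have hx := (h.1.mem_litList_of_ne (compl_ne x).symm).1
    exact ⟨x, hx, (envOf_sim hx (compl_mem_litList hx)).2 h⟩

theorem mem_select {c : Env → Literal → Literal → Bool} {P : Literal → Literal → Prop}
    (hc : ∀ p ∈ litList L, ∀ q ∈ litList L, c (envOf L) p q = true ↔ P p q)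
    (hP : ∀ p q, P p q → p ∈ litList L ∧ q ∈ litList L) {C : Finset Literal} :
    C ∈ toClauseSet ((envOf L).select c) ↔ ∃ p q, P p q ∧ C = {compl p, q} := by
  rw [mem_toClauseSet]
  simp only [Env.select, List.mem_map, List.mem_filter]
  constructor
  · rintro ⟨_, ⟨⟨p, q⟩, ⟨hm, h⟩, rfl⟩, rfl⟩
    obtain ⟨hp, hq⟩ := mem_pairs.1 hm
    exact ⟨p, q, (hc p hp q hq).1 h, by simp⟩
  · rintro ⟨p, q, h, rfl⟩
    obtain ⟨hp, hq⟩ := hP p q h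
    exact ⟨_, ⟨(p, q), ⟨mem_pairs.2 ⟨hp, hq⟩, (hc p hp q hq).2 h⟩, rfl⟩, by simp⟩

end envOf

theorem selectBase_eq {L : Formula} (hL : IsTwoCNF (toClauseSet L))
    (c : Env → Literal → Literal → Bool) :
    (¬ Satisfiable (toClauseSet L) → selectBase c L = [[]]) ∧
      (Satisfiable (toClauseSet L) → selectBase c L = (envOf L).select c) := by
  have h : ((L.any fun C => C.isEmpty) || (envOf L).clash) = true ↔
      ¬ Satisfiable (toClauseSet L) := by
    rw [satisfiable_iff hL, not_and_or, not_not, Bool.or_eq_true, envOf_clash, mem_toClauseSet]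
    simp
  constructor
  · intro hs
    rw [selectBase, h.2 hs, cond_true]
  · intro hs
    have : ((L.any fun C => C.isEmpty) || (envOf L).clash) = false := by
      rw [← Bool.not_eq_true, h, not_not]
      exact hs
    rw [selectBase, this, cond_false]

/-- At level 0 uniqueness makes the base shortest. From level 1 on a single selection works, as
being a smallest equivalent set of prime implicates does not involve `k`. -/
theorem isShortestKBase_selectBase {L : Formula} (hL : IsTwoCNF (toClauseSet L)) :
    IsShortestKBase numClauses 0 (toClauseSet L) (toClauseSet (selectBase Env.prime L)) ∧
      ∀ k : ℕ∞, 1 ≤ k →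
        IsShortestKBase numClauses k (toClauseSet L) (toClauseSet (selectBase Env.keep L)) := by
  by_cases hs : Satisfiable (toClauseSet L)
  · rw [(selectBase_eq hL _).2 hs, (selectBase_eq hL _).2 hs]
    have hne : ∀ {p q}, (p = compl q ∨ Free (toClauseSet L) p ∧ Free (toClauseSet L) q ∧ p ≠ q) →
        p ≠ q := by
      rintro p q (rfl | ⟨-, -, h⟩)
      · exact compl_ne q
      · exact h
    constructor
    · have hG := (isEquivKBase_zero_iff (G := toClauseSet ((envOf L).select Env.prime)) hL.1).2
        fun C => by
          rw [isPrimeImplicate_iff_reach hL hs, mem_select (fun p hp q hq => envOf_prime hp hq)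
            fun p q h => h.1.mem_litList_of_ne (hne h.2)]
      refine ⟨hG, fun H hH => le_of_eq (congrArg _ ?_)⟩
      ext C
      rw [(isEquivKBase_zero_iff hL.1).1 hG, (isEquivKBase_zero_iff hL.1).1 hH]
    · intro k hk
      refine (isShortestKBase_iff_isSmallestPrimeSubset hL hk).2
        (isSmallestPrimeSubset_of_keep hL hs (rankInj_rank L) fun C => ?_)
      exact mem_select (fun p hp q hq => envOf_keep hp hq) fun p q h =>
        h.1.mem_litList_of_ne (hne (h.2.imp_right fun h => ⟨h.1, h.2.1, h.2.2.1⟩))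
  · rw [(selectBase_eq hL _).1 hs, (selectBase_eq hL _).1 hs]
    have e : toClauseSet [[]] = {∅} := rfl
    rw [e]
    exact ⟨(isShortestKBase_of_unsatisfiable hs 0).1,
      fun k _ => (isShortestKBase_of_unsatisfiable hs k).1⟩

end KBase

open KBase in
theorem theorem7p2 :
    -- Polynomial-time computation of shortest equivalent `k`-bases, in both measures;
    -- one algorithm serves all `k ≥ 1`.
    (∃ f : ℕ∞ → Formula → Formula,
      (∀ k, PolyTime (f k)) ∧ (∀ k, 1 ≤ k → f k = f 1) ∧
      ∀ (k : ℕ∞) (L : Formula), IsTwoCNF (toClauseSet L) →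
        IsShortestKBase numClauses k (toClauseSet L) (toClauseSet (f k L)) ∧
        IsShortestKBase numLitOcc k (toClauseSet L) (toClauseSet (f k L))) ∧
    -- The facts on which the computation rests.
    ∀ (F : ClauseSet), IsTwoCNF F →
      -- `F` unsatisfiable
      (¬ Satisfiable F → ∀ (k : ℕ∞),
        IsShortestKBase numClauses k F {∅} ∧ IsShortestKBase numLitOcc k F {∅}) ∧
      -- `F` empty
      (F = ∅ → ∀ (k : ℕ∞),
        IsShortestKBase numClauses k F ∅ ∧ IsShortestKBase numLitOcc k F ∅) ∧
      -- splitting off a forced literal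
      (Satisfiable F → ∀ (x : Literal), Forced F x → ∀ (k : ℕ∞),
        (∀ G, IsEquivKBase k F G → {x} ∈ G) ∧
        (∀ G, IsShortestKBase numClauses k (setTrue x F) G →
          IsShortestKBase numClauses k F (insert {x} G)) ∧
        (∀ G, IsShortestKBase numLitOcc k (setTrue x F) G →
          IsShortestKBase numLitOcc k F (insert {x} G))) ∧
      -- without forced literals all clauses and all prime implicates have length 2
      (Satisfiable F → (∀ x, ¬ Forced F x) →
        (∀ C ∈ F, C.card = 2) ∧ ∀ C, IsPrimeImplicate F C → C.card = 2) ∧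
      -- `k`-bases consist of prime implicates, and the two measures agree
      (∀ (k : ℕ∞) (G : ClauseSet),
        (IsEquivKBase k F G → ∀ C ∈ G, IsPrimeImplicate F C) ∧
        (IsShortestKBase numClauses k F G ↔ IsShortestKBase numLitOcc k F G)) ∧
      -- the prime implicates have length at most 2 and form the unique 0-base
      (∀ C, IsPrimeImplicate F C → C.card ≤ 2) ∧
      (∀ G, IsEquivKBase 0 F G ↔ ∀ C, C ∈ G ↔ IsPrimeImplicate F C) ∧
      -- `∞`-bases are 1-bases; for `k ≥ 1` the shortest `k`-bases are precisely the smallest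
      -- equivalent sets of prime implicates
      (∀ G, IsEquivKBase ⊤ F G → IsKBase 1 G) ∧
      (∀ (k : ℕ∞), 1 ≤ k → ∀ G,
        IsShortestKBase numClauses k F G ↔ IsSmallestPrimeSubset F G) := by
  classical
  -- Only level 0 requires all prime implicates; every other level, including `⊤`, uses the same
  -- selection.
  refine ⟨⟨fun k => if k = 0 then selectBase Env.prime else selectBase Env.keep,
    fun k => ?_, fun k hk => ?_, fun k L hL => ?_⟩, fun F hF => ⟨isShortestKBase_of_unsatisfiable,
    fun h k => h ▸ isShortestKBase_empty k, fun hs x hx k => ⟨fun G hG =>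
      hG.isEquivPrimeSubset.unit_mem_of_forced hs hx, fun G hG =>
      isShortestKBase_insert_unit hs hx (fun _ => numClauses_insert_unit) hG, fun G hG =>
      isShortestKBase_insert_unit hs hx (fun _ => numLitOcc_insert_unit) hG⟩,
    card_eq_two_of_not_forced hF, fun k G => ⟨fun h C hC => h.isPrimeImplicate hC,
      isShortestKBase_numClauses_iff hF⟩, fun C hC => hC.card_le_two hF,
    fun G => isEquivKBase_zero_iff hF.1, fun G h => h.isKBase_one hF,
    fun k hk G => isShortestKBase_iff_isSmallestPrimeSubset hF hk⟩⟩
  · dsimp only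
    split_ifs
    · exact PF.selectBase_prime.polyTime
    · exact PF.selectBase_keep.polyTime
  · simp [Order.one_le_iff_pos.1 hk |>.ne']
  · have key : IsShortestKBase numClauses k (toClauseSet L) (toClauseSet
        ((if k = 0 then selectBase Env.prime else selectBase Env.keep) L)) := by
      split_ifs with hk
      · exact hk ▸ (isShortestKBase_selectBase hL).1
      · exact (isShortestKBase_selectBase hL).2 k (Order.one_le_iff_ne_zero.2 hk)
    exact ⟨key, (isShortestKBase_numClauses_iff hL).1 key⟩
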